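/- Let $b\ge 0$ and let $D$ be a closed braid graph on $b$ strands: the closure of a word in the singular crossings $\sigma_1,\dots,\sigma_{b-1}$ (the $4$-valent vertices with two incoming and two outgoing edges in columns $1,\dots,b-1$), viewed as an oriented graph whose vertices are singular crossings and bivalent marks. *Homology.* Let $R(D)=\mathbb{Q}[X_e : e \text{ an edge of } D]/(\rho(v) : v\text{ a vertex of }D)$, where $\rho(v)$ is the sum of the variables of the edges leaving $v$ minus the sum of the variables of the edges entering $v$, graded by $q(X_e)=2$. Let $\widetilde C(D)$ be the tensor product over $R=R(D)$ of one complex $$R\{1,-2\}\xrightarrow{\;X_kX_l-X_iX_j\;}R\{-1,0\}$$ for each crossing, with incoming edges $i,j$ and outgoing edges $k,l$, and one complex $$R\{0,-2\}\xrightarrow{\;0\;}R\{0,0\}$$ for each connected component of $D$; here $R\{i,j\}$ denotes the free module whose generator has bidegree $(q,2\,\mathrm{gr}_h)=(i,j)$. Let $\widetilde H^{i,j}(D)$ be the part of bidegree $(i,j)$ of the homology of $\widetilde C(D)$ (the unreduced HOMFLY homology of $D$, without overall shift). *Polynomial.* Let $\widetilde P$ be the MOY HOMFLY polynomial, that is,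 the isotopy invariant of closed braid graphs with values in $\mathbb{Q}(a,q)$ that equals $1$ on the empty graph and satisfies the MOY relations, in which $u,v$ are words: $$\begin{aligned} \text{(O)}\quad & \widetilde P(u\sqcup\text{circle}) = \tfrac{a-a^{-1}}{q-q^{-1}}\,\widetilde P(u) && (u \text{ on } b \text{ strands; the circle is an additional strand } b+1),\\ \text{(I)}\quad & \widetilde P(u\,\sigma_b\,v) = \tfrac{aq^{-1}-a^{-1}q}{q-q^{-1}}\,\widetilde P(uv) && (u,v \text{ on } b\ge1 \text{ strands; } u\sigma_bv \text{ on } b+1 \text{ strands}),\\ \text{(II)}\quad & \widetilde P(u\,\sigma_i\sigma_i\,v)=(q+q^{-1})\,\widetilde P(u\,\sigma_i\,v),\\ \text{(III)}\quad & \widetilde P(u\,\sigma_{i+1}\sigma_i\sigma_{i+1}\,v)+\widetilde P(u\,\sigma_i\,v)=\widetilde P(u\,\sigma_i\sigma_{i+1}\sigma_i\,v)+\widetilde P(u\,\sigma_{i+1}\,v). \end{aligned}$$ Isotopy invariance means $\widetilde P(u\sigma_i\sigma_jv)=\widetilde P(u\sigma_j\sigma_iv)$ for $|i-j|\ge2$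 and $\widetilde P(uv)=\widetilde P(vu)$. **Claim.** The function $\widetilde P$ exists and is uniquely determined by these conditions. For every $b\ge 0$ and every closed braid graph $D$ on $b$ strands, each $\widetilde H^{i,j}(D)$ is finite-dimensional over $\mathbb{Q}$, only finitely many values of $j$ occur, and the signed Poincaré series satisfies $$\sum_{i,j}(-1)^{j/2}a^jq^i\dim_{\mathbb{Q}}\widetilde H^{i,j}(D)=(-aq)^{-b}\,\widetilde P(D),$$ where the right-hand side is expanded as a Laurent series in $q$ over $\mathbb{Q}(a)$. -/

import Mathlib

open scoped LaurentSeries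

noncomputable section

namespace KR

/-! ### Closed singular graphs and their edge rings -/

/-- The combinatorial data of a closed graph all of whose crossings are singular.  A crossing has
two incoming and two outgoing edges; a mark (bivalent vertex) has one incoming and one outgoing
edge. -/
structure ClosedGraph where
  /-- the number of crossings; the crossings are numbered by `Fin numCrossings` -/
  numCrossings : ℕ
  Edge : Type
  [finiteEdge : Finite Edge]
  Mark : Type
  inL : Fin numCrossings → Edge
  inR : Fin numCrossings → Edge
  outL : Fin numCrossings → Edge
  outR : Fin numCrossings → Edge
  markIn : Mark → Edge
  markOut : Mark → Edge

namespace ClosedGraph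

variable (D : ClosedGraph)

/-- The linear relator of a mark: outgoing minus incoming variable. -/
def markRelator (v : D.Mark) : MvPolynomial D.Edge ℚ :=
  MvPolynomial.X (D.markOut v) - MvPolynomial.X (D.markIn v)

/-- The linear relator of a crossing: outgoing minus incoming variables. -/
def crossingRelator (c : Fin D.numCrossings) : MvPolynomial D.Edge ℚ :=
  MvPolynomial.X (D.outL c) + MvPolynomial.X (D.outR c)
    - MvPolynomial.X (D.inL c) - MvPolynomial.X (D.inR c)

/-- The ideal generated by the relators of all vertices. -/
def relatorIdeal : Ideal (MvPolynomial D.Edge ℚ) :=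
  Ideal.span (Set.range D.markRelator ∪ Set.range D.crossingRelator)

/-- The edge ring `R(D)`. -/
abbrev EdgeRing : Type := MvPolynomial D.Edge ℚ ⧸ D.relatorIdeal

/-- The class of the variable of an edge in the edge ring. -/
def x (e : D.Edge) : D.EdgeRing := Ideal.Quotient.mk D.relatorIdeal (MvPolynomial.X e)

/-- The homogeneous part of `R(D)` of `q`-degree `k`, where every edge variable has `q`-degree `2`:
the image of the polynomials of degree `m` if `k = 2 m` with `m` a natural number, and `0` for
every other `k`. -/
def edgeRingPart (k : ℤ) : Submodule ℚ D.EdgeRing :=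
  ⨆ (m : ℕ) (_ : 2 * (m : ℤ) = k),
    (MvPolynomial.homogeneousSubmodule D.Edge ℚ m).map
      (Ideal.Quotient.mkₐ ℚ D.relatorIdeal).toLinearMap

/-! ### Connected components -/

/-- Two edges meet if they have a vertex in common. -/
def Meet (e e' : D.Edge) : Prop :=
  (∃ v, (e = D.markIn v ∨ e = D.markOut v) ∧ (e' = D.markIn v ∨ e' = D.markOut v)) ∨
  (∃ c, (e = D.inL c ∨ e = D.inR c ∨ e = D.outL c ∨ e = D.outR c) ∧
    (e' = D.inL c ∨ e' = D.inR c ∨ e' = D.outL c ∨ e' = D.outR c))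

/-- The connected components of the underlying graph. -/
abbrev Component : Type := (SimpleGraph.fromRel D.Meet).ConnectedComponent

/-! ### The unreduced complex with the differential `d₊`

The unreduced complex is the tensor product over `R = R(D)` of one short complex
`R{1,-2} ⟶ R{-1,0}` for each crossing, whose map is multiplication by `X_k X_l - X_i X_j`
(`i`, `j` incoming, `k`, `l` outgoing), and of one short complex `R{0,-2} ⟶ R{0,0}` with zero map
for each connected component.  The shifts `{i,j}` refer to the bigrading `(q, 2 gr_h)`.
As a module this is free on the pairs `(S, T)`, where `S` is the set of those crossings and `T`
the set of those components for which the generator of the target is taken.  All crossings being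
singular, the vertical differential vanishes.  The differential `d₋`, the only place in
which the parameter `p` of the KR-complex enters, does not occur in the HOMFLY homology. -/

/-- Labels of the `R(D)`-basis of the unreduced complex. -/
abbrev BasisIndex : Type := Finset (Fin D.numCrossings) × Finset D.Component

/-- The underlying module of the unreduced complex. -/
abbrev Chain : Type := D.BasisIndex → D.EdgeRing

/-- The horizontal grading `gr_h` of a basis element: each source generator contributes `-1`. -/
def grH (s : D.BasisIndex) : ℤ :=
  ((s.1.card : ℤ) - D.numCrossings) + ((s.2.card : ℤ) - Nat.card D.Component)

/-- The `q`-grading of a basis element: `-1` for every crossing in `S`, and `+1` for every other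
crossing. -/
def qShift (s : D.BasisIndex) : ℤ := (D.numCrossings : ℤ) - 2 * s.1.card

/-- The polynomial `X_k X_l - X_i X_j` of a crossing with incoming edges `i`, `j` and outgoing
edges `k`, `l`. -/
def quad (c : Fin D.numCrossings) : D.EdgeRing :=
  D.x (D.outL c) * D.x (D.outR c) - D.x (D.inL c) * D.x (D.inR c)

/-- The differential `d₊`, with the usual Koszul signs. -/
def dPlus : D.Chain →ₗ[D.EdgeRing] D.Chain :=
  LinearMap.pi fun s => ∑ c ∈ s.1,
    ((-1 : D.EdgeRing) ^ (s.1.filter (· < c)).card * D.quad c) •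
      LinearMap.proj (R := D.EdgeRing) (φ := fun _ : D.BasisIndex => D.EdgeRing)
        (s.1.erase c, s.2)

/-- The part of the complex of bidegree `(q, gr_h) = (i, h)`. -/
def chainPart (i h : ℤ) : Submodule ℚ D.Chain :=
  Submodule.pi Set.univ fun s => if D.grH s = h then D.edgeRingPart (i - D.qShift s) else ⊥

/-- The cycles of bidegree `(q, gr_h) = (i, h)`. -/
def cycles (i h : ℤ) : Submodule ℚ D.Chain :=
  (LinearMap.ker D.dPlus).restrictScalars ℚ ⊓ D.chainPart i h

/-- The unreduced HOMFLY homology in bidegree `(q, gr_h) = (i, h)`, that is in bidegree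
`(q, 2 gr_h) = (i, 2h)`: cycles of this bidegree modulo those which are boundaries. -/
abbrev Homology (i h : ℤ) : Type :=
  D.cycles i h ⧸ ((LinearMap.range D.dPlus).restrictScalars ℚ).comap (D.cycles i h).subtype

/-- The homology vanishes in `q`-degrees below `-n`, with `n` the number of crossings. -/
theorem finrank_homology_eq_zero {i : ℤ} (hi : i < -(D.numCrossings : ℤ)) (h : ℤ) :
    Module.finrank ℚ (D.Homology i h) = 0 := by
  have hpart : ∀ k : ℤ, k < 0 → D.edgeRingPart k = ⊥ := by
    intro k hk
    simp only [edgeRingPart, iSup_eq_bot]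
    intro m hm
    omega
  have hchain : D.chainPart i h = ⊥ := by
    rw [eq_bot_iff]
    intro f hf
    rw [Submodule.mem_bot]
    funext s
    have h1 := (Submodule.mem_pi.mp hf) s (Set.mem_univ s)
    have hcard : s.1.card ≤ D.numCrossings := by
      simpa using Finset.card_le_univ s.1
    have hneg : i - D.qShift s < 0 := by
      unfold qShift
      omega
    rw [hpart _ hneg] at h1
    simpa using h1
  have hcyc : D.cycles i h = ⊥ := by
    rw [cycles, hchain, inf_bot_eq]
  have hs : Subsingleton (D.cycles i h) := by
    rw [hcyc]
    infer_instance
  have : Subsingleton (D.Homology i h) :=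
    (Submodule.mkQ_surjective _).subsingleton
  exact Module.finrank_zero_of_subsingleton

end ClosedGraph

/-! ### Closed braid graphs -/

/-- The columns in which a crossing of a braid graph on `b` strands can lie.  Column `i` lies
between strands `i` and `i + 1`, where the strands are numbered `0, …, b - 1` from left to right. -/
abbrev Column (b : ℕ) : Type := {i : ℕ // i + 1 < b}

/-- An open braid graph on `b` strands, given by the columns of its singular crossings in the order
in which they occur.  It stands for its closure. -/
abbrev BraidGraph (b : ℕ) : Type := List (Column b)

/-- The closure of a braid graph.  The edge `(t, s)` is the piece of strand `s` between the `t`-th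
crossing and the next one, so that strands which do not take part in a crossing carry a mark at
its level.  The last group of marks joins the top ends to the bottom ends. -/
def closure {b : ℕ} (w : BraidGraph b) : ClosedGraph where
  numCrossings := w.length
  Edge := Fin (w.length + 1) × Fin b
  Mark := {v : Fin w.length × Fin b //
    (v.2 : ℕ) ≠ (w.get v.1).1 ∧ (v.2 : ℕ) ≠ (w.get v.1).1 + 1} ⊕ Fin b
  inL c := (c.castSucc, ⟨(w.get c).1, Nat.lt_of_succ_lt (w.get c).2⟩)
  inR c := (c.castSucc, ⟨(w.get c).1 + 1, (w.get c).2⟩)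
  outL c := (c.succ, ⟨(w.get c).1, Nat.lt_of_succ_lt (w.get c).2⟩)
  outR c := (c.succ, ⟨(w.get c).1 + 1, (w.get c).2⟩)
  markIn := Sum.elim (fun v => (v.1.1.castSucc, v.1.2)) (fun s => (Fin.last _, s))
  markOut := Sum.elim (fun v => (v.1.1.succ, v.1.2)) (fun s => (0, s))

/-! ### The signed Poincaré series -/

/-- The field `ℚ(a, q)`, realised as rational functions in `q` over `ℚ(a)`. -/
abbrev QAQ : Type := RatFunc (RatFunc ℚ)

/-- The variable `q`. -/
def q : QAQ := RatFunc.X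

/-- The variable `a` in the coefficient field `ℚ(a)`. -/
def a₀ : RatFunc ℚ := RatFunc.X

/-- The variable `a`. -/
def a : QAQ := RatFunc.C a₀

/-- The expansion of a rational function in `q` as a Laurent series in `q` over `ℚ(a)`. -/
def expand (f : QAQ) : (RatFunc ℚ)⸨X⸩ := f

/-- The signed Poincaré series `∑_{i,j} (-1)^{j/2} a^j q^i dim H^{i,j}` as a Laurent series in `q`
over `ℚ(a)`; here `j = 2h`, as the second grading of the homology is twice `gr_h`. -/
def poincare (D : ClosedGraph) : (RatFunc ℚ)⸨X⸩ :=
  HahnSeries.ofSuppBddBelow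
    (fun i : ℤ => ∑ᶠ h : ℤ,
      (-1 : RatFunc ℚ) ^ h * a₀ ^ (2 * h) * (Module.finrank ℚ (D.Homology i h) : RatFunc ℚ))
    ⟨-(D.numCrossings : ℤ), by
      intro i hi
      by_contra hlt
      refine hi ?_
      simp [D.finrank_homology_eq_zero (lt_of_not_ge hlt)]⟩

/-! ### The MOY HOMFLY polynomial -/

/-- A crossing of a braid on `b` strands, after adding a strand on the right. -/
def widen {b : ℕ} (i : Column b) : Column (b + 1) := ⟨i.1, Nat.lt_succ_of_lt i.2⟩

/-- The rightmost column on `b + 2` strands. -/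
def lastColumn (b : ℕ) : Column (b + 2) := ⟨b, Nat.lt_succ_self (b + 1)⟩

/-- `P` is an isotopy invariant of closed braid graphs that takes the value `1` on the
empty graph and satisfies the MOY relations. -/
structure IsMOYHomfly (P : (b : ℕ) → BraidGraph b → QAQ) : Prop where
  /-- isotopy: crossings in distant columns slide past each other -/
  slide : ∀ (b : ℕ) (u v : BraidGraph b) (i j : Column b), i.1 + 1 < j.1 →
    P b (u ++ [i, j] ++ v) = P b (u ++ [j, i] ++ v)
  /-- isotopy: a part of the braid graph slides around the closure -/
  rotate : ∀ (b : ℕ) (u v : BraidGraph b), P b (u ++ v) = P b (v ++ u)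
  /-- the empty graph -/
  empty : P 0 [] = 1
  /-- relation O: removing a circle without crossings -/
  relO : ∀ (b : ℕ) (w : BraidGraph b),
    P (b + 1) (w.map widen) = (a - a⁻¹) / (q - q⁻¹) * P b w
  /-- relation I: removing a crossing, one of whose strands closes up to a loop -/
  relI : ∀ (b : ℕ) (u v : BraidGraph (b + 1)),
    P (b + 2) (u.map widen ++ [lastColumn b] ++ v.map widen) =
      (a * q⁻¹ - a⁻¹ * q) / (q - q⁻¹) * P (b + 1) (u ++ v)
  /-- relation II: two successive crossings in the same column -/
  relII : ∀ (b : ℕ) (u v : BraidGraph b) (i : Column b),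
    P b (u ++ [i, i] ++ v) = (q + q⁻¹) * P b (u ++ [i] ++ v)
  /-- relation III: three crossings in two adjacent columns -/
  relIII : ∀ (b : ℕ) (u v : BraidGraph b) (i j : Column b), j.1 = i.1 + 1 →
    P b (u ++ [j, i, j] ++ v) + P b (u ++ [i] ++ v) =
      P b (u ++ [i, j, i] ++ v) + P b (u ++ [j] ++ v)

/-- The MOY HOMFLY polynomial of closed braid graphs: the invariant determined by the MOY
relations and the value `1` on the empty graph. -/
def moyHomfly : (b : ℕ) → BraidGraph b → QAQ :=
  Classical.epsilon IsMOYHomfly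

end KR

end

noncomputable section



namespace KR

/-! ### Graded differential modules over a polynomial ring -/

/-! The Poincaré series times `(-(a * q)) ^ b` satisfies the MOY relations, and those relations
together with the value on the empty graph leave no freedom. Hence this normalized series is the
polynomial; in particular the existence of the polynomial is a consequence of the homology
computation.

Homology. At every level of the braid, replace the edge variables by their partial sums from the
left. The linear relations at marks and crossings then say that a crossing in column `i` changes
only the partial sum with index `i + 1`; if this label changes from `b` to `r` between the
neighbours `a` and `c`, the quadratic polynomial of the crossing is `(r - b) * (a + c - r - b)`.
Before closing up, the bottom labels and one new label for each crossing are free variables. Closing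
up adds one linear entry, top minus bottom label, per strand. Some of these entries eliminate a
variable. The others vanish, one for each connected component, and are exactly the complexes with
zero map in the definition. So the unreduced homology is the homology of a single Koszul complex
over a polynomial ring (`hh`, `rank_homology`).

Koszul complexes can be simplified by a few moves. Entries may be permuted (`koszul_perm`) and
changed by multiples of other entries (`koszul_replace`). A linear equation eliminates a variable
(`hrank_koszul_elim`), a monic quadratic equation in a variable that occurs nowhere else doubles the
homology (`hrank_koszul_monicQuad`), a zero entry splits the complex (`hrank_cone_zero`), and a
variable that occurs in no entry contributes the factor `1 / (1 - q ^ 2)`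
(`hrank_koszul_polynomial`). These moves yield rotation and the relations O, I and II directly. For
relation III, the closure with three alternating crossings splits into the closure with one crossing
and a remainder (`hrank_koszul_triple`), and the remainder is the same for both orders of the
columns.

Polynomial. As for traces on Hecke algebras, relations II, III and distant commutation rewrite every
word into words that contain the last column at most once; relation O or I then removes a strand. So
a function with values in a `ℚ(a, q)`-vector space that satisfies the relations takes its values in
every subspace that contains its value on the empty graph (`MOYRelations.mem`). Applied to a
difference of two solutions and the zero subspace, this is uniqueness. Applied to the normalized
Poincaré series and the image of the expansion map, it is rationality. -/

/-- `f` is homogeneous of `q`-degree `e`, where every variable has `q`-degree `2`. -/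
abbrev Deg {σ : Type} (f : MvPolynomial σ ℚ) (e : ℤ) : Prop :=
  MvPolynomial.IsWeightedHomogeneous (fun _ : σ => (2 : ℤ)) f e

/-- A differential module over a polynomial ring with a bigrading. -/
structure Cx (σ : Type) where
  V : Type
  [addCommGroup : AddCommGroup V]
  [moduleRat : Module ℚ V]
  [modulePoly : Module (MvPolynomial σ ℚ) V]
  [tower : IsScalarTower ℚ (MvPolynomial σ ℚ) V]
  d : V →ₗ[MvPolynomial σ ℚ] V
  part : ℤ → ℤ → Submodule ℚ V
  smul_mem : ∀ {f : MvPolynomial σ ℚ} {e k h : ℤ} {v : V}, Deg f e → v ∈ part k h →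
    f • v ∈ part (k + e) h

namespace Cx

attribute [instance] addCommGroup moduleRat modulePoly tower

variable {σ : Type}

/-- The homogeneous cycles. -/
def cyc (X : Cx σ) (k h : ℤ) : Submodule ℚ X.V :=
  (LinearMap.ker X.d).restrictScalars ℚ ⊓ X.part k h

/-- The boundaries of homogeneous chains. -/
def bdry (X : Cx σ) (k h : ℤ) : Submodule ℚ X.V :=
  (X.part (k - 2) (h - 1)).map (X.d.restrictScalars ℚ)

/-- The dimension of the homology in a bidegree. -/
def hrank (X : Cx σ) (k h : ℤ) : Cardinal :=
  Module.rank ℚ (X.cyc k h ⧸ (X.bdry k h).comap (X.cyc k h).subtype)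

theorem mem_cyc {X : Cx σ} {k h : ℤ} {v : X.V} : v ∈ X.cyc k h ↔ X.d v = 0 ∧ v ∈ X.part k h := by
  simp [cyc]

theorem mem_bdry {X : Cx σ} {k h : ℤ} {v : X.V} :
    v ∈ X.bdry k h ↔ ∃ w ∈ X.part (k - 2) (h - 1), X.d w = v := by
  simp [bdry]

/-- The mapping cone of multiplication by `f`, of `q`-degree `2 s + 2`, with symmetric shifts. -/
def cone (X : Cx σ) (s : ℤ) (f : MvPolynomial σ ℚ) : Cx σ where
  V := X.V × X.V
  d := (X.d.comp (LinearMap.fst _ _ _)).prod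
    (f • LinearMap.fst _ _ _ - X.d.comp (LinearMap.snd _ _ _))
  part k h := (X.part (k - s) (h + 1)).prod (X.part (k + s) h)
  smul_mem := by
    rintro g e k h ⟨x, y⟩ hg ⟨hx, hy⟩
    refine ⟨?_, ?_⟩
    · have := X.smul_mem hg hx
      rwa [show k - s + e = k + e - s by ring] at this
    · have := X.smul_mem hg hy
      rwa [show k + s + e = k + e + s by ring] at this

/-- The iterated mapping cone, that is the Koszul complex with coefficients in `X`. -/
def koszul (X : Cx σ) : List (ℤ × MvPolynomial σ ℚ) → Cx σ
  | [] => X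
  | (s, f) :: l => (koszul X l).cone s f

/-- The direct sum. -/
def prod (X Y : Cx σ) : Cx σ where
  V := X.V × Y.V
  d := X.d.prodMap Y.d
  part k h := (X.part k h).prod (Y.part k h)
  smul_mem hg hv := ⟨X.smul_mem hg hv.1, Y.smul_mem hg hv.2⟩

/-- The bidegree shift. -/
def shift (X : Cx σ) (s t : ℤ) : Cx σ where
  V := X.V
  d := X.d
  part k h := X.part (k - s) (h - t)
  smul_mem {f e k h v} hg hv := by
    have := X.smul_mem hg hv
    rwa [show k - s + e = k + e - s by ring] at this

/-! ### Quasi-isomorphisms and their compatibility with mapping cones -/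

/-- `X` maps to `Y` by a bihomogeneous quasi-isomorphism. -/
def QI (X Y : Cx σ) : Prop :=
  ∃ φ : X.V →ₗ[MvPolynomial σ ℚ] Y.V, (∀ x, φ (X.d x) = Y.d (φ x)) ∧
    (∀ k h x, x ∈ X.part k h → φ x ∈ Y.part k h) ∧
    (∀ k h x y, x ∈ X.part k h → X.d x = 0 → y ∈ Y.part (k - 2) (h - 1) → φ x = Y.d y →
      ∃ x' ∈ X.part (k - 2) (h - 1), x = X.d x') ∧
    (∀ k h y, y ∈ Y.part k h → Y.d y = 0 →
      ∃ x ∈ X.part k h, X.d x = 0 ∧ ∃ y' ∈ Y.part (k - 2) (h - 1), y - φ x = Y.d y')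

/-- A bihomogeneous isomorphism is a quasi-isomorphism. -/
theorem QI.of_equiv {X Y : Cx σ} (φ : X.V ≃ₗ[MvPolynomial σ ℚ] Y.V)
    (hd : ∀ x, φ (X.d x) = Y.d (φ x))
    (hp : ∀ k h x, φ x ∈ Y.part k h ↔ x ∈ X.part k h) : QI X Y := by
  refine ⟨φ.toLinearMap, hd, fun k h x hx => (hp k h x).2 hx, ?_, ?_⟩
  · intro k h x y hx _ hy hxy
    refine ⟨φ.symm y, (hp _ _ _).1 (by simpa using hy), φ.injective ?_⟩
    rw [hd]
    simpa using hxy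
  · intro k h y hy hdy
    refine ⟨φ.symm y, (hp _ _ _).1 (by simpa using hy), φ.injective ?_, 0, zero_mem _, ?_⟩
    · rw [hd]; simpa using hdy
    · simp

/-- Equivalence generated by bihomogeneous quasi-isomorphisms. -/
def Equiv : Cx σ → Cx σ → Prop := Relation.EqvGen QI

scoped infix:50 " ≃q " => Cx.Equiv

theorem QI.equiv {X Y : Cx σ} (h : QI X Y) : X ≃q Y := Relation.EqvGen.rel _ _ h
theorem Equiv.refl (X : Cx σ) : X ≃q X := Relation.EqvGen.refl _
theorem Equiv.symm {X Y : Cx σ} (h : X ≃q Y) : Y ≃q X := Relation.EqvGen.symm _ _ h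
theorem Equiv.trans {X Y Z : Cx σ} (h : X ≃q Y) (h' : Y ≃q Z) : X ≃q Z :=
  Relation.EqvGen.trans _ _ _ h h'

theorem Equiv.lift {τ : Type} (F : Cx σ → Cx τ) (hF : ∀ X Y, QI X Y → QI (F X) (F Y))
    {X Y : Cx σ} (h : X ≃q Y) : F X ≃q F Y := by
  induction h with
  | rel X Y h => exact (hF X Y h).equiv
  | refl X => exact .refl _
  | symm X Y _ ih => exact ih.symm
  | trans X Y Z _ _ ih ih' => exact ih.trans ih'

/-- The last two clauses of `QI` are injectivity and surjectivity on homology, phrased for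
homogeneous elements. The homology is the quotient of the cycles by those cycles that are
boundaries, so neither `d ∘ d = 0` nor homogeneity of `d` has to be part of `Cx`. -/
theorem QI.hrank_eq {X Y : Cx σ} (H : QI X Y) (k h : ℤ) : X.hrank k h = Y.hrank k h := by
  obtain ⟨φ, hd, hp, hi, hs⟩ := H
  have hc : ∀ x ∈ X.cyc k h, φ.restrictScalars ℚ x ∈ Y.cyc k h := by
    intro x hx
    rw [mem_cyc] at hx ⊢
    refine ⟨?_, hp _ _ _ hx.2⟩
    rw [LinearMap.restrictScalars_apply, ← hd, hx.1, map_zero]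
  let ψ : X.cyc k h →ₗ[ℚ] Y.cyc k h := (φ.restrictScalars ℚ).restrict hc
  have hψ : (X.bdry k h).comap (X.cyc k h).subtype ≤
      ((Y.bdry k h).comap (Y.cyc k h).subtype).comap ψ := by
    intro x hx
    simp only [Submodule.mem_comap, mem_bdry] at hx ⊢
    obtain ⟨w, hw, hwx⟩ := hx
    refine ⟨φ w, hp _ _ _ hw, ?_⟩
    rw [← hd, hwx]
    rfl
  let Ψ := Submodule.mapQ _ _ ψ hψ
  have hbij : Function.Bijective Ψ := by
    constructor
    · rw [injective_iff_map_eq_zero]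
      intro z hz
      obtain ⟨⟨x, hx⟩, rfl⟩ := Submodule.mkQ_surjective _ z
      rw [Submodule.mkQ_apply] at hz ⊢
      rw [Submodule.mapQ_apply, Submodule.Quotient.mk_eq_zero, Submodule.mem_comap,
        mem_bdry] at hz
      rw [Submodule.Quotient.mk_eq_zero, Submodule.mem_comap, mem_bdry]
      obtain ⟨y, hy, hyx⟩ := hz
      rw [mem_cyc] at hx
      obtain ⟨x', hx', e⟩ := hi k h x y hx.2 hx.1 hy hyx.symm
      exact ⟨x', hx', e.symm⟩
    · intro z
      obtain ⟨⟨y, hy⟩, rfl⟩ := Submodule.mkQ_surjective _ z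
      rw [mem_cyc] at hy
      obtain ⟨x, hx, hdx, y', hy', e⟩ := hs k h y hy.2 hy.1
      refine ⟨Submodule.Quotient.mk ⟨x, mem_cyc.2 ⟨hdx, hx⟩⟩, ?_⟩
      rw [Submodule.mapQ_apply, Submodule.mkQ_apply, eq_comm, Submodule.Quotient.eq,
        Submodule.mem_comap, mem_bdry]
      exact ⟨y', hy', e.symm⟩
  exact (LinearEquiv.ofBijective Ψ hbij).rank_eq

theorem Equiv.hrank_eq {X Y : Cx σ} (H : X ≃q Y) (k h : ℤ) : X.hrank k h = Y.hrank k h := by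
  induction H with
  | rel X Y h => exact h.hrank_eq _ _
  | refl X => rfl
  | symm X Y _ ih => exact ih.symm
  | trans X Y Z _ _ ih ih' => exact ih.trans ih'

/-- This is the five lemma for the long exact sequence of a cone, carried out by chasing homogeneous
elements. The degree `2 * s + 2` of `f` is what makes the shifts of the two summands fit. -/
theorem QI.cone {X Y : Cx σ} (H : QI X Y) {s : ℤ} {f : MvPolynomial σ ℚ} (hf : Deg f (2 * s + 2)) :
    QI (X.cone s f) (Y.cone s f) := by
  obtain ⟨φ, hd, hp, hi, hs⟩ := H
  refine ⟨φ.prodMap φ, ?_, ?_, ?_, ?_⟩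
  · rintro ⟨x, y⟩
    change (φ (X.d x), φ (f • x - X.d y)) = (Y.d (φ x), f • φ x - Y.d (φ y))
    rw [hd, map_sub, map_smul, hd]
  · rintro k h ⟨x, y⟩ ⟨hx, hy⟩
    exact ⟨hp _ _ _ hx, hp _ _ _ hy⟩
  · rintro k h ⟨x, y⟩ ⟨x', y'⟩ ⟨hx, hy⟩ hxy ⟨hx', hy'⟩ e
    change x ∈ X.part (k - s) (h + 1) at hx
    change y ∈ X.part (k + s) h at hy
    change x' ∈ Y.part (k - 2 - s) (h - 1 + 1) at hx'
    change y' ∈ Y.part (k - 2 + s) (h - 1) at hy'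
    obtain ⟨h1, h2⟩ := Prod.mk.inj (show ((X.d x, f • x - X.d y) : X.V × X.V) = (0, 0) from hxy)
    obtain ⟨e1, e2⟩ := Prod.mk.inj
      (show ((φ x, φ y) : Y.V × Y.V) = (Y.d x', f • x' - Y.d y') from e)
    rw [show k - 2 - s = k - s - 2 by ring] at hx'
    rw [show h - 1 + 1 = h + 1 - 1 by ring] at hx'
    obtain ⟨u, hu, rfl⟩ := hi _ _ _ _ hx h1 hx' e1
    rw [show h + 1 - 1 = h by ring] at hu hx'
    have hfu := X.smul_mem hf hu
    rw [show k - s - 2 + (2 * s + 2) = k + s by ring] at hfu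
    have hv : x' - φ u ∈ Y.part (k - s - 2) h := sub_mem hx' (hp _ _ _ hu)
    have hdv : Y.d (x' - φ u) = 0 := by rw [map_sub, ← hd, e1, sub_self]
    -- The primitive `u` of `x` need not map to `x'`. The difference `x' - φ u` is a cycle, hence
    -- homologous to some `φ z`, and `u + z` is the corrected primitive. The second component then
    -- differs from `f • (u + z)` by an element that bounds in `Y`, hence in `X`.
    obtain ⟨z, hz, hdz, w, hw, e3⟩ := hs _ _ _ hv hdv
    have hfz := X.smul_mem hf hz
    rw [show k - s - 2 + (2 * s + 2) = k + s by ring] at hfz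
    have hfw := Y.smul_mem hf hw
    rw [show k - s - 2 - 2 + (2 * s + 2) = k + s - 2 by ring] at hfw
    rw [show k - 2 + s = k + s - 2 by ring] at hy'
    obtain ⟨t, ht, e4⟩ := hi _ _ (y - f • u - f • z) (f • w - y')
      (sub_mem (sub_mem hy hfu) hfz)
      (by rw [map_sub, map_sub, map_smul, map_smul, hdz, smul_zero, sub_zero, ← sub_eq_zero.1 h2,
        sub_self])
      (sub_mem hfw hy')
      (by
        rw [map_sub, map_sub, map_smul, map_smul, e2, map_sub, map_smul, ← e3, smul_sub, smul_sub]
        abel)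
    refine ⟨(u + z, -t), ⟨?_, ?_⟩, ?_⟩
    · change u + z ∈ X.part (k - 2 - s) (h - 1 + 1)
      rw [show k - 2 - s = k - s - 2 by ring, show h - 1 + 1 = h by ring]
      exact add_mem hu hz
    · change -t ∈ X.part (k - 2 + s) (h - 1)
      rw [show k - 2 + s = k + s - 2 by ring]
      exact neg_mem ht
    · change _ = (X.d (u + z), f • (u + z) - X.d (-t))
      rw [map_add, hdz, add_zero, map_neg, ← e4, smul_add]
      congr 1
      abel
  · rintro k h ⟨x, y⟩ ⟨hx, hy⟩ hxy
    change x ∈ Y.part (k - s) (h + 1) at hx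
    change y ∈ Y.part (k + s) h at hy
    obtain ⟨h1, h2⟩ := Prod.mk.inj (show ((Y.d x, f • x - Y.d y) : Y.V × Y.V) = (0, 0) from hxy)
    obtain ⟨a, ha, hda, w, hw, e1⟩ := hs _ _ _ hx h1
    rw [show h + 1 - 1 = h by ring] at hw
    have hfa := X.smul_mem hf ha
    rw [show k - s + (2 * s + 2) = k + s + 2 by ring] at hfa
    have hfw := Y.smul_mem hf hw
    rw [show k - s - 2 + (2 * s + 2) = k + s by ring] at hfw
    have e2 : φ (f • a) = Y.d (y - f • w) := by
      rw [map_smul, map_sub, map_smul, ← e1, ← sub_eq_zero.1 h2, smul_sub]; abel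
    -- The cycle `f • a` becomes a boundary in `Y`, so it bounds some `b` in `X`. Then `(a, b + c)`
    -- is a cycle of the cone for every cycle `c`, and `c` is chosen to correct the second
    -- component.
    obtain ⟨b, hb, e3⟩ := hi (k + s + 2) (h + 1) (f • a) (y - f • w) hfa
      (by rw [map_smul, hda, smul_zero])
      (by
        rw [show k + s + 2 - 2 = k + s by ring, show h + 1 - 1 = h by ring]
        exact sub_mem hy hfw) e2
    rw [show k + s + 2 - 2 = k + s by ring, show h + 1 - 1 = h by ring] at hb
    obtain ⟨c, hc, hdc, e, he, e4⟩ := hs (k + s) h (y - f • w - φ b)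
      (sub_mem (sub_mem hy hfw) (hp _ _ _ hb))
      (by rw [map_sub, ← hd, ← e3, ← e2, sub_self])
    refine ⟨(a, b + c), ⟨ha, add_mem hb hc⟩, ?_, (w, -e), ⟨?_, ?_⟩, ?_⟩
    · change ((X.d a, f • a - X.d (b + c)) : X.V × X.V) = (0, 0)
      rw [hda, map_add, hdc, e3]
      simp
    · change w ∈ Y.part (k - 2 - s) (h - 1 + 1)
      rwa [show k - 2 - s = k - s - 2 by ring, show h - 1 + 1 = h by ring]
    · change -e ∈ Y.part (k - 2 + s) (h - 1)
      rw [show k - 2 + s = k + s - 2 by ring]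
      exact neg_mem he
    · change (x - φ a, y - φ (b + c)) = (Y.d w, f • w - Y.d (-e))
      rw [e1, map_neg, ← e4, map_add]
      congr 1
      abel

theorem Equiv.cone {X Y : Cx σ} (H : X ≃q Y) {s : ℤ} {f : MvPolynomial σ ℚ}
    (hf : Deg f (2 * s + 2)) : X.cone s f ≃q Y.cone s f :=
  H.lift (fun X => X.cone s f) fun _ _ h => h.cone hf

/-- All entries of the list have the degrees that their shifts prescribe. -/
def Homog (l : List (ℤ × MvPolynomial σ ℚ)) : Prop := ∀ e ∈ l, Deg e.2 (2 * e.1 + 2)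

theorem homog_nil : Homog ([] : List (ℤ × MvPolynomial σ ℚ)) := by simp [Homog]

theorem homog_cons {e : ℤ × MvPolynomial σ ℚ} {l : List (ℤ × MvPolynomial σ ℚ)} :
    Homog (e :: l) ↔ Deg e.2 (2 * e.1 + 2) ∧ Homog l := by simp [Homog]

theorem homog_append {l l' : List (ℤ × MvPolynomial σ ℚ)} :
    Homog (l ++ l') ↔ Homog l ∧ Homog l' := by simp [Homog, or_imp, forall_and]

theorem Homog.perm {l l' : List (ℤ × MvPolynomial σ ℚ)} (h : Homog l) (hp : l.Perm l') : Homog l' :=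
  fun e he => h e (hp.mem_iff.2 he)

theorem Equiv.koszul {X Y : Cx σ} (H : X ≃q Y) : ∀ {l : List (ℤ × MvPolynomial σ ℚ)}, Homog l →
    X.koszul l ≃q Y.koszul l
  | [], _ => H
  | (_, _) :: _, hl => (Equiv.koszul H (homog_cons.1 hl).2).cone (homog_cons.1 hl).1

theorem koszul_append (X : Cx σ) (l l' : List (ℤ × MvPolynomial σ ℚ)) :
    X.koszul (l ++ l') = (X.koszul l').koszul l := by
  induction l with
  | nil => rfl
  | cons e l ih => simp [koszul, ih]

/-- Exchanging the two middle summands identifies the iterated cones; the sign on the last summand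
accounts for the differential being negated in the second summand of a cone. -/
theorem QI.cone_cone (X : Cx σ) (s t : ℤ) (f g : MvPolynomial σ ℚ) :
    QI ((X.cone s f).cone t g) ((X.cone t g).cone s f) := by
  let φ : ((X.V × X.V) × (X.V × X.V)) ≃ₗ[MvPolynomial σ ℚ] ((X.V × X.V) × (X.V × X.V)) :=
    { toFun := fun v => ((v.1.1, v.2.1), (v.1.2, -v.2.2))
      invFun := fun v => ((v.1.1, v.2.1), (v.1.2, -v.2.2))
      left_inv := fun v => by simp
      right_inv := fun v => by simp
      map_add' := fun v w => by simp [add_comm]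
      map_smul' := fun c v => by simp }
  refine QI.of_equiv φ ?_ ?_
  · rintro ⟨⟨a, b⟩, c, e⟩
    change (((X.d a, g • a - X.d c), (f • a - X.d b, -(g • b - (f • c - X.d e)))) :
      (X.V × X.V) × (X.V × X.V)) =
      ((X.d a, g • a - X.d c), (f • a - X.d b, f • c - (g • b - X.d (-e))))
    rw [map_neg]
    congr 2
    abel
  · rintro k h ⟨⟨a, b⟩, c, e⟩
    change ((a ∈ X.part (k - s - t) (h + 1 + 1) ∧ c ∈ X.part (k - s + t) (h + 1)) ∧
        (b ∈ X.part (k + s - t) (h + 1) ∧ -e ∈ X.part (k + s + t) h)) ↔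
      ((a ∈ X.part (k - t - s) (h + 1 + 1) ∧ b ∈ X.part (k - t + s) (h + 1)) ∧
        (c ∈ X.part (k + t - s) (h + 1) ∧ e ∈ X.part (k + t + s) h))
    rw [neg_mem_iff, show k - s - t = k - t - s by ring, show k + s - t = k - t + s by ring,
      show k - s + t = k + t - s by ring, show k + s + t = k + t + s by ring]
    tauto

theorem koszul_perm (X : Cx σ) {l l' : List (ℤ × MvPolynomial σ ℚ)} (hp : l.Perm l')
    (hl : Homog l) : X.koszul l ≃q X.koszul l' := by
  induction hp with
  | nil => exact .refl _
  | cons e _ ih => exact (ih (homog_cons.1 hl).2).cone (homog_cons.1 hl).1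
  | swap e e' l => exact (QI.cone_cone _ _ _ _ _).equiv
  | trans hp _ ih ih' => exact (ih hl).trans (ih' (hl.perm hp))

/-! ### Null-homotopic multiplications and changes of entries -/

/-- Multiplication by `f`, of degree `2 s + 2`, is homotopic to zero. -/
def Null (X : Cx σ) (s : ℤ) (f : MvPolynomial σ ℚ) : Prop :=
  ∃ η : X.V →ₗ[MvPolynomial σ ℚ] X.V, (∀ v, X.d (η v) + η (X.d v) = f • v) ∧
    ∀ k h v, v ∈ X.part k h → η v ∈ X.part (k + 2 * s) (h - 1)

theorem Null.zero (X : Cx σ) (s : ℤ) : X.Null s 0 := ⟨0, by simp, by simp⟩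

theorem Null.add {X : Cx σ} {s : ℤ} {f g : MvPolynomial σ ℚ} (hf : X.Null s f) (hg : X.Null s g) :
    X.Null s (f + g) := by
  obtain ⟨η, h1, h2⟩ := hf
  obtain ⟨θ, h3, h4⟩ := hg
  refine ⟨η + θ, fun v => ?_, fun k h v hv => add_mem (h2 _ _ _ hv) (h4 _ _ _ hv)⟩
  rw [add_smul, ← h1, ← h3, LinearMap.add_apply, LinearMap.add_apply, map_add]
  abel

theorem Null.mul {X : Cx σ} {s t e : ℤ} {f g : MvPolynomial σ ℚ} (hf : X.Null s f) (hg : Deg g e)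
    (he : 2 * t = 2 * s + e) : X.Null t (g * f) := by
  obtain ⟨η, h1, h2⟩ := hf
  refine ⟨g • η, fun v => ?_, fun k h v hv => ?_⟩
  · rw [mul_smul, ← h1, LinearMap.smul_apply, LinearMap.smul_apply, map_smul, smul_add]
  · have := X.smul_mem hg (h2 _ _ _ hv)
    rwa [show k + 2 * s + e = k + 2 * t by rw [he]; ring] at this

/-- The homotopy carries the second copy of `X` identically onto the first. -/
theorem Null.cone_self (X : Cx σ) (s : ℤ) (f : MvPolynomial σ ℚ) : (X.cone s f).Null s f := by
  refine ⟨(LinearMap.inl _ _ _).comp (LinearMap.snd _ _ _), ?_, ?_⟩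
  · rintro ⟨x, y⟩
    change ((X.d y + (f • x - X.d y), f • y - X.d 0 + 0) : X.V × X.V) = (f • x, f • y)
    rw [map_zero, sub_zero, add_zero, add_sub_cancel]
  · rintro k h ⟨x, y⟩ ⟨hx, hy⟩
    refine ⟨?_, zero_mem _⟩
    change y ∈ X.part (k + 2 * s - s) (h - 1 + 1)
    rwa [show k + 2 * s - s = k + s by ring, show h - 1 + 1 = h by ring]

/-- A homotopy on `X` acts on both copies, with a sign on the second, where the cone has the
differential `-d`. Thus each entry of a Koszul complex acts null-homotopically on the whole complex,
whatever further entries are added. -/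
theorem Null.cone {X : Cx σ} {s : ℤ} {f : MvPolynomial σ ℚ} (hf : X.Null s f) (t : ℤ)
    (g : MvPolynomial σ ℚ) : (X.cone t g).Null s f := by
  obtain ⟨η, h1, h2⟩ := hf
  refine ⟨η.prodMap (-η), ?_, ?_⟩
  · rintro ⟨x, y⟩
    change ((X.d (η x) + η (X.d x), g • η x - X.d (-η y) + -η (g • x - X.d y)) : X.V × X.V) =
      (f • x, f • y)
    rw [← h1, ← h1, map_neg, map_sub, map_smul]
    congr 1
    abel
  · rintro k h ⟨x, y⟩ ⟨hx, hy⟩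
    refine ⟨?_, ?_⟩
    · have := h2 _ _ _ hx
      change η x ∈ X.part (k + 2 * s - t) (h - 1 + 1)
      rwa [show k + 2 * s - t = k - t + 2 * s by ring, show h - 1 + 1 = h + 1 - 1 by ring]
    · have := h2 _ _ _ hy
      change -η y ∈ X.part (k + 2 * s + t) (h - 1)
      rw [show k + 2 * s + t = k + t + 2 * s by ring]
      exact neg_mem this

theorem Null.koszul (X : Cx σ) {s : ℤ} {f : MvPolynomial σ ℚ} :
    ∀ {l : List (ℤ × MvPolynomial σ ℚ)}, (s, f) ∈ l → (X.koszul l).Null s f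
  | (t, g) :: l, h => by
    rcases List.mem_cons.1 h with h | h
    · rw [← (Prod.mk.inj h).1, ← (Prod.mk.inj h).2]
      exact Null.cone_self _ _ _
    · exact (Null.koszul X h).cone _ _

/-- The homotopy `η` between the two multiplications gives the shear `(x, y) ↦ (x, y + η x)`, an
isomorphism of the cones. -/
theorem QI.cone_congr {X : Cx σ} {s : ℤ} {f g : MvPolynomial σ ℚ} (h : X.Null s (g - f)) :
    QI (X.cone s f) (X.cone s g) := by
  obtain ⟨η, h1, h2⟩ := h
  let φ : (X.V × X.V) ≃ₗ[MvPolynomial σ ℚ] (X.V × X.V) :=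
    { toFun := fun v => (v.1, v.2 + η v.1)
      invFun := fun v => (v.1, v.2 - η v.1)
      left_inv := fun v => by simp
      right_inv := fun v => by simp
      map_add' := fun v w => by simp only [Prod.fst_add, Prod.snd_add, map_add, Prod.mk_add_mk]; congr 1; abel
      map_smul' := fun c v => by simp }
  have h3 : ∀ k h v, v ∈ X.part (k - s) (h + 1) → η v ∈ X.part (k + s) h := by
    intro k h v hv
    have := h2 _ _ _ hv
    rwa [show k - s + 2 * s = k + s by ring, show h + 1 - 1 = h by ring] at this
  refine QI.of_equiv φ ?_ ?_
  · rintro ⟨x, y⟩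
    change ((X.d x, f • x - X.d y + η (X.d x)) : X.V × X.V) = (X.d x, g • x - X.d (y + η x))
    have := h1 x
    rw [sub_smul, ← eq_sub_iff_add_eq'] at this
    rw [this, map_add]
    congr 1
    abel
  · rintro k h ⟨x, y⟩
    change (x ∈ X.part (k - s) (h + 1) ∧ y + η x ∈ X.part (k + s) h) ↔
      (x ∈ X.part (k - s) (h + 1) ∧ y ∈ X.part (k + s) h)
    refine and_congr_right fun hx => ?_
    exact Submodule.add_mem_iff_left _ (h3 _ _ _ hx)

theorem QI.cone_neg (X : Cx σ) (s : ℤ) (f : MvPolynomial σ ℚ) :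
    QI (X.cone s f) (X.cone s (-f)) := by
  refine QI.of_equiv (LinearEquiv.prodCongr (LinearEquiv.refl _ X.V) (LinearEquiv.neg _)) ?_ ?_
  · rintro ⟨x, y⟩
    change ((X.d x, -(f • x - X.d y)) : X.V × X.V) = (X.d x, (-f) • x - X.d (-y))
    rw [map_neg, neg_smul]
    congr 1
    abel
  · rintro k h ⟨x, y⟩
    change (x ∈ X.part (k - s) (h + 1) ∧ -y ∈ X.part (k + s) h) ↔
      (x ∈ X.part (k - s) (h + 1) ∧ y ∈ X.part (k + s) h)
    rw [neg_mem_iff]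

/-- An entry of a Koszul complex may be changed by a multiplication that is homotopic to zero on the
Koszul complex of the other entries. -/
theorem koszul_replace (X : Cx σ) {l l' r : List (ℤ × MvPolynomial σ ℚ)} {s : ℤ}
    {f g : MvPolynomial σ ℚ} (hl : l.Perm ((s, f) :: r)) (hl' : l'.Perm ((s, g) :: r))
    (h : (X.koszul r).Null s (g - f)) (H : Homog l) (H' : Homog l') :
    X.koszul l ≃q X.koszul l' :=
  (koszul_perm X hl H).trans (((QI.cone_congr h).equiv).trans (koszul_perm X hl' H').symm)

end Cx
end KR


/-! ### Sums, shifts, regular elements and restriction of scalars -/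

namespace KR
namespace Cx

variable {σ τ : Type}

/-- An isomorphism of subquotients gives equality of ranks. -/
theorem rank_subquotient_eq {V W : Type} [AddCommGroup V] [AddCommGroup W] [Module ℚ V] [Module ℚ W]
    (e : V ≃ₗ[ℚ] W) {A B : Submodule ℚ V} {A' B' : Submodule ℚ W} (hc : ∀ v, e v ∈ A' ↔ v ∈ A)
    (hb : ∀ v ∈ A, e v ∈ B' ↔ v ∈ B) :
    Module.rank ℚ (A ⧸ B.comap A.subtype) = Module.rank ℚ (A' ⧸ B'.comap A'.subtype) := by
  have h1 : A.map e.toLinearMap = A' := by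
    ext v
    constructor
    · rintro ⟨w, hw, rfl⟩
      exact (hc w).2 hw
    · intro hv
      exact ⟨e.symm v, (hc _).1 (by simpa using hv), by simp⟩
  refine (Submodule.Quotient.equiv _ _ ((e.submoduleMap _).trans (LinearEquiv.ofEq _ _ h1)) ?_).rank_eq
  ext ⟨v, hv⟩
  simp only [Submodule.mem_map, Submodule.mem_comap, Subtype.exists]
  constructor
  · rintro ⟨w, hw, hwb, e1⟩
    have e2 : e w = v := congrArg Subtype.val e1
    have : e w ∈ B' := (hb w hw).2 hwb
    rw [e2] at this
    exact this
  · intro hvb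
    have hw : e.symm v ∈ A := (hc _).1 (by simpa using hv)
    refine ⟨e.symm v, hw, (hb _ hw).1 (by simpa using hvb), ?_⟩
    apply Subtype.ext
    exact e.apply_symm_apply v

theorem hrank_eq_of_eq {X : Cx σ} {Y : Cx τ} (e : X.V ≃ₗ[ℚ] Y.V) {k h k' h' : ℤ}
    (hc : ∀ v, e v ∈ Y.cyc k' h' ↔ v ∈ X.cyc k h) (hb : ∀ v, e v ∈ Y.bdry k' h' ↔ v ∈ X.bdry k h) :
    X.hrank k h = Y.hrank k' h' := rank_subquotient_eq e hc fun v _ => hb v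

theorem hrank_shift (X : Cx σ) (s t k h : ℤ) :
    (X.shift s t).hrank k h = X.hrank (k - s) (h - t) := by
  refine hrank_eq_of_eq (X := X.shift s t) (Y := X) (LinearEquiv.refl ℚ X.V) (fun v => Iff.rfl)
    fun v => Iff.trans (mem_bdry (X := X)) (Iff.trans ?_ (mem_bdry (X := X.shift s t)).symm)
  change (∃ w ∈ X.part (k - s - 2) (h - t - 1), X.d w = v) ↔
    ∃ w ∈ X.part (k - 2 - s) (h - 1 - t), X.d w = v
  rw [show k - 2 - s = k - s - 2 by ring, show h - 1 - t = h - t - 1 by ring]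

/-- The differential with the opposite sign. -/
def negD (X : Cx σ) : Cx σ where
  V := X.V
  d := -X.d
  part := X.part
  smul_mem := X.smul_mem

theorem hrank_negD (X : Cx σ) (k h : ℤ) : X.negD.hrank k h = X.hrank k h := by
  refine hrank_eq_of_eq (X := X.negD) (Y := X) (LinearEquiv.refl ℚ X.V)
    (fun v => Iff.trans (mem_cyc (X := X)) (Iff.trans ?_ (mem_cyc (X := X.negD)).symm))
    fun v => Iff.trans (mem_bdry (X := X)) (Iff.trans ?_ (mem_bdry (X := X.negD)).symm)
  · change (X.d v = 0 ∧ v ∈ X.part k h) ↔ (-X.d v = 0 ∧ v ∈ X.part k h)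
    rw [neg_eq_zero]
  · change (∃ w ∈ X.part (k - 2) (h - 1), X.d w = v) ↔
      ∃ w ∈ X.part (k - 2) (h - 1), -X.d w = v
    constructor
    · rintro ⟨w, hw, e⟩
      exact ⟨-w, neg_mem hw, by rw [map_neg, neg_neg, e]⟩
    · rintro ⟨w, hw, e⟩
      exact ⟨-w, neg_mem hw, by rw [map_neg, e]⟩

theorem hrank_prod (X Y : Cx σ) (k h : ℤ) :
    (X.prod Y).hrank k h = X.hrank k h + Y.hrank k h := by
  have hc : ∀ v : X.V × Y.V, v ∈ (X.prod Y).cyc k h ↔ v.1 ∈ X.cyc k h ∧ v.2 ∈ Y.cyc k h := by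
    rintro ⟨x, y⟩
    refine (mem_cyc (X := X.prod Y)).trans ?_
    rw [mem_cyc, mem_cyc]
    change (((X.d x, Y.d y) : X.V × Y.V) = 0 ∧ (x ∈ X.part k h ∧ y ∈ Y.part k h)) ↔ _
    rw [Prod.mk_eq_zero]
    tauto
  have hb : ∀ v : X.V × Y.V, v ∈ (X.prod Y).bdry k h ↔ v.1 ∈ X.bdry k h ∧ v.2 ∈ Y.bdry k h := by
    rintro ⟨x, y⟩
    refine (mem_bdry (X := X.prod Y)).trans ?_
    rw [mem_bdry, mem_bdry]
    constructor
    · rintro ⟨⟨x', y'⟩, ⟨h1, h2⟩, e⟩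
      obtain ⟨e1, e2⟩ := Prod.mk.inj (show ((X.d x', Y.d y') : X.V × Y.V) = (x, y) from e)
      exact ⟨⟨x', h1, e1⟩, ⟨y', h2, e2⟩⟩
    · rintro ⟨⟨x', h1, e1⟩, ⟨y', h2, e2⟩⟩
      exact ⟨(x', y'), ⟨h1, h2⟩, Prod.ext e1 e2⟩
  let qX := ((X.bdry k h).comap (X.cyc k h).subtype).mkQ
  let qY := ((Y.bdry k h).comap (Y.cyc k h).subtype).mkQ
  let pX : (X.prod Y).cyc k h →ₗ[ℚ] X.cyc k h :=
    ((LinearMap.fst ℚ X.V Y.V).comp ((X.prod Y).cyc k h).subtype).codRestrict _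
      fun v => ((hc v.1).1 v.2).1
  let pY : (X.prod Y).cyc k h →ₗ[ℚ] Y.cyc k h :=
    ((LinearMap.snd ℚ X.V Y.V).comp ((X.prod Y).cyc k h).subtype).codRestrict _
      fun v => ((hc v.1).1 v.2).2
  let F := (qX.comp pX).prod (qY.comp pY)
  have hF : Function.Surjective F := by
    rintro ⟨x, y⟩
    obtain ⟨x, rfl⟩ := Submodule.mkQ_surjective _ x
    obtain ⟨y, rfl⟩ := Submodule.mkQ_surjective _ y
    exact ⟨⟨(x.1, y.1), (hc _).2 ⟨x.2, y.2⟩⟩, rfl⟩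
  have hk : LinearMap.ker F = ((X.prod Y).bdry k h).comap ((X.prod Y).cyc k h).subtype := by
    ext v
    have h1 : F v = 0 ↔ qX (pX v) = 0 ∧ qY (pY v) = 0 := by
      change (qX (pX v), qY (pY v)) = 0 ↔ _
      rw [Prod.mk_eq_zero]
    rw [LinearMap.mem_ker, h1, Submodule.mem_comap]
    refine Iff.trans ?_ (hb v.1).symm
    simp only [qX, qY, Submodule.mkQ_apply, Submodule.Quotient.mk_eq_zero, Submodule.mem_comap]
    rfl
  have := (LinearMap.quotKerEquivOfSurjective F hF).rank_eq
  rw [hk, rank_prod'] at this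
  exact this

theorem QI.cone_zero (X : Cx σ) (s : ℤ) :
    QI (X.cone s 0) ((X.shift s (-1)).prod (X.shift (-s) 0).negD) := by
  refine QI.of_equiv (LinearEquiv.refl _ (X.V × X.V)) ?_ ?_
  · rintro ⟨x, y⟩
    change ((X.d x, (0 : MvPolynomial σ ℚ) • x - X.d y) : X.V × X.V) = (X.d x, -X.d y)
    rw [zero_smul, zero_sub]
  · rintro k h ⟨x, y⟩
    change (x ∈ X.part (k - s) (h - -1) ∧ y ∈ X.part (k - -s) (h - 0)) ↔
      (x ∈ X.part (k - s) (h + 1) ∧ y ∈ X.part (k + s) h)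
    simp

/-- A cone on zero is a direct sum of two shifted copies. With `s = 0` this gives the numerator in
relation O, with `s = 1` the one in relation I. -/
theorem hrank_cone_zero (X : Cx σ) (s k h : ℤ) :
    (X.cone s 0).hrank k h = X.hrank (k - s) (h + 1) + X.hrank (k + s) h := by
  rw [(QI.cone_zero X s).hrank_eq, hrank_prod, hrank_negD, hrank_shift, hrank_shift]
  simp

theorem QI.prod_cone (X Y : Cx σ) (s : ℤ) (f : MvPolynomial σ ℚ) :
    QI ((X.prod Y).cone s f) ((X.cone s f).prod (Y.cone s f)) := by
  refine QI.of_equiv (LinearEquiv.prodProdProdComm _ X.V Y.V X.V Y.V) ?_ ?_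
  · rintro ⟨⟨x, y⟩, x', y'⟩
    rfl
  · rintro k h ⟨⟨x, y⟩, x', y'⟩
    change ((x ∈ X.part (k - s) (h + 1) ∧ x' ∈ X.part (k + s) h) ∧
      (y ∈ Y.part (k - s) (h + 1) ∧ y' ∈ Y.part (k + s) h)) ↔
      ((x ∈ X.part (k - s) (h + 1) ∧ y ∈ Y.part (k - s) (h + 1)) ∧
      (x' ∈ X.part (k + s) h ∧ y' ∈ Y.part (k + s) h))
    tauto

theorem koszul_prod (X Y : Cx σ) : ∀ {l : List (ℤ × MvPolynomial σ ℚ)}, Homog l →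
    (X.prod Y).koszul l ≃q (X.koszul l).prod (Y.koszul l)
  | [], _ => .refl _
  | (_, _) :: _, hl => ((koszul_prod X Y (homog_cons.1 hl).2).cone (homog_cons.1 hl).1).trans
      (QI.prod_cone _ _ _ _).equiv

theorem QI.shift_cone (X : Cx σ) (s a b : ℤ) (f : MvPolynomial σ ℚ) :
    QI ((X.shift a b).cone s f) ((X.cone s f).shift a b) := by
  refine QI.of_equiv (LinearEquiv.refl _ (X.V × X.V)) (fun _ => rfl) ?_
  rintro k h ⟨x, y⟩
  change (x ∈ X.part (k - a - s) (h - b + 1) ∧ y ∈ X.part (k - a + s) (h - b)) ↔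
    (x ∈ X.part (k - s - a) (h + 1 - b) ∧ y ∈ X.part (k + s - a) (h - b))
  rw [show k - a - s = k - s - a by ring, show k - a + s = k + s - a by ring,
    show h - b + 1 = h + 1 - b by ring]

theorem koszul_shift (X : Cx σ) (a b : ℤ) : ∀ {l : List (ℤ × MvPolynomial σ ℚ)}, Homog l →
    (X.shift a b).koszul l ≃q (X.koszul l).shift a b
  | [], _ => .refl _
  | (_, _) :: _, hl => ((koszul_shift X a b (homog_cons.1 hl).2).cone (homog_cons.1 hl).1).trans
      (QI.shift_cone _ _ _ _ _).equiv

theorem hrank_koszul_prod (X Y : Cx σ) {l : List (ℤ × MvPolynomial σ ℚ)} (hl : Homog l)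
    (k h : ℤ) : ((X.prod Y).koszul l).hrank k h = (X.koszul l).hrank k h + (Y.koszul l).hrank k h :=
  ((koszul_prod X Y hl).hrank_eq k h).trans (hrank_prod _ _ _ _)

theorem hrank_koszul_shift (X : Cx σ) (a b : ℤ) {l : List (ℤ × MvPolynomial σ ℚ)} (hl : Homog l)
    (k h : ℤ) : ((X.shift a b).koszul l).hrank k h = (X.koszul l).hrank (k - a) (h - b) :=
  ((koszul_shift X a b hl).hrank_eq k h).trans (hrank_shift _ _ _ _ _)

/-- The mapping cone of a regular element is the quotient. -/
theorem QI.of_regular {X Y : Cx σ} {s : ℤ} {f : MvPolynomial σ ℚ}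
    (ψ : X.V →ₗ[MvPolynomial σ ℚ] Y.V) (hX : ∀ x, X.d x = 0) (hY : ∀ y, Y.d y = 0)
    (hp : ∀ k h x, x ∈ X.part k h → ψ x ∈ Y.part k h)
    (hs : ∀ k h y, y ∈ Y.part k h → ∃ x ∈ X.part k h, ψ x = y)
    (hreg : ∀ x : X.V, f • x = 0 → x = 0) (hf : ∀ x : X.V, ψ (f • x) = 0)
    (hker : ∀ k h x, x ∈ X.part k h → ψ x = 0 → ∃ x' ∈ X.part (k - (2 * s + 2)) h, x = f • x') :
    QI (X.cone s f) (Y.shift (-s) 0) := by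
  refine ⟨ψ.comp (LinearMap.snd _ X.V X.V), ?_, ?_, ?_, ?_⟩
  · rintro ⟨x, y⟩
    change ψ (f • x - X.d y) = Y.d (ψ y)
    rw [hX, hY, map_sub, hf, map_zero, sub_zero]
  · rintro k h ⟨x, y⟩ ⟨hx, hy⟩
    change ψ y ∈ Y.part (k - -s) (h - 0)
    rw [sub_neg_eq_add, sub_zero]
    exact hp _ _ _ hy
  · rintro k h ⟨x, y⟩ z ⟨hx, hy⟩ hd hz e
    obtain ⟨-, h2⟩ := Prod.mk.inj (show ((X.d x, f • x - X.d y) : X.V × X.V) = (0, 0) from hd)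
    rw [hX, sub_zero] at h2
    obtain rfl := hreg x h2
    replace e : ψ y = 0 := e.trans (hY z)
    obtain ⟨x', hx', rfl⟩ := hker _ _ _ hy e
    refine ⟨(x', 0), ⟨?_, zero_mem _⟩, ?_⟩
    · change x' ∈ X.part (k - 2 - s) (h - 1 + 1)
      rwa [show k - 2 - s = k + s - (2 * s + 2) by ring, show h - 1 + 1 = h by ring]
    · change ((0, f • x') : X.V × X.V) = (X.d x', f • x' - X.d 0)
      rw [hX, hX, sub_zero]
  · rintro k h y hy -
    change y ∈ Y.part (k - -s) (h - 0) at hy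
    rw [sub_neg_eq_add, sub_zero] at hy
    obtain ⟨x, hx, rfl⟩ := hs _ _ _ hy
    refine ⟨(0, x), ⟨zero_mem _, hx⟩, ?_, 0, zero_mem _, ?_⟩
    · change ((X.d 0, f • 0 - X.d x) : X.V × X.V) = (0, 0)
      rw [hX, hX, smul_zero, sub_zero]
    · change ψ x - ψ x = Y.d 0
      rw [map_zero, sub_self]

/-- Homomorphisms of polynomial rings that preserve the grading. -/
def Graded (g : MvPolynomial σ ℚ →ₐ[ℚ] MvPolynomial τ ℚ) : Prop :=
  ∀ f e, Deg f e → Deg (g f) e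

/-- Restriction of scalars along a homomorphism of graded polynomial rings. -/
def restrict (g : MvPolynomial σ ℚ →ₐ[ℚ] MvPolynomial τ ℚ) (hg : Graded g) (X : Cx τ) : Cx σ :=
  letI : Module (MvPolynomial σ ℚ) X.V := Module.compHom X.V g.toRingHom
  { V := X.V
    tower := ⟨fun a f v => by
      change g (a • f) • v = a • (g f • v)
      rw [map_smul, smul_assoc]⟩
    d :=
      { toFun := X.d
        map_add' := X.d.map_add
        map_smul' := fun f v => X.d.map_smul (g f) v }
    part := X.part
    smul_mem := fun hf hv => X.smul_mem (hg _ _ hf) hv }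

variable {g : MvPolynomial σ ℚ →ₐ[ℚ] MvPolynomial τ ℚ} {hg : Graded g}

theorem hrank_restrict (X : Cx τ) (k h : ℤ) : (X.restrict g hg).hrank k h = X.hrank k h :=
  hrank_eq_of_eq (LinearEquiv.refl ℚ X.V) (fun _ => Iff.rfl) fun _ => Iff.rfl

/-- Apply a homomorphism to the entries of a list. -/
def mapL (g : MvPolynomial σ ℚ →ₐ[ℚ] MvPolynomial τ ℚ) (l : List (ℤ × MvPolynomial σ ℚ)) :
    List (ℤ × MvPolynomial τ ℚ) := l.map fun e => (e.1, g e.2)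

theorem Homog.mapL {l : List (ℤ × MvPolynomial σ ℚ)} (hl : Homog l) (hg : Graded g) :
    Homog (mapL g l) := by
  intro e he
  obtain ⟨e', he', rfl⟩ := List.mem_map.1 he
  exact hg _ _ (hl e' he')

theorem QI.restrict_cone (X : Cx τ) (s : ℤ) (f : MvPolynomial σ ℚ) :
    QI ((X.restrict g hg).cone s f) ((X.cone s (g f)).restrict g hg) :=
  QI.of_equiv (Y := (X.cone s (g f)).restrict g hg) (X := (X.restrict g hg).cone s f)
    { toFun := fun v => v
      invFun := fun v => v
      left_inv := fun _ => rfl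
      right_inv := fun _ => rfl
      map_add' := fun _ _ => rfl
      map_smul' := fun _ _ => rfl } (fun _ => rfl) fun _ _ _ => Iff.rfl

theorem koszul_restrict (X : Cx τ) : ∀ {l : List (ℤ × MvPolynomial σ ℚ)}, Homog l →
    (X.restrict g hg).koszul l ≃q (X.koszul (mapL g l)).restrict g hg
  | [], _ => .refl _
  | (_, _) :: _, hl => ((koszul_restrict X (homog_cons.1 hl).2).cone (homog_cons.1 hl).1).trans
      (QI.restrict_cone _ _ _).equiv

/-- If all entries come from the smaller ring, the Koszul complex may be formed there, with the
coefficients regarded as a complex over that ring. A decomposition of the coefficients over the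
smaller ring then decomposes the homology. -/
theorem hrank_koszul_mapL (hg : Graded g) (X : Cx τ) {l : List (ℤ × MvPolynomial σ ℚ)}
    (hl : Homog l) (k h : ℤ) :
    (X.koszul (mapL g l)).hrank k h = ((X.restrict g hg).koszul l).hrank k h :=
  (((koszul_restrict X hl).hrank_eq k h).trans (hrank_restrict _ _ _)).symm

variable (σ) in
/-- The bihomogeneous parts of the polynomial ring, which is concentrated in homological
degree `0`. -/
def basePart (k h : ℤ) : Submodule ℚ (MvPolynomial σ ℚ) :=
  if h = 0 then MvPolynomial.weightedHomogeneousSubmodule ℚ (fun _ => (2 : ℤ)) k else ⊥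

theorem mem_basePart {k h : ℤ} {v : MvPolynomial σ ℚ} :
    v ∈ basePart σ k h ↔ Deg v k ∧ (h = 0 ∨ v = 0) := by
  unfold basePart
  split_ifs with hh
  · simp [hh, MvPolynomial.mem_weightedHomogeneousSubmodule]
  · simp only [Submodule.mem_bot, hh, false_or]
    refine ⟨fun h => ⟨h ▸ MvPolynomial.isWeightedHomogeneous_zero _ _ _, h⟩, fun h => h.2⟩

variable (σ) in
/-- The polynomial ring itself. -/
def base : Cx σ where
  V := MvPolynomial σ ℚ
  d := 0
  part := basePart σ
  smul_mem {f e k h v} hf hv := by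
    rw [mem_basePart] at hv ⊢
    refine ⟨?_, hv.2.imp_right fun h => by rw [h, smul_zero]⟩
    rw [add_comm]
    exact hf.mul hv.1

end Cx
end KR


/-! ### Elimination of variables and free variables in polynomial rings -/

namespace KR

open MvPolynomial

variable {σ τ : Type}

theorem deg_X (i : σ) : Deg (X i : MvPolynomial σ ℚ) 2 := isWeightedHomogeneous_X _ _ _

theorem Deg.mul' {f g : MvPolynomial σ ℚ} {a b c : ℤ} (hf : Deg f a) (hg : Deg g b)
    (h : a + b = c) : Deg (f * g) c := h ▸ IsWeightedHomogeneous.mul hf hg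

/-- A homogeneous polynomial takes homogeneous values. -/
theorem aeval_mem {A : Type} [CommRing A] [Algebra ℚ A] (𝒜 : ℤ → Submodule ℚ A) (h1 : 1 ∈ 𝒜 0)
    (hmul : ∀ i j a b, a ∈ 𝒜 i → b ∈ 𝒜 j → a * b ∈ 𝒜 (i + j)) {x : σ → A} (hx : ∀ i, x i ∈ 𝒜 2)
    {f : MvPolynomial σ ℚ} {e : ℤ} (hf : Deg f e) : aeval x f ∈ 𝒜 e := by
  rw [f.as_sum, map_sum]
  refine Submodule.sum_mem _ fun d hd => ?_
  have hpow : ∀ (i : σ) (n : ℕ), x i ^ n ∈ 𝒜 (n * 2) := by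
    intro i n
    induction n with
    | zero => simpa using h1
    | succ n ih =>
      rw [pow_succ, show ((n + 1 : ℕ) : ℤ) * 2 = n * 2 + 2 by push_cast; ring]
      exact hmul _ _ _ _ ih (hx i)
  have hprod : ∀ S : Finset σ, ∏ i ∈ S, x i ^ d i ∈ 𝒜 (∑ i ∈ S, (d i : ℤ) * 2) := by
    classical
    intro S
    induction S using Finset.induction_on with
    | empty => simpa using h1
    | insert i S hi ih =>
      rw [Finset.prod_insert hi, Finset.sum_insert hi]
      exact hmul _ _ _ _ (hpow _ _) ih
  have hw : ∑ i ∈ d.support, (d i : ℤ) * 2 = e := by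
    have := hf (mem_support_iff.1 hd)
    rw [← this, Finsupp.weight_apply, Finsupp.sum]
    simp
  rw [aeval_monomial, ← Algebra.smul_def, Finsupp.prod, ← hw]
  exact Submodule.smul_mem _ _ (hprod _)

theorem Cx.graded_aeval {x : σ → MvPolynomial τ ℚ} (hx : ∀ i, Deg (x i) 2) :
    Cx.Graded (aeval x) := fun _ _ hf =>
  aeval_mem (weightedHomogeneousSubmodule ℚ fun _ => (2 : ℤ)) (isWeightedHomogeneous_one _ _)
    (fun _ _ _ _ ha hb => IsWeightedHomogeneous.mul ha hb) hx hf

theorem Cx.graded_rename (f : σ → τ) : Cx.Graded (rename f : MvPolynomial σ ℚ →ₐ[ℚ] _) := by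
  rw [show (rename f : MvPolynomial σ ℚ →ₐ[ℚ] _) = aeval (X ∘ f) by ext; simp]
  exact Cx.graded_aeval fun i => deg_X _

/-- In a degree `j ≠ k - e`, the product of `f` with the component of `q` is the component of `f *
q` in degree `e + j`, which vanishes; the polynomial ring is a domain. -/
theorem deg_of_mul {f q : MvPolynomial σ ℚ} {e k : ℤ} (hf : Deg f e) (h0 : f ≠ 0)
    (h : Deg (f * q) k) : Deg q (k - e) := by
  classical
  let 𝒜 : ℤ → Submodule ℚ (MvPolynomial σ ℚ) := weightedHomogeneousSubmodule ℚ fun _ => (2 : ℤ)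
  let _ : GradedAlgebra 𝒜 := weightedGradedAlgebra ℚ _
  have key : ∀ j, j ≠ k - e → (DirectSum.decompose 𝒜 q j : MvPolynomial σ ℚ) = 0 := by
    intro j hj
    have h1 := DirectSum.coe_decompose_mul_add_of_left_mem (𝒜 := 𝒜) (i := e) (j := j) (b := q)
      (show f ∈ 𝒜 e from hf)
    rw [DirectSum.decompose_of_mem_ne 𝒜 (show f * q ∈ 𝒜 k from h) (by omega)] at h1
    exact (mul_eq_zero.1 h1.symm).resolve_left h0
  have h2 := DirectSum.sum_support_decompose 𝒜 q
  change q ∈ 𝒜 (k - e)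
  rw [← h2]
  refine Submodule.sum_mem _ fun j _ => ?_
  by_cases hj : j = k - e
  · rw [← hj]
    exact SetLike.coe_mem _
  · rw [key j hj]
    exact zero_mem _

namespace Cx

/-- Quotient by a regular element, for polynomial rings. -/
theorem hrank_koszul_subst {s : ℤ} {f : MvPolynomial σ ℚ} (hf : Deg f (2 * s + 2)) (h0 : f ≠ 0)
    (ψ : MvPolynomial σ ℚ →ₐ[ℚ] MvPolynomial τ ℚ) (hψ : Graded ψ)
    (ρ : MvPolynomial τ ℚ →ₐ[ℚ] MvPolynomial σ ℚ) (hρ : Graded ρ) (hψρ : ∀ p, ψ (ρ p) = p)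
    (hψf : ψ f = 0) (hker : ∀ p, ψ p = 0 → f ∣ p) {l : List (ℤ × MvPolynomial σ ℚ)} (hl : Homog l)
    (k h : ℤ) : ((base σ).koszul ((s, f) :: l)).hrank k h =
      ((base τ).koszul (mapL ψ l)).hrank (k + s) h := by
  have h1 : QI ((base σ).cone s f) (((base τ).restrict ψ hψ).shift (-s) 0) := by
    let φ : (base σ).V →ₗ[MvPolynomial σ ℚ] ((base τ).restrict ψ hψ).V :=
      { toFun := ψ
        map_add' := map_add ψ
        map_smul' := fun a b => map_mul ψ a b }
    refine QI.of_regular φ (fun _ => rfl) (fun _ => rfl) ?_ ?_ ?_ ?_ ?_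
    · intro k h x hx
      replace hx := mem_basePart.1 hx
      refine mem_basePart.2 ⟨hψ _ _ hx.1, hx.2.imp_right fun h => ?_⟩
      exact (congrArg ψ h).trans (map_zero ψ)
    · intro k h y hy
      have hy' := mem_basePart.1 hy
      refine ⟨ρ y, mem_basePart.2 ⟨hρ _ _ hy'.1, hy'.2.imp_right fun h => ?_⟩, hψρ y⟩
      rw [h, map_zero]
    · intro x hx
      exact (mul_eq_zero.1 hx).resolve_left h0
    · intro x
      refine (map_mul ψ f x).trans ?_
      rw [hψf, zero_mul]
      rfl
    · intro k h x hx hx0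
      obtain ⟨y, rfl⟩ := hker x hx0
      replace hx := mem_basePart.1 hx
      refine ⟨y, mem_basePart.2 ⟨deg_of_mul hf h0 hx.1, hx.2.imp_right fun h => ?_⟩, rfl⟩
      exact (mul_eq_zero.1 h).resolve_left h0
  have hH : Homog ((s, f) :: l) := homog_cons.2 ⟨hf, hl⟩
  -- The last entry of the list is the innermost cone, so the entry `(s, f)` is moved to the end
  -- before the cone of `base σ` is replaced by the quotient.
  rw [(koszul_perm _ (List.perm_append_singleton _ _).symm hH).hrank_eq, koszul_append]
  refine ((Equiv.koszul h1.equiv hl).hrank_eq k h).trans ?_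
  rw [hrank_koszul_shift _ _ _ hl, ← hrank_koszul_mapL hψ _ hl]
  simp

/-- Isomorphisms of polynomial rings. -/
theorem hrank_koszul_iso (ψ : MvPolynomial σ ℚ →ₐ[ℚ] MvPolynomial τ ℚ) (hψ : Graded ψ)
    (ρ : MvPolynomial τ ℚ →ₐ[ℚ] MvPolynomial σ ℚ) (hρ : Graded ρ) (hψρ : ∀ p, ψ (ρ p) = p)
    (hρψ : ∀ p, ρ (ψ p) = p) {l : List (ℤ × MvPolynomial σ ℚ)} (hl : Homog l)
    (k h : ℤ) : ((base τ).koszul (mapL ψ l)).hrank k h = ((base σ).koszul l).hrank k h := by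
  rw [hrank_koszul_mapL hψ _ hl]
  refine (Equiv.koszul (QI.equiv ?_) hl).hrank_eq k h
  let φ : ((base τ).restrict ψ hψ).V ≃ₗ[MvPolynomial σ ℚ] (base σ).V :=
    { toFun := ρ
      invFun := ψ
      left_inv := hψρ
      right_inv := hρψ
      map_add' := map_add ρ
      map_smul' := fun a b => by
        refine (map_mul ρ (ψ a) b).trans ?_
        rw [hρψ]
        rfl }
  refine QI.of_equiv φ (fun _ => map_zero ρ) fun k h (x : MvPolynomial τ ℚ) => ?_
  change ρ x ∈ basePart σ k h ↔ x ∈ basePart τ k h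
  rw [mem_basePart]
  refine Iff.trans ?_ mem_basePart.symm
  constructor
  · rintro ⟨h1, h2⟩
    have := hψ _ _ h1
    rw [hψρ] at this
    exact ⟨this, h2.imp_right fun h => (hψρ x).symm.trans ((congrArg ψ h).trans (map_zero ψ))⟩
  · rintro ⟨h1, h2⟩
    exact ⟨hρ _ _ h1, h2.imp_right fun h => (congrArg ρ h).trans (map_zero ρ)⟩

theorem hrank_koszul_rename (e : σ ≃ τ) {l : List (ℤ × MvPolynomial σ ℚ)} (hl : Homog l)
    (k h : ℤ) : ((base τ).koszul (mapL (rename e) l)).hrank k h = ((base σ).koszul l).hrank k h :=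
  hrank_koszul_iso (rename e) (graded_rename e) (rename e.symm) (graded_rename _)
    (fun p => by rw [rename_rename]; simp) (fun p => by rw [rename_rename]; simp) hl k h

/-- The substitution of `c` for the additional variable. -/
abbrev substNone (c : MvPolynomial σ ℚ) : MvPolynomial (Option σ) ℚ →ₐ[ℚ] MvPolynomial σ ℚ :=
  aeval fun o => o.elim c X

theorem substNone_rename (c p : MvPolynomial σ ℚ) : substNone c (rename some p) = p := by
  rw [aeval_rename]
  exact aeval_X_left_apply p

theorem graded_substNone {c : MvPolynomial σ ℚ} (hc : Deg c 2) : Graded (substNone c) :=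
  graded_aeval fun o => by
    cases o with
    | none => exact hc
    | some i => exact deg_X i

/-- Division with remainder by `X none - c`; it shows that the kernel of the substitution is
principal. -/
theorem exists_eq_add_X_none_sub_mul (c : MvPolynomial σ ℚ) (p : MvPolynomial (Option σ) ℚ) :
    ∃ q, p = rename some (substNone c p) + (X none - rename some c) * q := by
  induction p using MvPolynomial.induction_on with
  | C a => exact ⟨0, by simp⟩
  | add p q hp hq =>
    obtain ⟨p', hp⟩ := hp
    obtain ⟨q', hq⟩ := hq
    refine ⟨p' + q', ?_⟩
    rw [map_add, map_add]
    linear_combination hp + hq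
  | mul_X p o hp =>
    obtain ⟨p', hp⟩ := hp
    cases o with
    | some i =>
      refine ⟨p' * X (some i), ?_⟩
      simp only [map_mul, aeval_X, Option.elim_some, rename_X]
      linear_combination (X (some i)) * hp
    | none =>
      refine ⟨p' * X none + rename some (substNone c p), ?_⟩
      simp only [map_mul, aeval_X, Option.elim_none]
      linear_combination (X none) * hp

theorem X_none_sub_ne_zero (c : MvPolynomial σ ℚ) :
    (X none - rename some c : MvPolynomial (Option σ) ℚ) ≠ 0 := by
  intro h
  -- Substituting `c + 1` for the variable turns `X none - c` into `1`.
  have := congrArg (substNone (c + 1)) h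
  rw [map_sub, substNone_rename, map_zero, aeval_X] at this
  simp at this

/-- Elimination of a variable by a linear equation. -/
theorem hrank_koszul_elim {c : MvPolynomial σ ℚ} (hc : Deg c 2)
    {l : List (ℤ × MvPolynomial (Option σ) ℚ)} (hl : Homog l) (k h : ℤ) :
    ((base (Option σ)).koszul ((0, X none - rename some c) :: l)).hrank k h =
      ((base σ).koszul (mapL (substNone c) l)).hrank k h := by
  rw [hrank_koszul_subst (s := 0) ?_ (X_none_sub_ne_zero c) (substNone c) (graded_substNone hc)
    (rename some) (graded_rename _) (substNone_rename c) ?_ ?_ hl k h, add_zero]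
  · exact (deg_X none).sub (graded_rename some _ _ hc)
  · rw [map_sub, substNone_rename, aeval_X, Option.elim_none, sub_self]
  · intro p hp
    obtain ⟨q, hq⟩ := exists_eq_add_X_none_sub_mul c p
    rw [hp, map_zero, zero_add] at hq
    exact ⟨q, hq⟩

/-- Splitting off the constant term gives `ℚ[σ][x] = ℚ[σ] ⊕ x ℚ[σ][x]` over `ℚ[σ]`, and the second
summand is the whole ring shifted by `2`. As a recursion in `k` this encodes the factor `1 / (1 - q
^ 2)` without an infinite direct sum. -/
theorem hrank_koszul_polynomial {l : List (ℤ × MvPolynomial σ ℚ)} (hl : Homog l) (k h : ℤ) :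
    ((base (Option σ)).koszul (mapL (rename some) l)).hrank k h = ((base σ).koszul l).hrank k h +
      ((base (Option σ)).koszul (mapL (rename some) l)).hrank (k - 2) h := by
  have hg := graded_rename (some : σ → Option σ)
  rw [hrank_koszul_mapL hg _ hl, hrank_koszul_mapL hg _ hl]
  let X' := (base (Option σ)).restrict _ hg
  have h0 : ∀ (a : MvPolynomial σ ℚ) g, substNone 0 (rename some a + X none * g) = a := by
    intro a g
    rw [map_add, map_mul, substNone_rename, aeval_X, Option.elim_none, zero_mul, add_zero]
  have hadd : ∀ v w : MvPolynomial σ ℚ × MvPolynomial (Option σ) ℚ,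
      (rename some (v.1 + w.1) + X none * (v.2 + w.2) : MvPolynomial (Option σ) ℚ) =
        (rename some v.1 + X none * v.2) + (rename some w.1 + X none * w.2) := by
    intro v w
    rw [map_add]
    ring
  have hsmul : ∀ (c : MvPolynomial σ ℚ) (v : MvPolynomial σ ℚ × MvPolynomial (Option σ) ℚ),
      (rename some (c * v.1) + X none * (rename some c * v.2) : MvPolynomial (Option σ) ℚ) =
        rename some c * (rename some v.1 + X none * v.2) := by
    intro c v
    rw [map_mul]
    ring
  let φ : ((base σ).prod (X'.shift 2 0)).V →ₗ[MvPolynomial σ ℚ] X'.V :=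
    { toFun := fun v : MvPolynomial σ ℚ × MvPolynomial (Option σ) ℚ =>
        (rename some v.1 + X none * v.2 : MvPolynomial (Option σ) ℚ)
      map_add' := hadd
      map_smul' := hsmul }
  have hX : (X none : MvPolynomial (Option σ) ℚ) ≠ 0 := X_ne_zero _
  have hφ : Function.Bijective φ := by
    constructor
    · have : ∀ (a a' : MvPolynomial σ ℚ) (g g' : MvPolynomial (Option σ) ℚ),
          rename some a + X none * g = rename some a' + X none * g' → (a, g) = (a', g') := ?_
      · exact fun v w h => this v.1 w.1 v.2 w.2 h
      intro a a' g g' h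
      have h1 : a = a' := by rw [← h0 a g, h, h0]
      subst h1
      rw [add_right_inj] at h
      rw [mul_left_cancel₀ hX h]
    · intro (p : MvPolynomial (Option σ) ℚ)
      obtain ⟨q, hq⟩ := exists_eq_add_X_none_sub_mul 0 p
      rw [map_zero, sub_zero] at hq
      exact ⟨(substNone 0 p, q), hq.symm⟩
  have hq : QI ((base σ).prod (X'.shift 2 0)) X' := by
    refine QI.of_equiv (LinearEquiv.ofBijective φ hφ) (fun _ => map_zero φ) ?_
    have : ∀ (k h : ℤ) (a : MvPolynomial σ ℚ) (g : MvPolynomial (Option σ) ℚ),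
        rename some a + X none * g ∈ basePart (Option σ) k h ↔
          a ∈ basePart σ k h ∧ g ∈ basePart (Option σ) (k - 2) (h - 0) := ?_
    · exact fun k h v => this k h v.1 v.2
    intro k h a g
    rw [mem_basePart, mem_basePart, mem_basePart, sub_zero]
    constructor
    · rintro ⟨h1, h2⟩
      have ha := graded_substNone (isWeightedHomogeneous_zero _ _ _) _ _ h1
      rw [h0] at ha
      have hg' : Deg (X none * g) k := by
        have := h1.sub (hg _ _ ha)
        rwa [add_sub_cancel_left] at this
      refine ⟨⟨ha, h2.imp_right fun h => ?_⟩, deg_of_mul (deg_X none) hX hg',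
        h2.imp_right fun h => ?_⟩
      · rw [← h0 a g, h, map_zero]
      · have h3 : a = 0 := by rw [← h0 a g, h, map_zero]
        rw [h3, map_zero, zero_add] at h
        exact (mul_eq_zero.1 h).resolve_left hX
    · rintro ⟨⟨h1, h2⟩, h3, h4⟩
      refine ⟨(hg _ _ h1).add ((deg_X none).mul' h3 (by ring)), ?_⟩
      rcases h2 with h2 | h2
      · exact .inl h2
      · refine h4.imp_right fun h4 => ?_
        rw [h2, h4]
        simp
  rw [← (Equiv.koszul hq.equiv hl).hrank_eq, hrank_koszul_prod _ _ hl, hrank_koszul_shift _ _ _ hl,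
    sub_zero]

end Cx
end KR


/-! ### Adjoining a root of a monic quadratic polynomial -/

namespace KR

open MvPolynomial

namespace Cx

variable {σ : Type}

theorem mul_mem_basePart {f v : MvPolynomial σ ℚ} {e k k' h : ℤ} (hf : Deg f e)
    (hv : v ∈ basePart σ k h) (hk : k + e = k') : f * v ∈ basePart σ k' h :=
  hk ▸ (base σ).smul_mem hf hv

/-- The polynomial ring with a root of a quadratic polynomial adjoined, as a module over the
polynomial ring with one more variable. -/
def toQuad (β α : MvPolynomial σ ℚ) :
    MvPolynomial (Option σ) ℚ →ₐ[ℚ] QuadraticAlgebra (MvPolynomial σ ℚ) β α :=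
  aeval fun o => o.elim ⟨0, 1⟩ fun i => ⟨X i, 0⟩

theorem toQuad_rename (β α p : MvPolynomial σ ℚ) : toQuad β α (rename some p) = ⟨p, 0⟩ := by
  rw [toQuad, aeval_rename]
  induction p using MvPolynomial.induction_on with
  | C a =>
    rw [aeval_C]
    rfl
  | add p q hp hq =>
    rw [map_add, hp, hq]
    ext <;> simp
  | mul_X p i hp =>
    rw [map_mul, hp, aeval_X]
    ext <;> simp

theorem toQuad_X_none (β α : MvPolynomial σ ℚ) : toQuad β α (X none) = ⟨0, 1⟩ := by
  rw [toQuad, aeval_X]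
  rfl

/-- The parts of a quadratic extension. -/
def quadPart (β α : MvPolynomial σ ℚ) (k h : ℤ) :
    Submodule ℚ (QuadraticAlgebra (MvPolynomial σ ℚ) β α) where
  carrier := {v | v.re ∈ basePart σ k h ∧ v.im ∈ basePart σ (k - 2) h}
  zero_mem' := ⟨zero_mem _, zero_mem _⟩
  add_mem' hv hw := ⟨add_mem hv.1 hw.1, add_mem hv.2 hw.2⟩
  smul_mem' c _ hv := ⟨Submodule.smul_mem _ c hv.1, Submodule.smul_mem _ c hv.2⟩

theorem mem_quadPart {β α : MvPolynomial σ ℚ} {k h : ℤ}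
    {v : QuadraticAlgebra (MvPolynomial σ ℚ) β α} :
    v ∈ quadPart β α k h ↔ v.re ∈ basePart σ k h ∧ v.im ∈ basePart σ (k - 2) h := Iff.rfl

theorem quadPart_mul {β α : MvPolynomial σ ℚ} (hβ : Deg β 4) (hα : Deg α 2) {k e h : ℤ}
    {v w : QuadraticAlgebra (MvPolynomial σ ℚ) β α} (hv : v ∈ quadPart β α e 0)
    (hw : w ∈ quadPart β α k h) : v * w ∈ quadPart β α (k + e) h := by
  have h1 := (mem_basePart.1 hv.1).1
  have h2 := (mem_basePart.1 hv.2).1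
  refine ⟨?_, ?_⟩
  · rw [QuadraticAlgebra.re_mul, mul_assoc]
    exact add_mem (mul_mem_basePart h1 hw.1 (by ring))
      (mul_mem_basePart hβ (mul_mem_basePart h2 hw.2 rfl) (by ring))
  · rw [QuadraticAlgebra.im_mul, mul_assoc]
    exact add_mem (add_mem (mul_mem_basePart h1 hw.2 (by ring))
      (mul_mem_basePart h2 hw.1 (by ring)))
      (mul_mem_basePart hα (mul_mem_basePart h2 hw.2 rfl) (by ring))

theorem toQuad_mem {β α : MvPolynomial σ ℚ} (hβ : Deg β 4) (hα : Deg α 2)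
    {f : MvPolynomial (Option σ) ℚ} {e : ℤ} (hf : Deg f e) : toQuad β α f ∈ quadPart β α e 0 := by
  refine aeval_mem (fun k => quadPart β α k 0) ?_ ?_ ?_ hf
  · exact ⟨mem_basePart.2 ⟨isWeightedHomogeneous_one _ _, .inl rfl⟩, zero_mem _⟩
  · intro i j a b ha hb
    rw [add_comm]
    exact quadPart_mul hβ hα ha hb
  · rintro (_ | i)
    · exact ⟨zero_mem _, mem_basePart.2 ⟨isWeightedHomogeneous_one _ _, .inl rfl⟩⟩
    · exact ⟨mem_basePart.2 ⟨deg_X i, .inl rfl⟩, zero_mem _⟩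

/-- The quadratic extension as a complex. -/
def quadCx (β α : MvPolynomial σ ℚ) (hβ : Deg β 4) (hα : Deg α 2) : Cx (Option σ) :=
  letI : Module (MvPolynomial (Option σ) ℚ) (QuadraticAlgebra (MvPolynomial σ ℚ) β α) :=
    Module.compHom _ (toQuad β α).toRingHom
  { V := QuadraticAlgebra (MvPolynomial σ ℚ) β α
    tower := ⟨fun a f v => by
      change toQuad β α (a • f) * v = a • (toQuad β α f * v)
      rw [map_smul, smul_mul_assoc]⟩
    d := 0
    part := quadPart β α
    smul_mem := fun hf hv => quadPart_mul hβ hα (toQuad_mem hβ hα hf) hv }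

/-- The monic quadratic polynomial. -/
def monicQuad (β α : MvPolynomial σ ℚ) : MvPolynomial (Option σ) ℚ :=
  X none * X none - rename some α * X none - rename some β

theorem deg_monicQuad {β α : MvPolynomial σ ℚ} (hβ : Deg β 4) (hα : Deg α 2) :
    Deg (monicQuad β α) 4 :=
  (((deg_X _).mul' (deg_X _) (by norm_num)).sub
    (Deg.mul' (graded_rename some _ _ hα) (deg_X _) (by norm_num))).sub (graded_rename some _ _ hβ)

theorem toQuad_monicQuad (β α : MvPolynomial σ ℚ) : toQuad β α (monicQuad β α) = 0 := by
  rw [monicQuad, map_sub, map_sub, map_mul, map_mul, toQuad_rename, toQuad_rename, toQuad_X_none]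
  ext <;> simp

/-- Division with remainder by the monic quadratic: the remainder is read off from the coordinates
of the image in the quadratic extension. -/
theorem exists_eq_add_monicQuad_mul (β α : MvPolynomial σ ℚ) (p : MvPolynomial (Option σ) ℚ) :
    ∃ q, p = rename some (toQuad β α p).re + rename some (toQuad β α p).im * X none +
      monicQuad β α * q := by
  induction p using MvPolynomial.induction_on with
  | C a =>
    refine ⟨0, ?_⟩
    have : toQuad β α (C a) = ⟨C a, 0⟩ := by rw [toQuad, aeval_C]; rfl
    rw [this]
    simp
  | add p q hp hq =>
    obtain ⟨p', hp⟩ := hp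
    obtain ⟨q', hq⟩ := hq
    refine ⟨p' + q', ?_⟩
    rw [map_add, QuadraticAlgebra.re_add, QuadraticAlgebra.im_add, map_add, map_add]
    linear_combination hp + hq
  | mul_X p o hp =>
    obtain ⟨p', hp⟩ := hp
    cases o with
    | some i =>
      refine ⟨p' * X (some i), ?_⟩
      have : toQuad β α (X (some i)) = ⟨X i, 0⟩ := by rw [toQuad, aeval_X]; rfl
      rw [map_mul, this, QuadraticAlgebra.re_mul, QuadraticAlgebra.im_mul]
      simp only [mul_zero, add_zero, zero_add, map_mul, rename_X]
      linear_combination (X (some i)) * hp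
    | none =>
      refine ⟨p' * X none + rename some (toQuad β α p).im, ?_⟩
      rw [map_mul, toQuad_X_none, QuadraticAlgebra.re_mul, QuadraticAlgebra.im_mul]
      simp only [mul_zero, mul_one, zero_add, add_zero, map_mul, map_add]
      have hm : monicQuad β α = X none * X none - rename some α * X none - rename some β := rfl
      linear_combination (X none) * hp - rename some (toQuad β α p).im * hm

theorem monicQuad_ne_zero (β α : MvPolynomial σ ℚ) : monicQuad β α ≠ 0 := by
  intro h
  obtain ⟨q, hq⟩ := exists_eq_add_monicQuad_mul β α (X none * X none)
  -- In the quadratic extension with `β + 1` in place of `β` the polynomial takes the value `1`.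
  have h1 := congrArg (toQuad (β + 1) α) h
  rw [monicQuad, map_sub, map_sub, map_mul, map_mul, toQuad_rename, toQuad_rename, toQuad_X_none,
    map_zero] at h1
  have := congrArg QuadraticAlgebra.re h1
  simp at this

/-- The monic quadratic is regular and the quotient by it is the quadratic extension. The latter is
free on `1` and the root over the smaller ring, in degrees `0` and `2`; with the shift by `-1` these
become the symmetric degrees `-1` and `1`. -/
theorem QI.cone_monicQuad {β α : MvPolynomial σ ℚ} (hβ : Deg β 4) (hα : Deg α 2) :
    QI ((base (Option σ)).cone 1 (monicQuad β α)) ((quadCx β α hβ hα).shift (-1) 0) := by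
  let φ : (base (Option σ)).V →ₗ[MvPolynomial (Option σ) ℚ] (quadCx β α hβ hα).V :=
    { toFun := toQuad β α
      map_add' := map_add (toQuad β α)
      map_smul' := fun a b => map_mul (toQuad β α) a b }
  have hz : ∀ {h : ℤ} {x : MvPolynomial (Option σ) ℚ}, h = 0 ∨ x = 0 → ∀ {k},
      toQuad β α x ∈ quadPart β α k 0 → toQuad β α x ∈ quadPart β α k h := by
    rintro h x (rfl | rfl) k hx
    · exact hx
    · rw [map_zero]
      exact zero_mem _
  refine QI.of_regular φ (fun _ => rfl) (fun _ => rfl) ?_ ?_ ?_ ?_ ?_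
  · intro k h x hx
    replace hx := mem_basePart.1 hx
    exact hz hx.2 (toQuad_mem hβ hα hx.1)
  · intro k h (y : QuadraticAlgebra (MvPolynomial σ ℚ) β α) (hy : y ∈ quadPart β α k h)
    have h1 := mem_basePart.1 hy.1
    have h2 := mem_basePart.1 hy.2
    let x : MvPolynomial (Option σ) ℚ := rename some y.re + rename some y.im * X none
    have hx : x ∈ basePart (Option σ) k h := by
      refine add_mem (mem_basePart.2 ⟨graded_rename some _ _ h1.1, h1.2.imp_right fun h => ?_⟩)
        (mem_basePart.2 ⟨Deg.mul' (graded_rename some _ _ h2.1) (deg_X _) (by ring),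
          h2.2.imp_right fun h => ?_⟩)
      · rw [h, map_zero]
      · rw [h, map_zero, zero_mul]
    have hxy : toQuad β α x = y := by
      rw [map_add, map_mul, toQuad_rename, toQuad_rename, toQuad_X_none]
      ext <;> simp
    exact ⟨x, hx, hxy⟩
  · intro x hx
    exact (mul_eq_zero.1 hx).resolve_left (monicQuad_ne_zero β α)
  · intro x
    refine (map_mul (toQuad β α) (monicQuad β α) x).trans ?_
    rw [toQuad_monicQuad, zero_mul]
    rfl
  · intro k h (x : MvPolynomial (Option σ) ℚ) hx hx0
    obtain ⟨y, hy⟩ := exists_eq_add_monicQuad_mul β α x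
    rw [show toQuad β α x = 0 from hx0] at hy
    simp only [QuadraticAlgebra.re_zero, QuadraticAlgebra.im_zero, map_zero, zero_mul, zero_add,
      add_zero] at hy
    subst hy
    replace hx := mem_basePart.1 hx
    refine ⟨y, mem_basePart.2 ⟨deg_of_mul (deg_monicQuad hβ hα) (monicQuad_ne_zero β α) hx.1,
      hx.2.imp_right fun h => ?_⟩, rfl⟩
    exact (mul_eq_zero.1 h).resolve_left (monicQuad_ne_zero β α)

theorem quadCx_restrict {β α : MvPolynomial σ ℚ} (hβ : Deg β 4) (hα : Deg α 2)
    (hg : Graded (rename some : MvPolynomial σ ℚ →ₐ[ℚ] _)) :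
    QI ((quadCx β α hβ hα).restrict (rename some) hg) ((base σ).prod ((base σ).shift 2 0)) := by
  have hsmul : ∀ (c : MvPolynomial σ ℚ) (v : QuadraticAlgebra (MvPolynomial σ ℚ) β α),
      ((toQuad β α (rename some c) * v).re, (toQuad β α (rename some c) * v).im) =
        (c * v.re, c * v.im) := by
    intro c v
    rw [toQuad_rename]
    simp
  let φ : ((quadCx β α hβ hα).restrict (rename some) hg).V ≃ₗ[MvPolynomial σ ℚ]
      ((base σ).prod ((base σ).shift 2 0)).V :=
    { toFun := fun v : QuadraticAlgebra (MvPolynomial σ ℚ) β α => (v.re, v.im)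
      invFun := fun v : MvPolynomial σ ℚ × MvPolynomial σ ℚ => ⟨v.1, v.2⟩
      left_inv := fun _ => rfl
      right_inv := fun _ => rfl
      map_add' := fun _ _ => rfl
      map_smul' := hsmul }
  refine QI.of_equiv φ (fun _ => rfl)
    fun k h (v : QuadraticAlgebra (MvPolynomial σ ℚ) β α) => ?_
  change (v.re ∈ basePart σ k h ∧ v.im ∈ basePart σ (k - 2) (h - 0)) ↔
    (v.re ∈ basePart σ k h ∧ v.im ∈ basePart σ (k - 2) h)
  rw [sub_zero]

/-- A monic quadratic equation doubles the homology. -/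
theorem hrank_koszul_monicQuad {β α : MvPolynomial σ ℚ} (hβ : Deg β 4) (hα : Deg α 2)
    {l : List (ℤ × MvPolynomial σ ℚ)} (hl : Homog l) (k h : ℤ) :
    ((base (Option σ)).koszul ((1, monicQuad β α) :: mapL (rename some) l)).hrank k h =
      ((base σ).koszul l).hrank (k + 1) h + ((base σ).koszul l).hrank (k - 1) h := by
  have hg := graded_rename (some : σ → Option σ)
  have hm : Homog (mapL (rename some : MvPolynomial σ ℚ →ₐ[ℚ] _) l) := hl.mapL hg
  have hH : Homog ((1, monicQuad β α) :: mapL (rename some) l) :=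
    homog_cons.2 ⟨deg_monicQuad hβ hα, hm⟩
  rw [(koszul_perm _ (List.perm_append_singleton _ _).symm hH).hrank_eq, koszul_append]
  refine ((Equiv.koszul (QI.cone_monicQuad hβ hα).equiv hm).hrank_eq k h).trans ?_
  rw [hrank_koszul_shift _ _ _ hm, hrank_koszul_mapL hg _ hl,
    (Equiv.koszul (quadCx_restrict hβ hα hg).equiv hl).hrank_eq, hrank_koszul_prod _ _ hl,
    hrank_koszul_shift _ _ _ hl]
  congr 2 <;> ring

/-- Write `x` for the root and `N = g * g - α * g - β` for the value of the quadratic at `g`. Since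
`(x - g) * (α - g - x) = N`, multiplication by `x - g` is diagonal with entries `1` and `N` for the
basis `1, α - g - x` of the source and the basis `x - g, 1` of the target. `F` takes coordinates in
these bases. The extra factor `t` gives the cones on `t`, of degree `2`, and on `t * N`, of degree
`6`. -/
theorem quadCx_cone_restrict {β α t g : MvPolynomial σ ℚ} (hβ : Deg β 4) (hα : Deg α 2)
    (hg : Deg g 2) (hr : Graded (rename some : MvPolynomial σ ℚ →ₐ[ℚ] _)) :
    QI ((((quadCx β α hβ hα).shift (-1) 0).cone 1
      (rename some t * (X none - rename some g))).restrict (rename some) hr)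
      (((base σ).cone 0 t).prod ((base σ).cone 2 (t * (g * g - α * g - β)))) := by
  let F : QuadraticAlgebra (MvPolynomial σ ℚ) β α × QuadraticAlgebra (MvPolynomial σ ℚ) β α → (MvPolynomial σ ℚ × MvPolynomial σ ℚ) × (MvPolynomial σ ℚ × MvPolynomial σ ℚ) := fun v =>
    ((v.1.re + (α - g) * v.1.im, v.2.im), (-v.1.im, v.2.re + g * v.2.im))
  let G : (MvPolynomial σ ℚ × MvPolynomial σ ℚ) × (MvPolynomial σ ℚ × MvPolynomial σ ℚ) → QuadraticAlgebra (MvPolynomial σ ℚ) β α × QuadraticAlgebra (MvPolynomial σ ℚ) β α := fun v =>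
    (⟨v.1.1 + (α - g) * v.2.1, -v.2.1⟩, ⟨v.2.2 - g * v.1.2, v.1.2⟩)
  have hGF : ∀ v, G (F v) = v := by
    rintro ⟨⟨a, b⟩, c, d⟩
    simp only [F, G, Prod.mk.injEq, QuadraticAlgebra.mk.injEq]
    refine ⟨⟨by ring, by ring⟩, by ring, trivial⟩
  have hFG : ∀ v, F (G v) = v := by
    rintro ⟨⟨a, b⟩, c, d⟩
    simp only [F, G, Prod.mk.injEq]
    refine ⟨⟨by ring, trivial⟩, by ring, by ring⟩
  have hadd : ∀ v w : QuadraticAlgebra (MvPolynomial σ ℚ) β α × QuadraticAlgebra (MvPolynomial σ ℚ) β α, F (v + w) = F v + F w := by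
    rintro ⟨⟨a, b⟩, c, d⟩ ⟨⟨a', b'⟩, c', d'⟩
    simp only [F, Prod.mk_add_mk, Prod.mk.injEq, QuadraticAlgebra.re_add, QuadraticAlgebra.im_add]
    refine ⟨⟨by ring, trivial⟩, by ring, by ring⟩
  have hsmul : ∀ (c : MvPolynomial σ ℚ) (v : QuadraticAlgebra (MvPolynomial σ ℚ) β α × QuadraticAlgebra (MvPolynomial σ ℚ) β α), F (toQuad β α (rename some c) * v.1,
      toQuad β α (rename some c) * v.2) = c • F v := by
    rintro e ⟨⟨a, b⟩, c, d⟩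
    rw [toQuad_rename]
    simp only [F, Prod.smul_mk, smul_eq_mul, Prod.mk.injEq, QuadraticAlgebra.re_mul,
      QuadraticAlgebra.im_mul]
    refine ⟨⟨by ring, by ring⟩, by ring, by ring⟩
  let φ : ((((quadCx β α hβ hα).shift (-1) 0).cone 1
      (rename some t * (X none - rename some g))).restrict (rename some) hr).V ≃ₗ[MvPolynomial σ ℚ]
      (((base σ).cone 0 t).prod ((base σ).cone 2 (t * (g * g - α * g - β)))).V :=
    { toFun := F
      invFun := G
      left_inv := hGF
      right_inv := hFG
      map_add' := hadd
      map_smul' := hsmul }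
  refine QI.of_equiv φ ?_ ?_
  · have hd : ∀ v : QuadraticAlgebra (MvPolynomial σ ℚ) β α × QuadraticAlgebra (MvPolynomial σ ℚ) β α, F (0, toQuad β α (rename some t * (X none - rename some g)) * v.1 - 0) =
        ((0, t * (F v).1.1 - 0), (0, t * (g * g - α * g - β) * (F v).2.1 - 0)) := by
      rintro ⟨⟨a, b⟩, c, d⟩
      rw [map_mul, map_sub, toQuad_rename, toQuad_rename, toQuad_X_none]
      have e1 : ((⟨t, 0⟩ : QuadraticAlgebra (MvPolynomial σ ℚ) β α) * ((⟨0, 1⟩ : QuadraticAlgebra (MvPolynomial σ ℚ) β α) - ⟨g, 0⟩) * ⟨a, b⟩ - 0).re =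
          - t * g * a + t * β * b := by
        simp only [QuadraticAlgebra.re_sub, QuadraticAlgebra.im_sub, QuadraticAlgebra.re_mul,
          QuadraticAlgebra.im_mul, QuadraticAlgebra.re_zero]
        ring
      have e2 : ((⟨t, 0⟩ : QuadraticAlgebra (MvPolynomial σ ℚ) β α) * ((⟨0, 1⟩ : QuadraticAlgebra (MvPolynomial σ ℚ) β α) - ⟨g, 0⟩) * ⟨a, b⟩ - 0).im =
          t * a - t * g * b + t * α * b := by
        simp only [QuadraticAlgebra.re_sub, QuadraticAlgebra.im_sub, QuadraticAlgebra.re_mul,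
          QuadraticAlgebra.im_mul, QuadraticAlgebra.im_zero]
        ring
      simp only [F, e1, e2]
      simp only [Prod.mk.injEq, QuadraticAlgebra.re_zero, QuadraticAlgebra.im_zero]
      refine ⟨⟨by ring, by ring⟩, by ring, by ring⟩
    exact hd
  · have hp : ∀ k h (v : QuadraticAlgebra (MvPolynomial σ ℚ) β α × QuadraticAlgebra (MvPolynomial σ ℚ) β α),
        ((((F v).1.1 ∈ basePart σ (k - 0) (h + 1)) ∧ ((F v).1.2 ∈ basePart σ (k + 0) h)) ∧
        (((F v).2.1 ∈ basePart σ (k - 2) (h + 1)) ∧ ((F v).2.2 ∈ basePart σ (k + 2) h))) ↔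
        (v.1 ∈ quadPart β α (k - 1 - -1) (h + 1 - 0) ∧ v.2 ∈ quadPart β α (k + 1 - -1) (h - 0)) := by
      rintro k h ⟨⟨a, b⟩, c, d⟩
      simp only [F, mem_quadPart, sub_zero, add_zero, neg_mem_iff,
        show k - 1 - -1 = k by ring, show k + 1 - -1 = k + 2 by ring, show k + 2 - 2 = k by ring]
      have h1 : b ∈ basePart σ (k - 2) (h + 1) → (α - g) * b ∈ basePart σ k (h + 1) := fun hb =>
        mul_mem_basePart (hα.sub hg) hb (by ring)
      have h2 : d ∈ basePart σ k h → g * d ∈ basePart σ (k + 2) h := fun hd =>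
        mul_mem_basePart hg hd (by ring)
      constructor
      · rintro ⟨⟨ha, hd⟩, hb, hc⟩
        exact ⟨⟨(Submodule.add_mem_iff_left _ (h1 hb)).1 ha, hb⟩,
          (Submodule.add_mem_iff_left _ (h2 hd)).1 hc, hd⟩
      · rintro ⟨⟨ha, hb⟩, hc, hd⟩
        exact ⟨⟨add_mem ha (h1 hb), hd⟩, hb, add_mem hc (h2 hd)⟩
    exact hp

/-- Passing to the quotient by the monic quadratic and diagonalizing the other entry removes the
variable and splits the complex in two. This is the splitting behind relation III. -/
theorem hrank_koszul_monicQuad_linear {β α t g : MvPolynomial σ ℚ} (hβ : Deg β 4) (hα : Deg α 2)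
    (ht : Deg t 2) (hg : Deg g 2) {l : List (ℤ × MvPolynomial σ ℚ)} (hl : Homog l) (k h : ℤ) :
    ((base (Option σ)).koszul ((1, rename some t * (X none - rename some g)) ::
      (1, monicQuad β α) :: mapL (rename some) l)).hrank k h =
      ((base σ).koszul ((0, t) :: l)).hrank k h +
        ((base σ).koszul ((2, t * (g * g - α * g - β)) :: l)).hrank k h := by
  have hr := graded_rename (some : σ → Option σ)
  have hm : Homog (mapL (rename some : MvPolynomial σ ℚ →ₐ[ℚ] _) l) := hl.mapL hr
  have h1 : Deg (rename some t * (X none - rename some g)) (2 * 1 + 2) :=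
    (hr _ _ ht).mul' ((deg_X _).sub (hr _ _ hg)) (by norm_num)
  have hH : Homog ((1, rename some t * (X none - rename some g)) :: (1, monicQuad β α) ::
      mapL (rename some) l) := homog_cons.2 ⟨h1, homog_cons.2 ⟨deg_monicQuad hβ hα, hm⟩⟩
  -- Any entry can be made the innermost cone.
  have hp : ∀ {σ : Type} {Z : Cx σ} {e : ℤ × MvPolynomial σ ℚ} {l : List _}, Homog (e :: l) →
      Z.koszul (e :: l) ≃q (Z.cone e.1 e.2).koszul l := by
    intro σ Z e l he
    have := koszul_perm Z (List.perm_append_singleton _ _).symm he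
    rw [koszul_append] at this
    exact this
  have hN : Deg (t * (g * g - α * g - β)) (2 * 2 + 2) :=
    ht.mul' (((hg.mul' hg (by norm_num)).sub (hα.mul' hg (by norm_num))).sub hβ) (by norm_num)
  rw [(hp (homog_cons.2 ⟨ht, hl⟩)).hrank_eq, (hp (homog_cons.2 ⟨hN, hl⟩)).hrank_eq,
    ← hrank_koszul_prod _ _ hl,
    ← (Equiv.koszul (quadCx_cone_restrict (t := t) hβ hα hg hr).equiv hl).hrank_eq,
    ← hrank_koszul_mapL hr _ hl,
    (koszul_perm _ (List.Perm.swap _ _ _) hH).hrank_eq]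
  have h2 : Homog ((1, rename some t * (X none - rename some g)) :: mapL (rename some) l) :=
    homog_cons.2 ⟨h1, hm⟩
  have h3 := (hp (Z := base (Option σ)) (e := (1, monicQuad β α))
    (homog_cons.2 ⟨deg_monicQuad hβ hα, h2⟩)).trans
    ((Equiv.koszul (QI.cone_monicQuad hβ hα).equiv h2).trans (hp h2))
  exact h3.hrank_eq k h

end Cx
end KR


/-! ### The Koszul complex of a closed braid graph in terms of partial sums -/

namespace KR

open MvPolynomial Cx

section Labels

variable {A B : Type}

/-- The quadratic relation of a crossing in terms of partial sums of edge variables: the partial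
sum `b` between `a` and `c` changes to `r`. -/
def crossing [CommRing A] (a b c r : A) : A := (r - b) * (a + c - r - b)

/-- The labels above a braid graph with labels `p` below; each crossing carries its new label. -/
def topLabel (p : ℕ → A) : List (ℕ × A) → ℕ → A
  | [] => p
  | e :: w => topLabel (Function.update p (e.1 + 1) e.2) w

/-- The quadratic relations of all crossings. -/
def crossings [CommRing A] (p : ℕ → A) : List (ℕ × A) → List A
  | [] => []
  | e :: w => crossing (p e.1) (p (e.1 + 1)) (p (e.1 + 2)) e.2 ::
      crossings (Function.update p (e.1 + 1) e.2) w

theorem topLabel_append (p : ℕ → A) (w w' : List (ℕ × A)) :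
    topLabel p (w ++ w') = topLabel (topLabel p w) w' := by
  induction w generalizing p with
  | nil => rfl
  | cons e w ih => exact ih _

theorem crossings_append [CommRing A] (p : ℕ → A) (w w' : List (ℕ × A)) :
    crossings p (w ++ w') = crossings p w ++ crossings (topLabel p w) w' := by
  induction w generalizing p with
  | nil => rfl
  | cons e w ih => simp [crossings, topLabel, ih]

theorem map_crossing [CommRing A] [CommRing B] (φ : A →+* B) (a b c r : A) :
    φ (crossing a b c r) = crossing (φ a) (φ b) (φ c) (φ r) := by
  simp [crossing]

theorem comp_update (φ : A → B) (p : ℕ → A) (i : ℕ) (r : A) :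
    (fun s => φ (Function.update p i r s)) = Function.update (fun s => φ (p s)) i (φ r) :=
  Function.comp_update φ p i r

theorem map_topLabel [CommRing A] [CommRing B] (φ : A →+* B) (p : ℕ → A) (w : List (ℕ × A)) (s : ℕ) :
    φ (topLabel p w s) = topLabel (fun s => φ (p s)) (w.map fun e => (e.1, φ e.2)) s := by
  induction w generalizing p with
  | nil => rfl
  | cons e w ih =>
    rw [topLabel, ih, comp_update]
    rfl

theorem map_crossings [CommRing A] [CommRing B] (φ : A →+* B) (p : ℕ → A) (w : List (ℕ × A)) :
    (crossings p w).map φ = crossings (fun s => φ (p s)) (w.map fun e => (e.1, φ e.2)) := by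
  induction w generalizing p with
  | nil => rfl
  | cons e w ih =>
    rw [crossings, List.map_cons, ih, comp_update, map_crossing]
    rfl

theorem topLabel_of_forall_ne {p : ℕ → A} {w : List (ℕ × A)} {s : ℕ}
    (h : ∀ e ∈ w, e.1 + 1 ≠ s) : topLabel p w s = p s := by
  induction w generalizing p with
  | nil => rfl
  | cons e w ih =>
    rw [topLabel, ih fun e' he' => h e' (by simp [he']), Function.update_of_ne]
    exact (h e (by simp)).symm

theorem topLabel_congr {p p' : ℕ → A} {b : ℕ} (h : ∀ s ≤ b, p s = p' s) {w : List (ℕ × A)}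
    {s : ℕ} (hs : s ≤ b) : topLabel p w s = topLabel p' w s := by
  induction w generalizing p p' with
  | nil => exact h s hs
  | cons e w ih =>
    refine ih fun t ht => ?_
    simp only [Function.update_apply]
    rw [h t ht]

theorem crossings_congr [CommRing A] {p p' : ℕ → A} {b : ℕ} (h : ∀ s ≤ b, p s = p' s) {w : List (ℕ × A)}
    (hw : ∀ e ∈ w, e.1 + 1 < b) : crossings p w = crossings p' w := by
  induction w generalizing p p' with
  | nil => rfl
  | cons e w ih =>
    have := hw e (by simp)
    rw [crossings, crossings, h _ (by omega), h _ (by omega), h _ (by omega)]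
    congr 1
    refine ih (fun t ht => ?_) fun e' he' => hw e' (by simp [he'])
    simp only [Function.update_apply]
    rw [h t ht]

end Labels

variable {σ τ : Type}

/-- The quadratic entries of the Koszul complex of a braid graph. -/
def quadEntries (p : ℕ → MvPolynomial σ ℚ) (w : List (ℕ × MvPolynomial σ ℚ)) :
    List (ℤ × MvPolynomial σ ℚ) := (crossings p w).map fun f => (1, f)

/-- The linear entries that close up the strands in the list `S`. -/
def closeEntries (S : List ℕ) (p x : ℕ → MvPolynomial σ ℚ) : List (ℤ × MvPolynomial σ ℚ) :=
  S.map fun s => (0, x (s + 1) - p (s + 1))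

/-- The entries of the Koszul complex of the closure of a braid graph. -/
def entries (b : ℕ) (p : ℕ → MvPolynomial σ ℚ) (w : List (ℕ × MvPolynomial σ ℚ)) :
    List (ℤ × MvPolynomial σ ℚ) :=
  quadEntries p w ++ closeEntries (List.range b) p (topLabel p w)

theorem mapL_append (g : MvPolynomial σ ℚ →ₐ[ℚ] MvPolynomial τ ℚ)
    (l l' : List (ℤ × MvPolynomial σ ℚ)) : mapL g (l ++ l') = mapL g l ++ mapL g l' :=
  List.map_append

theorem mapL_cons (g : MvPolynomial σ ℚ →ₐ[ℚ] MvPolynomial τ ℚ) (s : ℤ) (f : MvPolynomial σ ℚ)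
    (l : List (ℤ × MvPolynomial σ ℚ)) : mapL g ((s, f) :: l) = (s, g f) :: mapL g l := rfl

theorem mapL_quadEntries (g : MvPolynomial σ ℚ →ₐ[ℚ] MvPolynomial τ ℚ)
    (p : ℕ → MvPolynomial σ ℚ) (w : List (ℕ × MvPolynomial σ ℚ)) :
    mapL g (quadEntries p w) = quadEntries (fun s => g (p s)) (w.map fun e => (e.1, g e.2)) := by
  have := map_crossings g.toRingHom p w
  simp only [quadEntries, mapL, List.map_map]
  change _ = (crossings (fun s => g.toRingHom (p s)) (w.map fun e => (e.1, g.toRingHom e.2))).map _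
  rw [← this, List.map_map]
  rfl

theorem mapL_closeEntries (g : MvPolynomial σ ℚ →ₐ[ℚ] MvPolynomial τ ℚ) (S : List ℕ)
    (p x : ℕ → MvPolynomial σ ℚ) :
    mapL g (closeEntries S p x) = closeEntries S (fun s => g (p s)) (fun s => g (x s)) := by
  simp only [closeEntries, mapL, List.map_map]
  refine List.map_congr_left fun s _ => ?_
  simp

theorem mapL_topLabel (g : MvPolynomial σ ℚ →ₐ[ℚ] MvPolynomial τ ℚ)
    (p : ℕ → MvPolynomial σ ℚ) (w : List (ℕ × MvPolynomial σ ℚ)) (s : ℕ) :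
    g (topLabel p w s) = topLabel (fun s => g (p s)) (w.map fun e => (e.1, g e.2)) s :=
  map_topLabel g.toRingHom p w s

theorem mapL_entries (g : MvPolynomial σ ℚ →ₐ[ℚ] MvPolynomial τ ℚ) (b : ℕ)
    (p : ℕ → MvPolynomial σ ℚ) (w : List (ℕ × MvPolynomial σ ℚ)) :
    mapL g (entries b p w) = entries b (fun s => g (p s)) (w.map fun e => (e.1, g e.2)) := by
  rw [entries, mapL_append, mapL_quadEntries, mapL_closeEntries, entries]
  simp only [mapL_topLabel]

theorem deg_crossing {a b c r : MvPolynomial σ ℚ} (ha : Deg a 2) (hb : Deg b 2) (hc : Deg c 2)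
    (hr : Deg r 2) : Deg (crossing a b c r) 4 :=
  Deg.mul' (hr.sub hb) (((ha.add hc).sub hr).sub hb) (by norm_num)

theorem deg_topLabel {p : ℕ → MvPolynomial σ ℚ} {w : List (ℕ × MvPolynomial σ ℚ)}
    (hp : ∀ s, Deg (p s) 2) (hw : ∀ e ∈ w, Deg e.2 2) (s : ℕ) : Deg (topLabel p w s) 2 := by
  induction w generalizing p with
  | nil => exact hp s
  | cons e w ih =>
    refine ih (fun t => ?_) fun e' he' => hw e' (by simp [he'])
    rw [Function.update_apply]
    split_ifs
    · exact hw e (by simp)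
    · exact hp t

theorem homog_quadEntries {p : ℕ → MvPolynomial σ ℚ} {w : List (ℕ × MvPolynomial σ ℚ)}
    (hp : ∀ s, Deg (p s) 2) (hw : ∀ e ∈ w, Deg e.2 2) : Homog (quadEntries p w) := by
  induction w generalizing p with
  | nil => exact homog_nil
  | cons e w ih =>
    refine homog_cons.2 ⟨deg_crossing (hp _) (hp _) (hp _) (hw e (by simp)),
      ih (fun t => ?_) fun e' he' => hw e' (by simp [he'])⟩
    rw [Function.update_apply]
    split_ifs
    · exact hw e (by simp)
    · exact hp t

theorem homog_closeEntries {p x : ℕ → MvPolynomial σ ℚ} (hp : ∀ s, Deg (p s) 2)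
    (hx : ∀ s, Deg (x s) 2) (S : List ℕ) : Homog (closeEntries S p x) := by
  intro e he
  obtain ⟨s, -, rfl⟩ := List.mem_map.1 he
  exact (hx _).sub (hp _)

theorem homog_entries {p : ℕ → MvPolynomial σ ℚ} {w : List (ℕ × MvPolynomial σ ℚ)} (b : ℕ)
    (hp : ∀ s, Deg (p s) 2) (hw : ∀ e ∈ w, Deg e.2 2) : Homog (entries b p w) :=
  homog_append.2 ⟨homog_quadEntries hp hw, homog_closeEntries hp (deg_topLabel hp hw) _⟩

/-- The labels of the bottom edges: the partial sums are variables. -/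
def bottom (zs : List σ) : ℕ → MvPolynomial σ ℚ
  | 0 => 0
  | s + 1 => (zs[s]?).elim 0 X

theorem deg_bottom (zs : List σ) (s : ℕ) : Deg (bottom zs s) 2 := by
  cases s with
  | zero => exact isWeightedHomogeneous_zero _ _ _
  | succ s =>
    rw [bottom]
    cases zs[s]? with
    | none => exact isWeightedHomogeneous_zero _ _ _
    | some i => exact deg_X i

theorem rename_bottom (f : σ → τ) (zs : List σ) (s : ℕ) :
    rename f (bottom zs s) = bottom (zs.map f) s := by
  cases s with
  | zero => exact map_zero _
  | succ s =>
    rw [bottom, bottom, List.getElem?_map]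
    cases zs[s]? with
    | none => exact map_zero _
    | some i => exact rename_X _ _

theorem bottom_set {zs : List σ} {i : ℕ} (hi : i < zs.length) (a : σ) :
    bottom (zs.set i a) = Function.update (bottom zs) (i + 1) (X a) := by
  funext s
  cases s with
  | zero => rfl
  | succ s =>
    rw [bottom, List.getElem?_set, Function.update_apply]
    by_cases h : i = s
    · subst h
      simp [hi]
    · rw [if_neg h, if_neg (by omega), bottom]

/-- Turn the variables of the crossings into polynomials. -/
def polyWord (wy : List (ℕ × σ)) : List (ℕ × MvPolynomial σ ℚ) := wy.map fun e => (e.1, X e.2)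

theorem deg_polyWord (wy : List (ℕ × σ)) : ∀ e ∈ polyWord wy, Deg e.2 2 := by
  intro e he
  obtain ⟨e', -, rfl⟩ := List.mem_map.1 he
  exact deg_X _

theorem rename_polyWord (f : σ → τ) (wy : List (ℕ × σ)) :
    (polyWord wy).map (fun e => (e.1, rename f e.2)) =
      polyWord (wy.map fun e => (e.1, f e.2)) := by
  simp [polyWord]

/-- The entries that belong to a naming of the variables. -/
abbrev presEntries (zs : List σ) (wy : List (ℕ × σ)) : List (ℤ × MvPolynomial σ ℚ) :=
  entries zs.length (bottom zs) (polyWord wy)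

theorem homog_presEntries (zs : List σ) (wy : List (ℕ × σ)) : Homog (presEntries zs wy) :=
  homog_entries _ (deg_bottom zs) (deg_polyWord wy)

/-- The variables of the bottom edges and of the crossings of a braid graph with the given columns
are named bijectively by `σ`. -/
structure Pres (b : ℕ) (w : List ℕ) (zs : List σ) (wy : List (ℕ × σ)) : Prop where
  length : zs.length = b
  word : wy.map Prod.fst = w
  nodup : (zs ++ wy.map Prod.snd).Nodup
  complete : ∀ i, i ∈ zs ++ wy.map Prod.snd

theorem mapL_presEntries (f : σ → τ) (zs : List σ) (wy : List (ℕ × σ)) :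
    mapL (rename f) (presEntries zs wy) =
      presEntries (zs.map f) (wy.map fun e => (e.1, f e.2)) := by
  simp only [presEntries, mapL_entries, rename_bottom, rename_polyWord, List.length_map]

theorem list_eq_of_map_fst_snd {α β : Type} {l l' : List (α × β)}
    (h1 : l.map Prod.fst = l'.map Prod.fst) (h2 : l.map Prod.snd = l'.map Prod.snd) : l = l' := by
  induction l generalizing l' with
  | nil => exact (List.map_eq_nil_iff.1 h1.symm).symm
  | cons e l ih =>
    cases l' with
    | nil => simp at h1
    | cons e' l' =>
      rw [List.map_cons, List.map_cons, List.cons.injEq] at h1 h2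
      rw [ih h1.2 h2.2, Prod.ext h1.1 h2.1]

/-- Each naming lists all variables once, in a fixed order; matching the two lists position by
position is a renaming of variables that carries one Koszul complex to the other. Hence any
convenient variable type may be used. -/
theorem Pres.hrank_eq {b : ℕ} {w : List ℕ} {zs : List σ} {wy : List (ℕ × σ)} {zs' : List τ}
    {wy' : List (ℕ × τ)} (h : Pres b w zs wy) (h' : Pres b w zs' wy') (k m : ℤ) :
    ((base σ).koszul (presEntries zs wy)).hrank k m =
      ((base τ).koszul (presEntries zs' wy')).hrank k m := by
  classical
  have hlen : (zs ++ wy.map Prod.snd).length = (zs' ++ wy'.map Prod.snd).length := by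
    have := congrArg List.length (h.word.trans h'.word.symm)
    simp only [List.length_map] at this
    simp [h.length, h'.length, this]
  let e1 := List.Nodup.getEquivOfForallMemList _ h.nodup h.complete
  let e2 := List.Nodup.getEquivOfForallMemList _ h'.nodup h'.complete
  let e : σ ≃ τ := (e1.symm.trans (finCongr hlen)).trans e2
  have he : (zs ++ wy.map Prod.snd).map e = zs' ++ wy'.map Prod.snd := by
    refine List.ext_getElem (by simpa using hlen) fun n h1 h2 => ?_
    rw [List.getElem_map]
    have h3 : n < (zs ++ wy.map Prod.snd).length := by simpa using h1
    have h4 : e1.symm (zs ++ wy.map Prod.snd)[n] = ⟨n, h3⟩ := by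
      rw [Equiv.symm_apply_eq]
      rfl
    change e2 (finCongr hlen (e1.symm _)) = _
    rw [h4]
    rfl
  rw [List.map_append] at he
  obtain ⟨hz, hw⟩ := List.append_inj he (by simp [h.length, h'.length])
  have hw' : wy.map (fun x => (x.1, e x.2)) = wy' := by
    refine list_eq_of_map_fst_snd ?_ ?_
    · rw [h'.word, ← h.word, List.map_map]
      rfl
    · rw [← hw, List.map_map, List.map_map]
      rfl
  rw [← hrank_koszul_rename e (homog_presEntries zs wy), mapL_presEntries, hz, hw']

theorem Pres.exists_fin (b : ℕ) (w : List ℕ) :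
    Pres b w ((List.finRange b).map (Sum.inl : Fin b → Fin b ⊕ Fin w.length))
      ((List.finRange w.length).map fun t => (w[t], Sum.inr t)) := by
  refine ⟨by simp, ?_, ?_, ?_⟩
  · rw [List.map_map]
    exact List.ext_getElem (by simp) (by simp)
  · rw [List.map_map]
    refine List.Nodup.append ((List.nodup_finRange b).map Sum.inl_injective)
      ((List.nodup_finRange _).map Sum.inr_injective) ?_
    intro x hx hx'
    obtain ⟨s, -, rfl⟩ := List.mem_map.1 hx
    obtain ⟨t, -, ht⟩ := List.mem_map.1 hx'
    cases ht
  · rintro (s | t) <;> simp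

/-- The dimensions of the Koszul homology of the closure of the braid graph with the given
columns. -/
def hh (b : ℕ) (w : List ℕ) (k h : ℤ) : Cardinal :=
  ((base _).koszul (presEntries ((List.finRange b).map (Sum.inl : Fin b → Fin b ⊕ Fin w.length))
      ((List.finRange w.length).map fun t => (w[t], Sum.inr t)))).hrank k h

theorem Pres.hrank {b : ℕ} {w : List ℕ} {zs : List σ} {wy : List (ℕ × σ)} (h : Pres b w zs wy)
    (k m : ℤ) : ((base σ).koszul (presEntries zs wy)).hrank k m = hh b w k m :=
  h.hrank_eq (Pres.exists_fin b w) k m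

theorem Pres.of_perm {b b' : ℕ} {w w' : List ℕ} {zs : List σ} {wy : List (ℕ × σ)}
    (h : Pres b w zs wy) {zs' : List (Option σ)} {wy' : List (ℕ × Option σ)}
    (hz : zs'.length = b') (hw : wy'.map Prod.fst = w')
    (hp : (none :: (zs ++ wy.map Prod.snd).map some).Perm (zs' ++ wy'.map Prod.snd)) :
    Pres b' w' zs' wy' := by
  refine ⟨hz, hw, ?_, ?_⟩
  · rw [← hp.nodup_iff]
    refine List.nodup_cons.2 ⟨by simp, h.nodup.map (Option.some_injective _)⟩
  · intro i
    rw [← hp.mem_iff]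
    cases i with
    | none => simp
    | some i => exact List.mem_cons_of_mem _ (List.mem_map_of_mem (h.complete i))

/-- Name the variables of a braid graph with one more strand. -/
theorem Pres.add_strand {b : ℕ} {w : List ℕ} {zs : List σ} {wy : List (ℕ × σ)}
    (h : Pres b w zs wy) :
    Pres (b + 1) w (zs.map some ++ [none]) (wy.map fun e => (e.1, some e.2)) := by
  refine h.of_perm (by simp [h.length]) (by rw [← h.word, List.map_map]; rfl) ?_
  rw [List.map_append, List.map_map, List.map_map, List.append_assoc]
  exact (List.perm_middle).symm

/-- Name the variables of a braid graph with one more crossing at the end. -/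
theorem Pres.snoc {b : ℕ} {w : List ℕ} {zs : List σ} {wy : List (ℕ × σ)}
    (h : Pres b w zs wy) (i : ℕ) :
    Pres b (w ++ [i]) (zs.map some) ((wy.map fun e => (e.1, some e.2)) ++ [(i, none)]) := by
  refine h.of_perm (by simp [h.length]) (by rw [← h.word]; simp [Function.comp_def]) ?_
  rw [List.map_append, List.map_append, List.map_map, List.map_map, ← List.append_assoc]
  exact (List.perm_append_singleton _ _).symm

/-- Name the variables of a braid graph with one more crossing at the beginning. -/
theorem Pres.cons {b : ℕ} {w : List ℕ} {zs : List σ} {wy : List (ℕ × σ)}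
    (h : Pres b w zs wy) {i : ℕ} (hi : i < zs.length) :
    Pres b (i :: w) ((zs.map some).set i none)
      ((i, some zs[i]) :: wy.map fun e => (e.1, some e.2)) := by
  refine h.of_perm (by simp [h.length]) (by rw [← h.word]; simp [Function.comp_def]) ?_
  have hi' : i < (zs.map some).length := by simpa using hi
  rw [List.map_append, List.map_cons, List.map_map, List.map_map, List.set_eq_take_append_cons_drop,
    if_pos hi']
  have h1 : zs.map some = (zs.map some).take i ++ some zs[i] :: (zs.map some).drop (i + 1) := by
    conv_lhs => rw [← List.take_append_drop i (zs.map some), List.drop_eq_getElem_cons hi',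
      List.getElem_map]
  generalize ht : (zs.map some).take i = T at h1 ⊢
  generalize hd : (zs.map some).drop (i + 1) = D at h1 ⊢
  rw [h1]
  generalize some zs[i] = a
  change (none :: (T ++ a :: D ++ wy.map (some ∘ Prod.snd))).Perm
    (T ++ none :: D ++ a :: wy.map (some ∘ Prod.snd))
  simp only [List.append_assoc, List.cons_append]
  refine (List.Perm.trans ?_ (List.perm_middle).symm)
  refine List.Perm.cons _ (List.Perm.append_left _ ?_)
  exact (List.perm_middle (l₁ := D)).symm

end KR


/-! ### Isotopy, relation II, and the algebra of relation III -/

namespace KR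

open MvPolynomial Cx

variable {σ τ : Type}

theorem Pres.exists (b : ℕ) (w : List ℕ) :
    ∃ (σ : Type) (zs : List σ) (wy : List (ℕ × σ)), Pres b w zs wy :=
  ⟨_, _, _, Pres.exists_fin b w⟩

theorem mapL_substNone_rename (c : MvPolynomial σ ℚ) (l : List (ℤ × MvPolynomial σ ℚ)) :
    mapL (substNone c) (mapL (rename some) l) = l := by
  simp only [mapL, List.map_map]
  conv_rhs => rw [← List.map_id l]
  refine List.map_congr_left fun e _ => ?_
  simp only [Function.comp_apply, substNone_rename, id_def]

theorem map_crossing' (g : MvPolynomial σ ℚ →ₐ[ℚ] MvPolynomial τ ℚ) (a b c r : MvPolynomial σ ℚ) :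
    g (crossing a b c r) = crossing (g a) (g b) (g c) (g r) := map_crossing g.toRingHom a b c r

theorem closeEntries_congr {S : List ℕ} {p p' x x' : ℕ → MvPolynomial σ ℚ}
    (hp : ∀ s ∈ S, p (s + 1) = p' (s + 1)) (hx : ∀ s ∈ S, x (s + 1) = x' (s + 1)) :
    closeEntries S p x = closeEntries S p' x' :=
  List.map_congr_left fun s hs => by rw [hp s hs, hx s hs]

theorem closeEntries_perm {S T : List ℕ} (h : S.Perm T) (p x : ℕ → MvPolynomial σ ℚ) :
    (closeEntries S p x).Perm (closeEntries T p x) := h.map _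

theorem closeEntries_update_top {S : List ℕ} (hS : S.Nodup) {i : ℕ} (hi : i ∈ S)
    (p x : ℕ → MvPolynomial σ ℚ) (y : MvPolynomial σ ℚ) :
    (closeEntries S p (Function.update x (i + 1) y)).Perm
      ((0, y - p (i + 1)) :: closeEntries (S.erase i) p x) := by
  refine (closeEntries_perm (List.perm_cons_erase hi) _ _).trans (List.Perm.of_eq ?_)
  rw [closeEntries, List.map_cons, Function.update_self]
  congr 1
  refine closeEntries_congr (fun _ _ => rfl) fun s hs => ?_
  rw [Function.update_of_ne]
  have := (hS.mem_erase_iff.1 hs).1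
  omega

theorem closeEntries_update_bottom {S : List ℕ} (hS : S.Nodup) {i : ℕ} (hi : i ∈ S)
    (p x : ℕ → MvPolynomial σ ℚ) (y : MvPolynomial σ ℚ) :
    (closeEntries S (Function.update p (i + 1) y) x).Perm
      ((0, x (i + 1) - y) :: closeEntries (S.erase i) p x) := by
  refine (closeEntries_perm (List.perm_cons_erase hi) _ _).trans (List.Perm.of_eq ?_)
  rw [closeEntries, List.map_cons, Function.update_self]
  congr 1
  refine closeEntries_congr (fun s hs => ?_) fun _ _ => rfl
  rw [Function.update_of_ne]
  have := (hS.mem_erase_iff.1 hs).1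
  omega

/-- The homology of a closure in terms of the entries without the last crossing. -/
theorem hh_snoc {b : ℕ} {w : List ℕ} {zs : List σ} {wy : List (ℕ × σ)} (h : Pres b w zs wy)
    {i : ℕ} (hi : i < b) {p x : ℕ → MvPolynomial σ ℚ} (hp : bottom zs = p)
    (hx : topLabel p (polyWord wy) = x) (k m : ℤ) :
    hh b (w ++ [i]) k m = ((base σ).koszul ((1, crossing (x i) (x (i + 1)) (x (i + 2)) (p (i + 1)))
      :: (quadEntries p (polyWord wy) ++
        closeEntries ((List.range b).erase i) p x))).hrank k m := by
  have hS := homog_presEntries (zs.map some) ((wy.map fun e => (e.1, some e.2)) ++ [(i, none)])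
  rw [← (h.snoc i).hrank]
  have hdp : ∀ s, Deg (p s) 2 := hp ▸ deg_bottom zs
  have hdx : ∀ s, Deg (x s) 2 := hx ▸ deg_topLabel hdp (deg_polyWord wy)
  have hb : bottom (zs.map some) = fun s => rename some (p s) := by
    rw [← hp]
    exact funext fun s => (rename_bottom _ _ _).symm
  have hw : polyWord ((wy.map fun e => (e.1, some e.2)) ++ [(i, none)]) =
      (polyWord wy).map (fun e => (e.1, rename some e.2)) ++ [(i, X none)] := by
    rw [rename_polyWord]
    simp [polyWord]
  have ht : topLabel (fun s => rename some (p s))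
      ((polyWord wy).map fun e => (e.1, rename some e.2)) = fun s => rename some (x s) := by
    rw [← hx]
    exact funext fun s => (mapL_topLabel _ _ _ _).symm
  -- Since nothing follows the last crossing, its new label is the top label `i + 1`. The closing
  -- entry of index `i` equates it with `p (i + 1)` and thereby eliminates it.
  have hperm : (presEntries (zs.map some) ((wy.map fun e => (e.1, some e.2)) ++ [(i, none)])).Perm
      ((0, X none - rename some (p (i + 1))) ::
        (1, crossing (rename some (x i)) (rename some (x (i + 1))) (rename some (x (i + 2))) (X none))
        :: mapL (rename some) (quadEntries p (polyWord wy) ++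
          closeEntries ((List.range b).erase i) p x)) := by
    rw [presEntries, entries, hb, hw, List.length_map, h.length, quadEntries, crossings_append,
      topLabel_append, ht, List.map_append, mapL_append, mapL_quadEntries, mapL_closeEntries]
    change ((_ ++ [(1, crossing (rename some (x i)) (rename some (x (i + 1)))
      (rename some (x (i + 2))) (X none))]) ++ closeEntries (List.range b) (fun s => rename some (p s))
      (Function.update (fun s => rename some (x s)) (i + 1) (X none))).Perm _
    refine ((closeEntries_update_top List.nodup_range (List.mem_range.2 hi) _ _ _).append_left
      _).trans ?_
    refine List.perm_middle.trans (List.Perm.cons _ ?_)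
    rw [List.append_assoc]
    exact List.perm_middle
  rw [(koszul_perm _ hperm hS).hrank_eq, hrank_koszul_elim (hdp _) (homog_cons.1 (hS.perm hperm)).2,
    mapL_cons, map_crossing', mapL_substNone_rename]
  simp only [substNone_rename, aeval_X, Option.elim_none]

/-- The homology of a closure in terms of the entries without the first crossing. -/
theorem hh_cons {b : ℕ} {w : List ℕ} {zs : List σ} {wy : List (ℕ × σ)} (h : Pres b w zs wy)
    {i : ℕ} (hi : i < b) {p x : ℕ → MvPolynomial σ ℚ} (hp : bottom zs = p)
    (hx : topLabel p (polyWord wy) = x) (k m : ℤ) :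
    hh b (i :: w) k m = ((base σ).koszul ((1, crossing (p i) (x (i + 1)) (p (i + 2)) (p (i + 1)))
      :: (quadEntries p (polyWord wy) ++
        closeEntries ((List.range b).erase i) p x))).hrank k m := by
  have hi' : i < zs.length := h.length ▸ hi
  have hS := homog_presEntries ((zs.map some).set i none)
    ((i, some zs[i]) :: wy.map fun e => (e.1, some e.2))
  rw [← (h.cons hi').hrank]
  have hdp : ∀ s, Deg (p s) 2 := hp ▸ deg_bottom zs
  have hdx : ∀ s, Deg (x s) 2 := hx ▸ deg_topLabel hdp (deg_polyWord wy)
  -- The new variable is the bottom label `i + 1`, and the old bottom variable becomes the label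
  -- that the first crossing introduces. Above that crossing all labels are therefore the old ones,
  -- and the closing entry of index `i` eliminates the new variable.
  have hb : bottom ((zs.map some).set i none) =
      Function.update (fun s => rename some (p s)) (i + 1) (X none) := by
    rw [bottom_set (by simpa using hi'), ← hp]
    congr 1
    exact funext fun s => (rename_bottom _ _ _).symm
  have hpi : rename some (p (i + 1)) = X (some zs[i]) := by
    rw [← hp, bottom, List.getElem?_eq_getElem hi']
    exact rename_X _ _
  have hw : polyWord ((i, some zs[i]) :: wy.map fun e => (e.1, some e.2)) =
      (i, rename some (p (i + 1))) :: (polyWord wy).map (fun e => (e.1, rename some e.2)) := by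
    rw [rename_polyWord, hpi]
    simp [polyWord]
  have ht : topLabel (fun s => rename some (p s))
      ((polyWord wy).map fun e => (e.1, rename some e.2)) = fun s => rename some (x s) := by
    rw [← hx]
    exact funext fun s => (mapL_topLabel _ _ _ _).symm
  have hu : Function.update (Function.update (fun s => rename some (p s)) (i + 1) (X none)) (i + 1)
      (rename some (p (i + 1))) = fun s => rename some (p s) := by
    rw [Function.update_idem]
    exact Function.update_eq_self (i + 1) fun s => rename some (p s)
  have hperm : (presEntries ((zs.map some).set i none)
      ((i, some zs[i]) :: wy.map fun e => (e.1, some e.2))).Perm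
      ((0, -(X none - rename some (x (i + 1)))) ::
        (1, crossing (rename some (p i)) (X none) (rename some (p (i + 2))) (rename some (p (i + 1))))
        :: mapL (rename some) (quadEntries p (polyWord wy) ++
          closeEntries ((List.range b).erase i) p x)) := by
    rw [presEntries, entries, hb, hw, List.length_set, List.length_map, h.length, quadEntries,
      crossings, topLabel, mapL_append, mapL_quadEntries, mapL_closeEntries]
    simp only [hu, ht]
    rw [Function.update_self, Function.update_of_ne (by omega), Function.update_of_ne (by omega),
      List.map_cons, neg_sub]
    refine ((closeEntries_update_bottom List.nodup_range (List.mem_range.2 hi) _ _ _).append_left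
      _).trans ?_
    exact List.perm_middle
  have hS' := hS.perm hperm
  rw [(koszul_perm _ hperm hS).hrank_eq]
  refine ((QI.cone_neg _ _ _).hrank_eq k m).trans ?_
  rw [neg_neg]
  refine (hrank_koszul_elim (hdx _) (homog_cons.1 hS').2 k m).trans ?_
  rw [mapL_cons, map_crossing', mapL_substNone_rename]
  simp only [substNone_rename, aeval_X, Option.elim_none]

theorem null_closeEntries {S : List ℕ} {s : ℕ} (hs : s ∈ S) {p x : ℕ → MvPolynomial σ ℚ}
    (l : List (ℤ × MvPolynomial σ ℚ)) :
    ((base σ).koszul (l ++ closeEntries S p x)).Null 0 (x (s + 1) - p (s + 1)) :=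
  Null.koszul _ (List.mem_append_right _ (List.mem_map.2 ⟨s, hs, rfl⟩))

/-- After elimination of one label the two complexes share all entries but one: the moved crossing
sees its neighbours `i` and `i + 2` at the bottom in one case and at the top in the other. The
difference is a combination of the closing entries for these two labels. -/
theorem hh_rotate_one {b : ℕ} (w : List ℕ) {i : ℕ} (hi : i + 1 < b) (k m : ℤ) :
    hh b (i :: w) k m = hh b (w ++ [i]) k m := by
  obtain ⟨σ, zs, wy, h⟩ := Pres.exists b w
  have hdp := deg_bottom zs
  have hdx := deg_topLabel hdp (deg_polyWord wy)
  have h0 : topLabel (bottom zs) (polyWord wy) 0 = bottom zs 0 :=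
    topLabel_of_forall_ne fun e _ => by omega
  rw [hh_cons h (by omega) rfl rfl, hh_snoc h (by omega) rfl rfl]
  generalize topLabel (bottom zs) (polyWord wy) = x at *
  have hq := homog_quadEntries hdp (deg_polyWord wy)
  generalize quadEntries (bottom zs) (polyWord wy) = l at *
  generalize bottom zs = p at *
  refine (QI.cone_congr ?_).hrank_eq k m
  have e : crossing (x i) (x (i + 1)) (x (i + 2)) (p (i + 1)) -
      crossing (p i) (x (i + 1)) (p (i + 2)) (p (i + 1)) =
      (p (i + 1) - x (i + 1)) * (x i - p i) + (p (i + 1) - x (i + 1)) * (x (i + 2) - p (i + 2)) := by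
    simp only [crossing]
    ring
  rw [e]
  refine Null.add ?_ ?_
  · refine Null.mul (s := 0) ?_ ((hdp _).sub (hdx _)) (by norm_num)
    -- The label `i` is closed up by the entry of index `i - 1`; for `i = 0` there is no such entry,
    -- but the label is `0` at both ends.
    cases i with
    | zero =>
      rw [h0, sub_self]
      exact Null.zero _ _
    | succ i =>
      refine null_closeEntries ?_ l
      rw [List.nodup_range.mem_erase_iff, List.mem_range]
      omega
  · refine Null.mul (s := 0) ?_ ((hdp _).sub (hdx _)) (by norm_num)
    refine null_closeEntries ?_ l
    rw [List.nodup_range.mem_erase_iff, List.mem_range]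
    omega

theorem hh_rotate {b : ℕ} (u v : List ℕ) (hu : ∀ j ∈ u, j + 1 < b) (k m : ℤ) :
    hh b (u ++ v) k m = hh b (v ++ u) k m := by
  induction u generalizing v with
  | nil => simp
  | cons i u ih =>
    rw [List.cons_append, hh_rotate_one _ (hu i (by simp)), List.append_assoc,
      ih _ fun j hj => hu j (by simp [hj]), List.append_assoc, List.singleton_append]

theorem Pres.perm {b : ℕ} {w w' : List ℕ} {zs : List σ} {wy wy' : List (ℕ × σ)}
    (h : Pres b w zs wy) (hw : wy'.map Prod.fst = w') (hp : wy.Perm wy') : Pres b w' zs wy' := by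
  have hp' := (hp.map Prod.snd).append_left zs
  exact ⟨h.length, hw, hp'.nodup_iff.1 h.nodup, fun i => hp'.mem_iff.1 (h.complete i)⟩

/-- A crossing in column `i` reads the labels `i`, `i + 1`, `i + 2` and changes the middle one. For
`i + 1 < j` neither crossing changes a label that the other reads, so only the order of the entries
is affected. -/
theorem presEntries_swap (zs : List σ) (u : List (ℕ × σ)) {i j : ℕ} (hij : i + 1 < j) (y z : σ) :
    (presEntries zs (u ++ [(i, y), (j, z)])).Perm (presEntries zs (u ++ [(j, z), (i, y)])) := by
  simp only [presEntries, entries, polyWord, quadEntries, List.map_append, crossings_append,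
    topLabel_append, List.map_cons, List.map_nil, topLabel, crossings]
  generalize topLabel (bottom zs) (u.map fun e => (e.1, X e.2)) = x
  rw [Function.update_comm (show i + 1 ≠ j + 1 by omega)]
  refine List.Perm.append_right _ (List.Perm.append_left _ ?_)
  rw [Function.update_of_ne (by omega), Function.update_of_ne (by omega),
    Function.update_of_ne (by omega), Function.update_of_ne (by omega),
    Function.update_of_ne (by omega), Function.update_of_ne (by omega)]
  exact List.Perm.swap _ _ _

theorem hh_slide_last {b : ℕ} (w : List ℕ) {i j : ℕ} (hij : i + 1 < j) (k m : ℤ) :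
    hh b (w ++ [i, j]) k m = hh b (w ++ [j, i]) k m := by
  have h := ((Pres.exists_fin b w).snoc i).snoc j
  rw [List.append_assoc, List.map_append, List.append_assoc] at h
  generalize List.map (fun e : ℕ × Option (Fin b ⊕ Fin w.length) => (e.1, some e.2))
    (List.map _ (List.map _ _)) = u at h
  have hu : (u.map Prod.fst) = w := (List.append_inj (List.map_append.symm.trans h.word) (by
    have := congrArg List.length h.word
    simp only [List.length_map, List.length_append] at this
    simpa using this)).1
  have h' := h.perm (wy' := u ++ [(j, none), (i, some none)]) (w' := w ++ [j, i])
    (by rw [List.map_append, hu]; rfl) ((List.Perm.swap _ _ _).append_left u)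
  rw [← h'.hrank]
  have h2 : hh b (w ++ [i, j]) k m = _ := (h.hrank k m).symm
  rw [h2]
  exact (koszul_perm _ (presEntries_swap _ u hij _ _) (homog_presEntries _ _)).hrank_eq k m

theorem Pres.snoc_bottom {zs : List σ} {p : ℕ → MvPolynomial σ ℚ} (hp : bottom zs = p) :
    bottom (zs.map some) = fun s => rename some (p s) := by
  rw [← hp]
  exact funext fun s => (rename_bottom _ _ _).symm

theorem Pres.snoc_polyWord (wy : List (ℕ × σ)) (i : ℕ) :
    polyWord ((wy.map fun e => (e.1, some e.2)) ++ [(i, none)]) =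
      (polyWord wy).map (fun e => (e.1, rename some e.2)) ++ [(i, X none)] := by
  rw [rename_polyWord]
  simp [polyWord]

theorem Pres.snoc_topLabel {wy : List (ℕ × σ)} {p x : ℕ → MvPolynomial σ ℚ}
    (hx : topLabel p (polyWord wy) = x) (i : ℕ) :
    topLabel (fun s => rename some (p s)) (polyWord ((wy.map fun e => (e.1, some e.2)) ++
      [(i, none)])) = Function.update (fun s => rename some (x s)) (i + 1) (X none) := by
  rw [Pres.snoc_polyWord, topLabel_append, ← hx]
  simp only [topLabel, mapL_topLabel]

theorem Pres.snoc_quadEntries {wy : List (ℕ × σ)} {p x : ℕ → MvPolynomial σ ℚ}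
    (hx : topLabel p (polyWord wy) = x) (i : ℕ) :
    quadEntries (fun s => rename some (p s)) (polyWord ((wy.map fun e => (e.1, some e.2)) ++
      [(i, none)])) = mapL (rename some) (quadEntries p (polyWord wy)) ++
        [(1, crossing (rename some (x i)) (rename some (x (i + 1))) (rename some (x (i + 2)))
          (X none))] := by
  rw [Pres.snoc_polyWord, quadEntries, crossings_append, List.map_append, mapL_quadEntries, ← hx]
  simp only [mapL_topLabel]
  rfl

/-- The homology of a closure in terms of the entries without the last two crossings. -/
theorem hh_snoc_snoc {b : ℕ} {w : List ℕ} {zs : List σ} {wy : List (ℕ × σ)} (h : Pres b w zs wy)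
    (i : ℕ) {j : ℕ} (hj : j < b) {p x : ℕ → MvPolynomial σ ℚ} (hp : bottom zs = p)
    (hx : topLabel p (polyWord wy) = x) {x' : ℕ → MvPolynomial (Option σ) ℚ}
    (hx' : Function.update (fun s => rename some (x s)) (i + 1) (X none) = x') (k m : ℤ) :
    hh b (w ++ [i] ++ [j]) k m = ((base (Option σ)).koszul
      ((1, crossing (x' j) (x' (j + 1)) (x' (j + 2)) (rename some (p (j + 1))))
        :: ((mapL (rename some) (quadEntries p (polyWord wy)) ++
        [(1, crossing (rename some (x i)) (rename some (x (i + 1))) (rename some (x (i + 2)))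
          (X none))]) ++ closeEntries ((List.range b).erase j)
            (fun s => rename some (p s)) x'))).hrank k m := by
  rw [hh_snoc (h.snoc i) hj (Pres.snoc_bottom hp) ((Pres.snoc_topLabel hx i).trans hx'),
    Pres.snoc_quadEntries hx]

theorem neg_monicQuad (a b c : MvPolynomial σ ℚ) :
    crossing (rename some a) (rename some b) (rename some c) (X none : MvPolynomial (Option σ) ℚ) =
      -monicQuad (b * b - (a + c) * b) (a + c) := by
  simp only [crossing, monicQuad, map_sub, map_mul, map_add]
  ring

theorem deg_quadConst {a b c : MvPolynomial σ ℚ} (ha : Deg a 2) (hb : Deg b 2) (hc : Deg c 2) :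
    Deg (b * b - (a + c) * b) 4 :=
  (Deg.mul' hb hb (by norm_num)).sub (Deg.mul' (ha.add hc) hb (by norm_num))

theorem closeEntries_update_of_notMem {S : List ℕ} {i : ℕ} (hi : i ∉ S)
    (p x : ℕ → MvPolynomial σ ℚ) (y : MvPolynomial σ ℚ) :
    closeEntries S p (Function.update x (i + 1) y) = closeEntries S p x :=
  closeEntries_congr (fun _ _ => rfl) fun s hs => by
    rw [Function.update_of_ne]
    rintro h
    exact hi (by rwa [← Nat.succ_injective h])

theorem range_erase_notMem (b i : ℕ) : i ∉ (List.range b).erase i :=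
  fun h => ((List.nodup_range).mem_erase_iff.1 h).1 rfl

/-- Relation II. -/
theorem hh_double {b : ℕ} (w : List ℕ) {i : ℕ} (hi : i < b) (k m : ℤ) :
    hh b (w ++ [i] ++ [i]) k m = hh b (w ++ [i]) (k + 1) m + hh b (w ++ [i]) (k - 1) m := by
  obtain ⟨σ, zs, wy, h⟩ := Pres.exists b w
  have hdp := deg_bottom zs
  have hdx := deg_topLabel hdp (deg_polyWord wy)
  have hdq := homog_quadEntries hdp (deg_polyWord wy)
  rw [hh_snoc_snoc h i hi rfl rfl rfl, hh_snoc h hi rfl rfl, hh_snoc h hi rfl rfl]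
  generalize topLabel (bottom zs) (polyWord wy) = x at *
  generalize quadEntries (bottom zs) (polyWord wy) = l at *
  generalize bottom zs = p at *
  rw [closeEntries_update_of_notMem (range_erase_notMem b i), Function.update_self,
    Function.update_of_ne (by omega), Function.update_of_ne (by omega)]
  have hl : Homog (l ++ closeEntries ((List.range b).erase i) p x) :=
    homog_append.2 ⟨hdq, homog_closeEntries hdp hdx _⟩
  have hc : Homog ((1, crossing (x i) (x (i + 1)) (x (i + 2)) (p (i + 1))) ::
      (l ++ closeEntries ((List.range b).erase i) p x)) :=
    homog_cons.2 ⟨deg_crossing (hdx _) (hdx _) (hdx _) (hdp _), hl⟩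
  rw [← hrank_koszul_monicQuad (deg_quadConst (hdx i) (hdx (i + 1)) (hdx (i + 2)))
    ((hdx i).add (hdx (i + 2))) hc, mapL_cons, mapL_append, mapL_closeEntries, map_crossing']
  have hr := graded_rename (some : σ → Option σ)
  have hml : Homog (mapL (rename some : MvPolynomial σ ℚ →ₐ[ℚ] _) l ++
      closeEntries ((List.range b).erase i) (fun s => rename some (p s))
        fun s => rename some (x s)) := by
    rw [← mapL_closeEntries, ← mapL_append]
    exact hl.mapL hr
  generalize closeEntries ((List.range b).erase i) (fun s => rename some (p s))
        (fun s => rename some (x s)) = T at *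
  generalize mapL (rename some) l = L at *
  have hd := fun s => hr _ _ (hdx s)
  have hdB := hr _ _ (hdp (i + 1))
  have hq := deg_crossing (hd i) (hd (i + 1)) (hd (i + 2)) (deg_X (none : Option σ))
  have hq' := deg_crossing (hd i) (hd (i + 1)) (hd (i + 2)) hdB
  have hq'' := deg_crossing (hd i) (deg_X (none : Option σ)) (hd (i + 2)) hdB
  have e1 := neg_monicQuad (x i) (x (i + 1)) (x (i + 2))
  generalize rename some (x i) = a at *
  generalize rename some (x (i + 1)) = e at *
  generalize rename some (x (i + 2)) = c at *
  generalize rename some (p (i + 1)) = f at *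
  have p1 : ((1, crossing a (X none) c f) :: (L ++ [(1, crossing a e c (X none))] ++ T)).Perm
      ((1, crossing a (X none) c f) :: (1, crossing a e c (X none)) :: (L ++ T)) := by
    rw [List.append_assoc]
    exact List.perm_middle.cons _
  have H1 : Homog ((1, crossing a (X none) c f) :: (1, crossing a e c (X none)) :: (L ++ T)) :=
    homog_cons.2 ⟨hq'', homog_cons.2 ⟨hq, hml⟩⟩
  -- After the replacement the middle label `X none` occurs only in `crossing a e c (X none)`, which
  -- is minus a monic quadratic in it.
  have H2 : Homog ((1, crossing a e c f) :: (1, crossing a e c (X none)) :: (L ++ T)) :=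
    homog_cons.2 ⟨hq', homog_cons.2 ⟨hq, hml⟩⟩
  rw [(koszul_perm _ p1 (H1.perm p1.symm)).hrank_eq,
    (koszul_replace (base (Option σ)) (List.Perm.refl _) (List.Perm.refl _) ?_ H1 H2).hrank_eq,
    (koszul_perm _ (List.Perm.swap _ _ _) H2).hrank_eq]
  · rw [e1]
    refine (QI.cone_neg _ _ _).hrank_eq k m |>.trans ?_
    rw [neg_neg]
    rfl
  -- `crossing a b c r` is the difference of the values of `t * (a + c - t)` at `r` and at `b`, so
  -- successive crossings in one column telescope.
  · have : crossing a e c f - crossing a (X none) c f = crossing a e c (X none) := by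
      simp only [crossing]
      ring
    rw [this]
    exact Null.koszul _ (List.mem_cons_self)

/-- This polynomial is the sum of the quadratic entries of three alternating crossings with end
labels `a, b, c, d` and `a, B, C, d`; the intermediate label cancels in the sum. -/
theorem deg_altQuad {a b c d B C : MvPolynomial σ ℚ} (ha : Deg a 2) (hb : Deg b 2)
    (hc : Deg c 2) (hd : Deg d 2) (hB : Deg B 2) (hC : Deg C 2) :
    Deg ((C - c) * (d - C - c) + B * (a + C) - B * B - b * (a + c) + b * b) 4 :=
    IsWeightedHomogeneous.add (IsWeightedHomogeneous.sub (IsWeightedHomogeneous.sub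
      (IsWeightedHomogeneous.add (Deg.mul' (hC.sub hc) ((hd.sub hC).sub hc) (by norm_num))
      (Deg.mul' hB (ha.add hC) (by norm_num))) (Deg.mul' hB hB (by norm_num)))
      (Deg.mul' hb (ha.add hc) (by norm_num))) (Deg.mul' hb hb (by norm_num))

/-- The Koszul homology of three crossings that alternate between two columns, in terms of the
labels at both ends. -/
theorem hrank_koszul_triple {a b c d B C : MvPolynomial σ ℚ} (ha : Deg a 2) (hb : Deg b 2)
    (hc : Deg c 2) (hd : Deg d 2) (hB : Deg B 2) (hC : Deg C 2)
    {T : List (ℤ × MvPolynomial σ ℚ)} (hT : Homog T) (k m : ℤ) :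
    ((base (Option σ)).koszul ((1, crossing (rename some a) (X none) (rename some C) (rename some B))
      :: (1, crossing (rename some a) (rename some b) (rename some c) (X none)) ::
      (1, crossing (X none) (rename some c) (rename some d) (rename some C)) ::
      mapL (rename some) T)).hrank k m =
    ((base σ).koszul ((0, C - c) ::
      (1, (C - c) * (d - C - c) + B * (a + C) - B * B - b * (a + c) + b * b) :: T)).hrank k m +
    ((base σ).koszul ((2, (C - c) * (c + C - d - B) * (c - d - a + B)) ::
      (1, (C - c) * (d - C - c) + B * (a + C) - B * B - b * (a + c) + b * b) :: T)).hrank k m := by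
  have hE := deg_altQuad ha hb hc hd hB hC
  have hβ : Deg (B * B - B * (a + C)) 4 :=
    (Deg.mul' hB hB (by norm_num)).sub (Deg.mul' hB (ha.add hC) (by norm_num))
  -- The quadratic entry of the third crossing is monic in the intermediate label, with roots `B`
  -- and `a + C - B`. Its value at `c + C - d` is the product of the last two factors on the left.
  have hN : (C - c) * (c + C - d - B) * (c - d - a + B) = (C - c) * ((c + C - d) * (c + C - d) -
      (a + C) * (c + C - d) - (B * B - B * (a + C))) := by ring
  rw [hN, ← hrank_koszul_monicQuad_linear hβ (ha.add hC) (hC.sub hc) ((hc.add hC).sub hd)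
    (homog_cons.2 ⟨hE, hT⟩), mapL_cons]
  have hr := graded_rename (some : σ → Option σ)
  have hX := deg_X (none : Option σ)
  have hmT : Homog (mapL (rename some : MvPolynomial σ ℚ →ₐ[ℚ] _) T) := hT.mapL hr
  have h1 := deg_crossing (hr _ _ ha) hX (hr _ _ hC) (hr _ _ hB)
  have h2 := deg_crossing (hr _ _ ha) (hr _ _ hb) (hr _ _ hc) hX
  have h3 := deg_crossing hX (hr _ _ hc) (hr _ _ hd) (hr _ _ hC)
  have h4 := hr _ _ hE
  have e1 : monicQuad (B * B - B * (a + C)) (a + C) =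
      crossing (rename some a) (X none) (rename some C) (rename some B) := by
    simp only [crossing, monicQuad, map_sub, map_mul, map_add]
    ring
  -- The crossing in the other column has the intermediate label as a neighbour, hence is linear in
  -- it, with zero at `c + C - d`.
  have e2 : rename some (C - c) * (X none - rename some (c + C - d)) =
      crossing (X none) (rename some c) (rename some d) (rename some C) := by
    simp only [crossing, map_sub, map_add]
    ring
  rw [e1, e2]
  -- The entry of the first crossing is replaced by the sum of all three entries, which no longer
  -- involves the intermediate label.
  have e3 : rename some ((C - c) * (d - C - c) + B * (a + C) - B * B - b * (a + c) + b * b) -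
      crossing (rename some a) (rename some b) (rename some c) (X none) =
      crossing (X none) (rename some c) (rename some d) (rename some C) +
      crossing (rename some a) (X none) (rename some C) (rename some B) := by
    simp only [crossing, map_sub, map_mul, map_add]
    ring
  generalize rename some ((C - c) * (d - C - c) + B * (a + C) - B * B - b * (a + c) + b * b) = E at *
  generalize crossing (X none) (rename some c) (rename some d) (rename some C) = f3 at *
  generalize crossing (rename some a) (X none) (rename some C) (rename some B) = f1 at *
  generalize crossing (rename some a) (rename some b) (rename some c) (X none) = f2 at *
  generalize mapL (rename some) T = T' at *
  refine (koszul_replace (base (Option σ)) (s := 1) (f := f2) (g := E) (r := (1, f3) :: (1, f1) :: T')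
    ?_ ?_ ?_ ?_ ?_).hrank_eq k m
  · exact (List.Perm.swap _ _ _).trans ((List.Perm.swap _ _ _).cons _)
  · exact ((List.Perm.swap _ _ _).cons _).trans (List.Perm.swap _ _ _)
  · rw [e3]
    exact Null.add (Null.koszul _ (by simp)) (Null.koszul _ (by simp))
  · exact homog_cons.2 ⟨h1, homog_cons.2 ⟨h2, homog_cons.2 ⟨h3, hmT⟩⟩⟩
  · exact homog_cons.2 ⟨h3, homog_cons.2 ⟨h1, homog_cons.2 ⟨h4, hmT⟩⟩⟩

end KR


/-! ### Relations III, O and I for the Koszul homology -/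

namespace KR

open MvPolynomial Cx

variable {σ τ : Type}

/-- The homology of a closure whose last three crossings alternate between two columns. -/
theorem hh_alternate {b : ℕ} {w : List ℕ} {zs : List σ} {wy : List (ℕ × σ)} (h : Pres b w zs wy)
    {i j : ℕ} (hi : i < b) (hj : j < b) (hij : i ≠ j) {p x : ℕ → MvPolynomial σ ℚ}
    (hp : bottom zs = p) (hx : topLabel p (polyWord wy) = x)
    {x' y : ℕ → MvPolynomial (Option σ) ℚ}
    (hx' : Function.update (fun s => rename some (x s)) (i + 1) (X none) = x')
    (hy : Function.update x' (j + 1) (rename some (p (j + 1))) = y) (k m : ℤ) :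
    hh b (w ++ [i] ++ [j] ++ [i]) k m = ((base (Option σ)).koszul
      ((1, crossing (y i) (y (i + 1)) (y (i + 2)) (rename some (p (i + 1)))) ::
        (1, crossing (rename some (x i)) (rename some (x (i + 1))) (rename some (x (i + 2)))
          (X none)) ::
        (1, crossing (x' j) (x' (j + 1)) (x' (j + 2)) (rename some (p (j + 1)))) ::
        mapL (rename some) (quadEntries p (polyWord wy) ++
          closeEntries (((List.range b).erase i).erase j) p x))).hrank k m := by
  have hdp : ∀ s, Deg (p s) 2 := hp ▸ deg_bottom zs
  have hdx : ∀ s, Deg (x s) 2 := hx ▸ deg_topLabel hdp (deg_polyWord wy)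
  have hdq := homog_quadEntries hdp (deg_polyWord wy)
  have hr := graded_rename (some : σ → Option σ)
  have hr' := graded_rename (some : Option σ → Option (Option σ))
  have hdx' : ∀ s, Deg (x' s) 2 := fun s => by
    rw [← hx', Function.update_apply]
    split_ifs
    · exact deg_X _
    · exact hr _ _ (hdx s)
  have hS : ((List.range b).erase i).Nodup := List.nodup_range.erase i
  have hjS : j ∈ (List.range b).erase i :=
    List.nodup_range.mem_erase_iff.2 ⟨hij.symm, List.mem_range.2 hj⟩
  rw [hh_snoc_snoc (h.snoc i) j hi (Pres.snoc_bottom hp) ((Pres.snoc_topLabel hx i).trans hx')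
    rfl, Pres.snoc_quadEntries hx]
  generalize quadEntries p (polyWord wy) = Q at *
  generalize hx'' : Function.update (fun s => rename some (x' s)) (j + 1) (X none) = x''
  have hdx'' : ∀ s, Deg (x'' s) 2 := fun s => by
    rw [← hx'', Function.update_apply]
    split_ifs
    · exact deg_X _
    · exact hr' _ _ (hdx' s)
  have hxx : closeEntries (((List.range b).erase i).erase j) (fun s => rename some (p s)) x' =
      mapL (rename some) (closeEntries (((List.range b).erase i).erase j) p x) := by
    rw [mapL_closeEntries, ← hx', closeEntries_update_of_notMem]
    exact fun h => range_erase_notMem b i (List.mem_of_mem_erase h)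
  -- The label of the third crossing is already eliminated. The closing entry of index `j` now
  -- equates the label of the second crossing with `p (j + 1)`, so that only the label of the first
  -- crossing remains.
  have hperm : (closeEntries ((List.range b).erase i)
      (fun s => rename some (rename some (p s))) x'').Perm
      ((0, X none - rename some (rename some (p (j + 1)))) :: mapL (rename some)
        (closeEntries (((List.range b).erase i).erase j) (fun s => rename some (p s)) x')) := by
    rw [← hx'', mapL_closeEntries]
    exact closeEntries_update_top hS hjS _ _ _
  have e : ∀ s, substNone (rename some (p (j + 1))) (x'' s) = y s := fun s => by
    rw [← hx'', ← hy, Function.update_apply, Function.update_apply]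
    split_ifs
    · simp [substNone]
    · exact substNone_rename _ _
  rw [hxx] at hperm
  have hQT : Homog (Q ++ closeEntries (((List.range b).erase i).erase j) p x) :=
    homog_append.2 ⟨hdq, homog_closeEntries hdp hdx _⟩
  generalize closeEntries (((List.range b).erase i).erase j) p x = T at *
  generalize closeEntries ((List.range b).erase i)
    (fun s => rename some (rename some (p s))) x'' = T'' at *
  have hH : Homog ((0, X none - rename some (rename some (p (j + 1)))) ::
      (1, crossing (x'' i) (x'' (i + 1)) (x'' (i + 2)) (rename some (rename some (p (i + 1))))) ::
      (1, rename some (crossing (rename some (x i)) (rename some (x (i + 1)))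
        (rename some (x (i + 2))) (X none))) ::
      (1, crossing (rename some (x' j)) (rename some (x' (j + 1))) (rename some (x' (j + 2)))
        (X none)) :: mapL (rename some) (mapL (rename some) (Q ++ T))) := by
    refine homog_cons.2 ⟨(deg_X _).sub (hr' _ _ (hr _ _ (hdp _))), homog_cons.2 ⟨?_,
      homog_cons.2 ⟨hr' _ _ ?_, homog_cons.2 ⟨?_, (hQT.mapL hr).mapL hr'⟩⟩⟩⟩
    · exact deg_crossing (hdx'' _) (hdx'' _) (hdx'' _) (hr' _ _ (hr _ _ (hdp _)))
    · exact deg_crossing (hr _ _ (hdx _)) (hr _ _ (hdx _)) (hr _ _ (hdx _)) (deg_X _)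
    · exact deg_crossing (hr' _ _ (hdx' _)) (hr' _ _ (hdx' _)) (hr' _ _ (hdx' _)) (deg_X _)
  have key : ((1, crossing (x'' i) (x'' (i + 1)) (x'' (i + 2))
        (rename some (rename some (p (i + 1))))) ::
      ((mapL (rename some) (mapL (rename some) Q ++ [(1, crossing (rename some (x i))
        (rename some (x (i + 1))) (rename some (x (i + 2))) (X none))]) ++
      [(1, crossing (rename some (x' j)) (rename some (x' (j + 1))) (rename some (x' (j + 2)))
        (X none))]) ++ T'')).Perm ((0, X none - rename some (rename some (p (j + 1)))) ::
      (1, crossing (x'' i) (x'' (i + 1)) (x'' (i + 2)) (rename some (rename some (p (i + 1))))) ::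
      (1, rename some (crossing (rename some (x i)) (rename some (x (i + 1)))
        (rename some (x (i + 2))) (X none))) ::
      (1, crossing (rename some (x' j)) (rename some (x' (j + 1))) (rename some (x' (j + 2)))
        (X none)) :: mapL (rename some) (mapL (rename some) (Q ++ T))) := by
    refine ((hperm.append_left _).cons _).trans ?_
    refine (List.perm_middle.cons _).trans ((List.Perm.swap _ _ _).trans
      (List.Perm.cons _ (List.Perm.cons _ ?_)))
    simp only [mapL_append, mapL_cons, List.append_assoc]
    refine List.perm_middle.trans (List.Perm.cons _ ?_)
    exact List.perm_middle
  rw [(koszul_perm _ key (hH.perm key.symm)).hrank_eq, hrank_koszul_elim (hr _ _ (hdp _))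
    (homog_cons.1 hH).2]
  simp only [mapL_cons, map_crossing', substNone_rename, mapL_substNone_rename, e]
  simp only [aeval_X, Option.elim_none]

theorem crossing_comm (a b c r : MvPolynomial σ ℚ) : crossing a b c r = crossing c b a r := by
  simp only [crossing]
  ring

/-- Modulo `c - C` the sum of the three quadratic entries becomes the entry of a single crossing,
and `c - C` itself is the closing entry of the label that this crossing does not touch. So this
summand is the closure with one crossing in place of three. -/
theorem hrank_koszul_replace_cross {a b c d B C : MvPolynomial σ ℚ} (ha : Deg a 2) (hb : Deg b 2)
    (hc : Deg c 2) (hd : Deg d 2) (hB : Deg B 2) (hC : Deg C 2)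
    {T L : List (ℤ × MvPolynomial σ ℚ)} (hT : Homog T) (hL : L.Perm ((0, c - C) :: T)) (k m : ℤ) :
    ((base σ).koszul ((0, C - c) ::
      (1, (C - c) * (d - C - c) + B * (a + C) - B * B - b * (a + c) + b * b) :: T)).hrank k m =
    ((base σ).koszul ((1, crossing a b c B) :: L)).hrank k m := by
  have h0 : Homog ((0, c - C) :: T) := homog_cons.2 ⟨hc.sub hC, hT⟩
  have h1 := deg_crossing ha hb hc hB
  have h2 : Deg ((C - c) * (d - C - c) + B * (a + C) - B * B - b * (a + c) + b * b) 4 :=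
    deg_altQuad ha hb hc hd hB hC
  refine ((QI.cone_neg _ _ _).hrank_eq k m).trans ?_
  rw [neg_sub]
  refine (koszul_replace (base σ) (s := 1) (g := crossing a b c B) (r := (0, c - C) :: T)
    (List.Perm.swap _ _ _) (hL.cons _) ?_ ?_ ?_).hrank_eq k m
  · have : crossing a b c B -
        ((C - c) * (d - C - c) + B * (a + C) - B * B - b * (a + c) + b * b) =
        (d - C - c + B) * (c - C) := by
      simp only [crossing]
      ring
    rw [this]
    exact (Null.koszul (s := 0) _ (List.mem_cons_self)).mul
      (IsWeightedHomogeneous.add ((hd.sub hC).sub hc) hB) (by norm_num)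
  · exact homog_cons.2 ⟨hc.sub hC, homog_cons.2 ⟨h2, hT⟩⟩
  · exact homog_cons.2 ⟨h1, h0.perm hL.symm⟩

/-- Relation III. -/
theorem hh_triple {b : ℕ} (w : List ℕ) {i : ℕ} (hi : i + 1 < b) (k m : ℤ) :
    ∃ z, hh b (w ++ [i] ++ [i + 1] ++ [i]) k m = hh b (w ++ [i]) k m + z ∧
      hh b (w ++ [i + 1] ++ [i] ++ [i + 1]) k m = hh b (w ++ [i + 1]) k m + z := by
  obtain ⟨σ, zs, wy, h⟩ := Pres.exists b w
  have hdp := deg_bottom zs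
  have hdx := deg_topLabel hdp (deg_polyWord wy)
  have hdq := homog_quadEntries hdp (deg_polyWord wy)
  rw [hh_alternate h (by omega : i < b) hi (by omega) rfl rfl rfl rfl,
    hh_alternate h hi (by omega : i < b) (by omega) rfl rfl rfl rfl,
    hh_snoc h (by omega) rfl rfl, hh_snoc h (by omega) rfl rfl,
    List.erase_comm (i + 1) i]
  generalize topLabel (bottom zs) (polyWord wy) = x at *
  generalize quadEntries (bottom zs) (polyWord wy) = Q at *
  generalize bottom zs = p at *
  have hS1 : (closeEntries ((List.range b).erase i) p x).Perm ((0, x (i + 2) - p (i + 2)) ::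
      closeEntries (((List.range b).erase i).erase (i + 1)) p x) := 
    closeEntries_perm (List.perm_cons_erase (List.nodup_range.mem_erase_iff.2
      ⟨by omega, List.mem_range.2 hi⟩)) p x
  have hS2 : (closeEntries ((List.range b).erase (i + 1)) p x).Perm ((0, x (i + 1) - p (i + 1)) ::
      closeEntries (((List.range b).erase i).erase (i + 1)) p x) := by
    rw [List.erase_comm]
    exact closeEntries_perm (List.perm_cons_erase (List.nodup_range.mem_erase_iff.2
      ⟨by omega, List.mem_range.2 (by omega)⟩)) p x
  have hT : Homog (Q ++ closeEntries (((List.range b).erase i).erase (i + 1)) p x) :=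
    homog_append.2 ⟨hdq, homog_closeEntries hdp hdx _⟩
  have p1 := hS1.append_left Q |>.trans List.perm_middle
  have p2 := hS2.append_left Q |>.trans List.perm_middle
  generalize Q ++ closeEntries ((List.range b).erase i) p x = L1 at *
  generalize Q ++ closeEntries ((List.range b).erase (i + 1)) p x = L2 at *
  generalize Q ++ closeEntries (((List.range b).erase i).erase (i + 1)) p x = T at *
  have u1 : ∀ {s t : ℕ} {f : ℕ → MvPolynomial (Option σ) ℚ} {r : MvPolynomial (Option σ) ℚ},
    s ≠ t → Function.update f t r s = f s := fun h => Function.update_of_ne h _ _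
  simp only [Function.update_self, u1 (show i ≠ i + 1 + 1 by omega), u1 (show i ≠ i + 1 by omega),
    u1 (show i + 1 ≠ i + 1 + 1 by omega), u1 (show i + 2 ≠ i + 1 by omega),
    u1 (show i + 1 + 2 ≠ i + 1 by omega),
    u1 (show i + 1 + 2 ≠ i + 1 + 1 by omega)]
  have ha := hdx i
  have hb := hdx (i + 1)
  have hc := hdx (i + 2)
  have hd := hdx (i + 1 + 2)
  have hB := hdp (i + 1)
  have hC := hdp (i + 2)
  have f1 := fun k m => hrank_koszul_triple ha hb hc hd hB hC hT k m
  -- The other order of the columns is the mirror image: it exchanges `a` with `d`, `b` with `c` and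
  -- `B` with `C`.
  have f2 := fun k m => hrank_koszul_triple hd hc hb ha hC hB hT k m
  have g1 := fun k m => hrank_koszul_replace_cross ha hb hc hd hB hC hT p1 k m
  have g2 := fun k m => hrank_koszul_replace_cross hd hc hb ha hC hB hT p2 k m
  have hE := deg_altQuad ha hb hc hd hB hC
  have hE' := deg_altQuad hd hc hb ha hC hB
  change Homog T at hT
  generalize x i = a at *
  generalize x (i + 1) = b at *
  generalize x (i + 2) = c at *
  generalize x (i + 1 + 2) = d at *
  change ∃ z, _ ∧ ((base (Option σ)).koszul ((1, crossing _ _ _ (rename some (p (i + 2)))) ::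
    (1, crossing (rename some b) (rename some c) _ _) :: _)).hrank k m =
    ((base σ).koszul ((1, crossing b c d (p (i + 2))) :: L2)).hrank k m + z
  change ∃ z, ((base (Option σ)).koszul ((1, crossing (rename some a) _ (rename some (p (i + 2))) _) ::
    _ :: (1, crossing _ (rename some c) _ (rename some (p (i + 2)))) :: _)).hrank k m = _ ∧ _
  generalize p (i + 1) = B at *
  generalize p (i + 2) = C at *
  refine ⟨_, (f1 k m).trans (congrArg₂ (· + ·) (g1 k m) rfl), ?_⟩
  rw [crossing_comm (rename some B), crossing_comm (rename some b), crossing_comm (rename some a),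
    crossing_comm b]
  refine (f2 k m).trans (congrArg₂ (· + ·) (g2 k m) ?_)
  -- The sum of the three quadratic entries is invariant under the mirror image.
  have e : (B - b) * (a - B - b) + C * (d + B) - C * C - c * (d + b) + c * c =
    (C - c) * (d - C - c) + B * (a + C) - B * B - b * (a + c) + b * b := by ring
  rw [e] at *
  refine ((QI.cone_neg _ _ _).hrank_eq k m).trans ?_
  refine (QI.cone_congr ?_).hrank_eq k m
  -- The entry of degree `6` changes its sign under the mirror image, up to a multiple of that sum,
  -- so the remainders of the two orders agree.
  have e' : (C - c) * (c + C - d - B) * (c - d - a + B) - -((B - b) * (b + B - a - C) *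
      (b - a - d + C)) = (a + d - b - c) *
      ((C - c) * (d - C - c) + B * (a + C) - B * B - b * (a + c) + b * b) := by
    ring
  rw [e']
  exact (Null.koszul (s := 1) _ (List.mem_cons_self)).mul
    (IsWeightedHomogeneous.sub (IsWeightedHomogeneous.sub (ha.add hd) hb) hc) (by norm_num)

theorem bottom_append_none {b : ℕ} {zs : List σ} (hb : zs.length = b) {s : ℕ} (hs : s ≤ b) :
    bottom (zs.map some ++ [none]) s = rename some (bottom zs s) := by
  cases s with
  | zero => exact (map_zero _).symm
  | succ s =>
    rw [rename_bottom, bottom, bottom, List.getElem?_append_left (by simpa [hb] using hs)]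

/-- The entries without the closing of the new strand. -/
theorem add_strand_entries {b : ℕ} {w : List ℕ} {zs : List σ} {wy : List (ℕ × σ)}
    (h : Pres b w zs wy) (hw : ∀ i ∈ w, i + 1 < b) :
    quadEntries (bottom (zs.map some ++ [none])) (polyWord (wy.map fun e => (e.1, some e.2))) =
        mapL (rename some) (quadEntries (bottom zs) (polyWord wy)) ∧
      (∀ s ≤ b, topLabel (bottom (zs.map some ++ [none]))
        (polyWord (wy.map fun e => (e.1, some e.2))) s =
          rename some (topLabel (bottom zs) (polyWord wy) s)) ∧
      ∀ s, b ≤ s → topLabel (bottom (zs.map some ++ [none]))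
        (polyWord (wy.map fun e => (e.1, some e.2))) s = bottom (zs.map some ++ [none]) s := by
  have hw' : ∀ e ∈ polyWord (wy.map fun e => (e.1, some e.2)), e.1 + 1 < b := by
    intro e he
    refine hw _ ?_
    rw [← h.word]
    simp only [polyWord, List.map_map, List.mem_map] at he ⊢
    obtain ⟨e', he', rfl⟩ := he
    exact ⟨e', he', rfl⟩
  have hp : ∀ s ≤ b, bottom (zs.map some ++ [none]) s = rename some (bottom zs s) :=
    fun s hs => bottom_append_none h.length hs
  refine ⟨?_, fun s hs => ?_, fun s hs => ?_⟩
  · rw [mapL_quadEntries, rename_polyWord, quadEntries, crossings_congr hp hw']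
    rfl
  · rw [topLabel_congr hp hs, mapL_topLabel, rename_polyWord]
  · exact topLabel_of_forall_ne fun e he => by
      have := hw' e he
      omega

/-- Relation O. -/
theorem hh_add_strand {b : ℕ} (w : List ℕ) (hw : ∀ i ∈ w, i + 1 < b) (k m : ℤ) :
    hh (b + 1) w k m = hh b w k m + hh b w k (m + 1) + hh (b + 1) w (k - 2) m := by
  obtain ⟨σ, zs, wy, h⟩ := Pres.exists b w
  obtain ⟨h1, h2, h3⟩ := add_strand_entries h hw
  have hl := homog_presEntries zs wy
  -- No crossing reads or changes the label of the new strand: its variable occurs in no entry, and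
  -- its closing entry is `0`.
  have e : presEntries (zs.map some ++ [none]) (wy.map fun e => (e.1, some e.2)) =
      mapL (rename some) (presEntries zs wy) ++ [(0, 0)] := by
    rw [presEntries, entries, h1, List.length_append, List.length_map, h.length, presEntries,
      entries, mapL_append, mapL_closeEntries, List.append_assoc, h.length, List.length_singleton,
      List.range_succ, closeEntries, List.map_append]
    congr 1
    congr 1
    · refine List.map_congr_left fun s hs => ?_
      have := List.mem_range.1 hs
      rw [h2 _ (by omega), bottom_append_none h.length (by omega)]
    · rw [List.map_singleton, h3 _ (by omega), sub_self]
  have hZ : ∀ k m, hh (b + 1) w k m =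
      ((base _).koszul (mapL (rename some) (presEntries zs wy))).hrank k (m + 1) +
      ((base _).koszul (mapL (rename some) (presEntries zs wy))).hrank k m := fun k m => by
    have hH := homog_presEntries (zs.map some ++ [none]) (wy.map fun e => (e.1, some e.2))
    rw [← (h.add_strand).hrank]
    rw [e] at hH ⊢
    rw [(koszul_perm _ (List.perm_append_singleton _ _) hH).hrank_eq]
    refine (hrank_cone_zero _ _ _ _).trans ?_
    rw [sub_zero, add_zero]
  rw [hZ k m, hZ (k - 2) m, hrank_koszul_polynomial hl k, hrank_koszul_polynomial hl k, h.hrank,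
    h.hrank]
  ac_rfl

/-- Relation I. -/
theorem hh_add_crossing {b : ℕ} (w : List ℕ) (hw : ∀ i ∈ w, i + 1 < b + 1) (k m : ℤ) :
    hh (b + 2) (w ++ [b]) k m =
      hh (b + 1) w (k - 1) (m + 1) + hh (b + 1) w (k + 1) m + hh (b + 2) (w ++ [b]) (k - 2) m := by
  obtain ⟨σ, zs, wy, h⟩ := Pres.exists (b + 1) w
  obtain ⟨h1, h2, h3⟩ := add_strand_entries h hw
  have hl := homog_presEntries zs wy
  -- The label `b + 1` is the total sum of the edge variables on `b + 1` strands, which no crossing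
  -- of `w` changes.
  have hx : topLabel (bottom zs) (polyWord wy) (b + 1) = bottom zs (b + 1) := by
    refine topLabel_of_forall_ne fun e he => ?_
    have : e.1 ∈ w := by
      rw [← h.word]
      simp only [polyWord, List.mem_map] at he ⊢
      obtain ⟨e', he', rfl⟩ := he
      exact ⟨e', he', rfl⟩
    have := hw _ this
    omega
  have er : (List.range (b + 2)).erase b = List.range b ++ [b + 1] := by
    rw [List.range_succ, List.range_succ, List.append_assoc, List.erase_append_right _ (by simp)]
    simp
  have hZ : ∀ k m, hh (b + 2) (w ++ [b]) k m =
      ((base _).koszul (mapL (rename some) (presEntries zs wy))).hrank (k - 1) (m + 1) +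
      ((base _).koszul (mapL (rename some) (presEntries zs wy))).hrank (k + 1) m := fun k m => by
    rw [hh_snoc h.add_strand (by omega) rfl rfl, h1, h3 (b + 1) le_rfl, er]
    -- The last crossing finds the label `b + 1` still at its bottom value and closes up to that
    -- value again, so its quadratic entry vanishes.
    have e : crossing (topLabel (bottom (zs.map some ++ [none]))
        (polyWord (wy.map fun e => (e.1, some e.2))) b) (bottom (zs.map some ++ [none]) (b + 1))
        (topLabel (bottom (zs.map some ++ [none])) (polyWord (wy.map fun e => (e.1, some e.2)))
          (b + 2)) (bottom (zs.map some ++ [none]) (b + 1)) = 0 := by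
      simp [crossing]
    -- The closing entry of index `b` was used to eliminate a label. The one of index `b + 1` is
    -- zero and takes the place of the closing entry of index `b` for `w` alone, which is zero as
    -- well.
    have e' : mapL (rename some) (quadEntries (bottom zs) (polyWord wy)) ++ closeEntries
        (List.range b ++ [b + 1]) (bottom (zs.map some ++ [none])) (topLabel
        (bottom (zs.map some ++ [none])) (polyWord (wy.map fun e => (e.1, some e.2)))) =
        mapL (rename some) (presEntries zs wy) := by
      rw [presEntries, entries, mapL_append, mapL_closeEntries, h.length, List.range_succ]
      congr 1
      simp only [closeEntries, List.map_append, List.map_singleton]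
      congr 1
      · refine List.map_congr_left fun s hs => ?_
        have := List.mem_range.1 hs
        rw [h2 _ (by omega), bottom_append_none h.length (by omega)]
      · rw [h3 _ (by omega), hx, sub_self, sub_self]
    rw [e, e']
    exact hrank_cone_zero _ _ _ _
  rw [hZ k m, hZ (k - 2) m, hrank_koszul_polynomial hl (k - 1), hrank_koszul_polynomial hl (k + 1),
    h.hrank, h.hrank, show k - 2 - 1 = k - 1 - 2 by ring, show k - 2 + 1 = k + 1 - 2 by ring]
  ac_rfl

end KR


/-! ### The Koszul complex with a basis labelled by finite sets -/

namespace KR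

open MvPolynomial

section FinsetFin

variable {n : ℕ}

/-- Remove `0` from a set of numbers and lower the others by one. -/
def finsetPred (S : Finset (Fin (n + 1))) : Finset (Fin n) := Finset.univ.filter fun i => i.succ ∈ S

theorem finsetPred_map (S : Finset (Fin n)) : finsetPred (S.map (Fin.succEmb n)) = S := by
  ext i
  simp [finsetPred]

theorem finsetPred_insert (S : Finset (Fin n)) :
    finsetPred (insert 0 (S.map (Fin.succEmb n))) = S := by
  ext i
  simp [finsetPred, Fin.succ_ne_zero]

theorem zero_notMem_map_succ (S : Finset (Fin n)) : 0 ∉ S.map (Fin.succEmb n) := by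
  simp [Fin.succ_ne_zero]

theorem map_finsetPred {S : Finset (Fin (n + 1))} (h : 0 ∉ S) :
    (finsetPred S).map (Fin.succEmb n) = S := by
  ext i
  induction i using Fin.cases with
  | zero => simp [h, Fin.succ_ne_zero]
  | succ i => simp [finsetPred]

theorem insert_map_finsetPred {S : Finset (Fin (n + 1))} (h : 0 ∈ S) :
    insert 0 ((finsetPred S).map (Fin.succEmb n)) = S := by
  ext i
  induction i using Fin.cases with
  | zero => simp [h]
  | succ i => simp [finsetPred, Fin.succ_ne_zero]

end FinsetFin

namespace Cx

variable {σ : Type}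

/-- The Koszul complex with coefficients in a complex without differential, with a basis labelled by
finite sets. -/
def cube (X : Cx σ) (s : ℤ) (n : ℕ) (Q : Fin n → MvPolynomial σ ℚ) : Cx σ where
  V := Finset (Fin n) → X.V
  d := LinearMap.pi fun S => ∑ c ∈ S,
    ((-1 : MvPolynomial σ ℚ) ^ (S.filter (· < c)).card * Q c) •
      LinearMap.proj (R := MvPolynomial σ ℚ) (φ := fun _ : Finset (Fin n) => X.V) (S.erase c)
  part k h := Submodule.pi Set.univ fun S => X.part (k + s * (2 * S.card - n)) (h + n - S.card)
  smul_mem {f e k h v} hf hv := by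
    intro S hS
    have := X.smul_mem hf (hv S hS)
    rwa [show k + s * (2 * (S.card : ℤ) - n) + e = k + e + s * (2 * S.card - n) by ring] at this

theorem cube_d_apply (X : Cx σ) (s : ℤ) {n : ℕ} (Q : Fin n → MvPolynomial σ ℚ)
    (x : Finset (Fin n) → X.V) (S : Finset (Fin n)) :
    ((X.cube s n Q).d x : Finset (Fin n) → X.V) S = ∑ c ∈ S,
      ((-1 : MvPolynomial σ ℚ) ^ (S.filter (· < c)).card * Q c) • x (S.erase c) := by
  change (∑ c ∈ S, ((-1 : MvPolynomial σ ℚ) ^ (S.filter (· < c)).card * Q c) •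
      LinearMap.proj (R := MvPolynomial σ ℚ) (φ := fun _ : Finset (Fin n) => X.V) (S.erase c)) x = _
  rw [LinearMap.sum_apply]
  rfl

theorem mem_cube_part (X : Cx σ) (s : ℤ) {n : ℕ} (Q : Fin n → MvPolynomial σ ℚ) {k h : ℤ}
    {x : Finset (Fin n) → X.V} : x ∈ (X.cube s n Q).part k h ↔
      ∀ S : Finset (Fin n), x S ∈ X.part (k + s * (2 * S.card - n)) (h + n - S.card) :=
  ⟨fun hx S => hx S (Set.mem_univ S), fun hx S _ => hx S⟩

/-- Separate the basis elements according to the first factor. -/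
def cubeSplit (X : Cx σ) (n : ℕ) : (Finset (Fin (n + 1)) → X.V) ≃ₗ[MvPolynomial σ ℚ]
    ((Finset (Fin n) → X.V) × (Finset (Fin n) → X.V)) where
  toFun x := (fun S => x (S.map (Fin.succEmb n)), fun S => x (insert 0 (S.map (Fin.succEmb n))))
  invFun y S := if 0 ∈ S then y.2 (finsetPred S) else y.1 (finsetPred S)
  map_add' _ _ := rfl
  map_smul' _ _ := rfl
  left_inv x := by
    funext S
    by_cases h : 0 ∈ S
    · simp only [h, if_true, insert_map_finsetPred h]
    · simp only [h, if_false, map_finsetPred h]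
  right_inv y := by
    refine Prod.ext (funext fun S => ?_) (funext fun S => ?_)
    · simp only [zero_notMem_map_succ, if_false, finsetPred_map]
    · simp only [Finset.mem_insert_self, if_true, finsetPred_insert]

/-- Sets without `0` form the first copy and sets with `0` the second copy in the cone on `Q 0`. In
the latter, `0` precedes every other element, which raises the sign exponents by one and gives the
minus sign of the cone. -/
theorem QI.cube_succ (X : Cx σ) (s : ℤ) {n : ℕ} (Q : Fin (n + 1) → MvPolynomial σ ℚ) :
    QI (X.cube s (n + 1) Q) ((X.cube s n fun c => Q c.succ).cone s (Q 0)) := by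
  refine QI.of_equiv (cubeSplit X n) ?_ ?_
  · intro (x : Finset (Fin (n + 1)) → X.V)
    have hf : ∀ (S : Finset (Fin n)) (c : Fin n), ((S.map (Fin.succEmb n)).filter
        (· < c.succ)).card = (S.filter (· < c)).card := by
      intro S c
      rw [Finset.filter_map, Finset.card_map]
      congr 1
      ext i
      rw [Finset.mem_filter, Finset.mem_filter]
      exact and_congr_right fun _ => Fin.succ_lt_succ_iff
    have hS : ∀ S : Finset (Fin n), ((X.cube s (n + 1) Q).d x : Finset (Fin (n + 1)) → X.V)
        (S.map (Fin.succEmb n)) = ∑ c ∈ S, ((-1 : MvPolynomial σ ℚ) ^ (S.filter (· < c)).card *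
          Q c.succ) • x ((S.erase c).map (Fin.succEmb n)) := by
      intro S
      rw [cube_d_apply, Finset.sum_map]
      refine Finset.sum_congr rfl fun c _ => ?_
      rw [Fin.coe_succEmb, hf, Finset.map_erase]
      rfl
    have hS' : ∀ S : Finset (Fin n), ((X.cube s (n + 1) Q).d x : Finset (Fin (n + 1)) → X.V)
        (insert 0 (S.map (Fin.succEmb n))) = Q 0 • x (S.map (Fin.succEmb n)) -
          ∑ c ∈ S, ((-1 : MvPolynomial σ ℚ) ^ (S.filter (· < c)).card *
          Q c.succ) • x (insert 0 ((S.erase c).map (Fin.succEmb n))) := by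
      intro S
      rw [cube_d_apply, Finset.sum_insert (zero_notMem_map_succ S), Finset.sum_map, sub_eq_add_neg,
        ← Finset.sum_neg_distrib]
      congr 1
      · rw [Finset.erase_insert (zero_notMem_map_succ S), Finset.filter_eq_empty_iff.2
          fun i _ => Fin.not_lt_zero i]
        simp
      · refine Finset.sum_congr rfl fun c _ => ?_
        rw [Fin.coe_succEmb, Finset.filter_insert, if_pos (Fin.succ_pos c),
          Finset.card_insert_of_notMem (by simp [Fin.succ_ne_zero]), hf, pow_succ,
          Finset.erase_insert_of_ne (Fin.succ_ne_zero c).symm, Finset.map_erase, Fin.coe_succEmb,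
          mul_neg_one, neg_mul, neg_smul]
    have h1 : ∀ S : Finset (Fin n), ((X.cube s n fun c => Q c.succ).d
        (fun S => x (S.map (Fin.succEmb n))) : Finset (Fin n) → X.V) S = _ := fun S =>
      cube_d_apply _ _ _ _ _
    have h2 : ∀ S : Finset (Fin n), ((X.cube s n fun c => Q c.succ).d
        (fun S => x (insert 0 (S.map (Fin.succEmb n)))) : Finset (Fin n) → X.V) S = _ := fun S =>
      cube_d_apply _ _ _ _ _
    refine Prod.ext (funext fun S => ?_) (funext fun S => ?_)
    · exact (hS S).trans (h1 S).symm
    · refine (hS' S).trans ?_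
      rw [← h2 S]
      rfl
  · intro k h (x : Finset (Fin (n + 1)) → X.V)
    refine Iff.trans ?_ (mem_cube_part X s Q).symm
    refine (and_congr (mem_cube_part X s _) (mem_cube_part X s _)).trans ?_
    have e1 : ∀ S : Finset (Fin n), X.part (k - s + s * (2 * S.card - n)) (h + 1 + n - S.card) =
        X.part (k + s * (2 * (S.map (Fin.succEmb n)).card - (n + 1 : ℕ)))
          (h + (n + 1 : ℕ) - (S.map (Fin.succEmb n)).card) := by
      intro S
      rw [Finset.card_map]
      push_cast
      congr 1 <;> ring
    have e2 : ∀ S : Finset (Fin n), X.part (k + s + s * (2 * S.card - n)) (h + n - S.card) =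
        X.part (k + s * (2 * (insert 0 (S.map (Fin.succEmb n))).card - (n + 1 : ℕ)))
          (h + (n + 1 : ℕ) - (insert 0 (S.map (Fin.succEmb n))).card) := by
      intro S
      rw [Finset.card_insert_of_notMem (zero_notMem_map_succ S), Finset.card_map]
      push_cast
      congr 1 <;> ring
    constructor
    · rintro ⟨h1, h2⟩ S
      by_cases h0 : 0 ∈ S
      · have := h2 (finsetPred S)
        rw [e2, insert_map_finsetPred h0] at this
        change x (insert 0 ((finsetPred S).map (Fin.succEmb n))) ∈ _ at this
        rwa [insert_map_finsetPred h0] at this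
      · have := h1 (finsetPred S)
        rw [e1, map_finsetPred h0] at this
        change x ((finsetPred S).map (Fin.succEmb n)) ∈ _ at this
        rwa [map_finsetPred h0] at this
    · refine fun hx => ⟨fun S => ?_, fun S => ?_⟩
      · rw [e1]
        exact hx _
      · rw [e2]
        exact hx _

theorem QI.cube_zero (X : Cx σ) (hX : ∀ x, X.d x = 0) (s : ℤ) (Q : Fin 0 → MvPolynomial σ ℚ) :
    QI (X.cube s 0 Q) X := by
  let φ : (Finset (Fin 0) → X.V) ≃ₗ[MvPolynomial σ ℚ] X.V :=
    LinearEquiv.funUnique (Finset (Fin 0)) (MvPolynomial σ ℚ) X.V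
  have hu : ∀ S : Finset (Fin 0), S = ∅ := fun S => Subsingleton.elim _ _
  refine QI.of_equiv φ ?_ ?_
  · intro (x : Finset (Fin 0) → X.V)
    rw [hX]
    change ((X.cube s 0 Q).d x : Finset (Fin 0) → X.V) default = 0
    rw [cube_d_apply, hu default, Finset.sum_empty]
  · intro k h (x : Finset (Fin 0) → X.V)
    refine Iff.trans ?_ (mem_cube_part X s Q).symm
    change x default ∈ X.part k h ↔ _
    constructor
    · intro hx S
      rw [Subsingleton.elim default S] at hx
      rw [hu S] at hx ⊢
      simpa using hx
    · intro hx
      have := hx default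
      rw [hu default] at this ⊢
      simpa using this

theorem cube_equiv_koszul (X : Cx σ) (hX : ∀ x, X.d x = 0) {s : ℤ} {n : ℕ}
    {Q : Fin n → MvPolynomial σ ℚ} (hQ : ∀ c, Deg (Q c) (2 * s + 2)) :
    X.cube s n Q ≃q X.koszul (List.ofFn fun c => (s, Q c)) := by
  induction n with
  | zero =>
    rw [List.ofFn_zero]
    exact (QI.cube_zero X hX s Q).equiv
  | succ n ih =>
    rw [List.ofFn_succ]
    exact (QI.cube_succ X s Q).equiv.trans ((ih fun c => hQ c.succ).cone (hQ 0))

end Cx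

end KR


/-! ### Closing up: elimination of the bottom labels -/

namespace KR

open MvPolynomial Cx

variable {σ τ : Type}

namespace Cx

/-- Eliminate several variables at once. -/
theorem hrank_koszul_elim_many {S : List σ} (hS : S.Nodup) {f : σ → τ} {c : σ → σ}
    (hc : ∀ y ∈ S, c y ∉ S) (hfc : ∀ y ∈ S, f (c y) = f y) (hf : ∀ t, ∃ y ∉ S, f y = t)
    (hinj : ∀ y ∉ S, ∀ z ∉ S, f y = f z → y = z) {l : List (ℤ × MvPolynomial σ ℚ)} (hl : Homog l)
    (k h : ℤ) :
    ((base σ).koszul (S.map (fun y => ((0 : ℤ), X (c y) - X y)) ++ l)).hrank k h =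
      ((base τ).koszul (mapL (rename f) l)).hrank k h := by
  classical
  induction S generalizing τ l with
  | nil =>
    have hb : Function.Bijective f :=
      ⟨fun y z h => hinj y (by simp) z (by simp) h, fun t => (hf t).imp fun _ h => h.2⟩
    rw [List.map_nil, List.nil_append, ← hrank_koszul_rename (Equiv.ofBijective f hb) hl]
    rfl
  | cons s S ih =>
    obtain ⟨hs, hS⟩ := List.nodup_cons.1 hS
    -- The variables in `S` are eliminated first, while `s` is kept apart as `none`; the remaining
    -- entry then eliminates `s`.
    let f' : σ → Option τ := fun y => if y = s then none else some (f y)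
    have hcs : ∀ y ∈ s :: S, c y ≠ s := fun y hy h => hc y hy (by simp [h])
    have hXX : ∀ y, Deg (X (c y) - X y : MvPolynomial σ ℚ) (2 * 0 + 2) :=
      fun y => (deg_X _).sub (deg_X _)
    have hl' : Homog ((0, X (c s) - X s) :: l) := homog_cons.2 ⟨hXX s, hl⟩
    have hH : Homog (S.map (fun y => ((0 : ℤ), X (c y) - X y)) ++ (0, X (c s) - X s) :: l) := by
      refine homog_append.2 ⟨fun e he => ?_, hl'⟩
      obtain ⟨y, -, rfl⟩ := List.mem_map.1 he
      exact hXX y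
    rw [List.map_cons, List.cons_append, (koszul_perm _ List.perm_middle.symm
      (hH.perm List.perm_middle)).hrank_eq, ih (f := f') hS (fun y hy h => hc y (by simp [hy])
        (by simp [h])) (fun y hy => ?_) (fun t => ?_) (fun y hy z hz h => ?_) hl', mapL_cons]
    · have e : rename f' (X (c s) - X s : MvPolynomial σ ℚ) = -(X none - rename some (X (f (c s)))) := by
        rw [map_sub, rename_X, rename_X, rename_X]
        simp [f', hcs s (by simp)]
      rw [e]
      refine ((QI.cone_neg _ _ _).hrank_eq k h).trans ?_
      rw [neg_neg]
      refine (hrank_koszul_elim (deg_X _) (hl.mapL (graded_rename f')) k h).trans ?_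
      congr 2
      rw [mapL, mapL, mapL, List.map_map]
      refine List.map_congr_left fun e _ => ?_
      have e' : (substNone (X (f (c s)))).comp (rename f') = rename f := by
        ext y
        simp only [AlgHom.comp_apply, rename_X, aeval_X]
        by_cases hy : y = s
        · simp [f', hy, hfc s (by simp)]
        · simp [f', hy]
      rw [← e']
      rfl
    · have : y ≠ s := fun h => hs (h ▸ hy)
      simp [f', hcs y (by simp [hy]), this, hfc y (by simp [hy])]
    · cases t with
      | none => exact ⟨s, hs, by simp [f']⟩
      | some t =>
        obtain ⟨y, hy, rfl⟩ := hf t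
        rw [List.mem_cons, not_or] at hy
        exact ⟨y, hy.2, by simp [f', hy.1]⟩
    · simp only [f'] at h
      split_ifs at h with h1 h2 h2
      · rw [h1, h2]
      · exact hinj y (by simp [h1, hy]) z (by simp [h2, hz]) (Option.some_injective _ h)

end Cx

theorem length_crossings {A : Type} [CommRing A] (p : ℕ → A) (w : List (ℕ × A)) :
    (crossings p w).length = w.length := by
  induction w generalizing p with
  | nil => rfl
  | cons e w ih => simp [crossings, ih]

theorem getElem_crossings {A : Type} [CommRing A] (p : ℕ → A) (w : List (ℕ × A)) (t : ℕ)
    (h : t < (crossings p w).length) (h' : t < w.length) :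
    (crossings p w)[t] = crossing (topLabel p (w.take t) w[t].1) (topLabel p (w.take t) (w[t].1 + 1))
      (topLabel p (w.take t) (w[t].1 + 2)) w[t].2 := by
  induction w generalizing p t with
  | nil => simp at h'
  | cons e w ih =>
    cases t with
    | zero => rfl
    | succ t =>
      simp only [crossings, List.getElem_cons_succ]
      rw [ih _ _ _ (by simpa using h')]
      rfl

/-- A label at the top is either unchanged or has been introduced by a crossing. -/
theorem topLabel_cases {A : Type} (p : ℕ → A) (w : List (ℕ × A)) (s : ℕ) :
    ((∀ e ∈ w, e.1 + 1 ≠ s) ∧ topLabel p w s = p s) ∨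
      ∃ e ∈ w, e.1 + 1 = s ∧ topLabel p w s = e.2 := by
  induction w generalizing p with
  | nil => exact Or.inl ⟨by simp, rfl⟩
  | cons e w ih =>
    rcases ih (Function.update p (e.1 + 1) e.2) with ⟨h1, h2⟩ | ⟨e', h1, h2, h3⟩
    · by_cases he : e.1 + 1 = s
      · refine Or.inr ⟨e, by simp, he, h2.trans ?_⟩
        rw [← he, Function.update_self]
      · refine Or.inl ⟨fun e' he' => ?_, h2.trans (Function.update_of_ne (Ne.symm he) _ _)⟩
        rcases List.mem_cons.1 he' with rfl | he'
        · exact he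
        · exact h1 e' he'
    · exact Or.inr ⟨e', by simp [h1], h2, h3⟩

section Closure

variable {b : ℕ} (w : BraidGraph b)

/-- The columns of a braid graph as numbers. -/
def cols : List ℕ := w.map fun i => i.1

/-- The names of the variables at the bottom. -/
def botVars : List (Fin b ⊕ Fin w.length) := (List.finRange b).map Sum.inl

/-- The crossings with the names of the variables that they introduce. -/
def crossVars : List (ℕ × (Fin b ⊕ Fin w.length)) :=
  (List.finRange w.length).map fun t => ((w.get t).1, Sum.inr t)

theorem pres_closure : Pres b (cols w) (botVars w) (crossVars w) := by
  refine ⟨by simp [botVars], ?_, ?_, ?_⟩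
  · rw [crossVars, List.map_map, cols]
    exact List.ext_getElem (by simp) (by simp)
  · rw [crossVars, List.map_map]
    refine List.Nodup.append ((List.nodup_finRange b).map Sum.inl_injective)
      ((List.nodup_finRange _).map Sum.inr_injective) ?_
    intro x hx hx'
    obtain ⟨s, -, rfl⟩ := List.mem_map.1 hx
    obtain ⟨t, -, ht⟩ := List.mem_map.1 hx'
    cases ht
  · rintro (s | t) <;> simp [botVars, crossVars]

/-- The labels after the first `t` crossings. -/
def lab (t : ℕ) : ℕ → MvPolynomial (Fin b ⊕ Fin w.length) ℚ :=
  topLabel (bottom (botVars w)) ((polyWord (crossVars w)).take t)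

theorem lab_zero : lab w 0 = bottom (botVars w) := rfl

theorem length_polyWord_crossVars : (polyWord (crossVars w)).length = w.length := by
  simp [polyWord, crossVars]

theorem lab_length : lab w w.length = topLabel (bottom (botVars w)) (polyWord (crossVars w)) := by
  rw [lab, List.take_of_length_le (length_polyWord_crossVars w).le]

theorem getElem_polyWord_crossVars (t : Fin w.length)
    (h : t.1 < (polyWord (crossVars w)).length) :
    (polyWord (crossVars w))[t.1] = ((w.get t).1, X (Sum.inr t)) := by
  simp [polyWord, crossVars]

theorem lab_succ (t : Fin w.length) :
    lab w (t + 1) = Function.update (lab w t) ((w.get t).1 + 1) (X (Sum.inr t)) := by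
  have h : t.1 < (polyWord (crossVars w)).length := (length_polyWord_crossVars w).symm ▸ t.2
  rw [lab, List.take_succ_eq_append_getElem h, topLabel_append, getElem_polyWord_crossVars]
  rfl

theorem lab_apply_zero (t : ℕ) : lab w t 0 = 0 :=
  topLabel_of_forall_ne fun e _ => by omega

theorem bottom_botVars (s : Fin b) : bottom (botVars w) (s + 1) = X (Sum.inl s) := by
  rw [bottom, botVars]
  simp

theorem deg_lab (t s : ℕ) : Deg (lab w t s) 2 :=
  deg_topLabel (deg_bottom _) (fun e he => deg_polyWord _ e (List.mem_of_mem_take he)) s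

/-- The quadratic relation of a crossing. -/
def labQuad (t : Fin w.length) : MvPolynomial (Fin b ⊕ Fin w.length) ℚ :=
  crossing (lab w t (w.get t).1) (lab w t ((w.get t).1 + 1)) (lab w t ((w.get t).1 + 2))
    (X (Sum.inr t))

theorem deg_labQuad (t : Fin w.length) : Deg (labQuad w t) 4 :=
  deg_crossing (deg_lab w _ _) (deg_lab w _ _) (deg_lab w _ _) (deg_X _)

theorem quadEntries_crossVars : quadEntries (bottom (botVars w)) (polyWord (crossVars w)) =
    List.ofFn fun t => (1, labQuad w t) := by
  refine List.ext_getElem (by simp [quadEntries, length_crossings, length_polyWord_crossVars]) ?_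
  intro t h1 h2
  have ht : t < w.length := by simpa using h2
  simp only [quadEntries, List.getElem_map, List.getElem_ofFn]
  rw [getElem_crossings _ _ _ _
    ((length_polyWord_crossVars w).symm ▸ ht), getElem_polyWord_crossVars w ⟨t, ht⟩]
  rfl

/-- The top label of a strand is always a variable: the one introduced by the last crossing in its
column, or the bottom variable if the column has no crossing. -/
theorem exists_top (s : Fin b) : ∃ y : Fin b ⊕ Fin w.length, lab w w.length (s + 1) = X y ∧
    ((s.1 ∈ cols w → ∃ t, y = Sum.inr t) ∧ (s.1 ∉ cols w → y = Sum.inl s)) := by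
  have hmem : ∀ e ∈ polyWord (crossVars w), ∃ t, e = ((w.get t).1, X (Sum.inr t)) := by
    intro e he
    simp only [polyWord, crossVars, List.map_map, List.mem_map] at he
    obtain ⟨t, -, rfl⟩ := he
    exact ⟨t, rfl⟩
  rw [lab_length]
  rcases topLabel_cases (bottom (botVars w)) (polyWord (crossVars w)) (s + 1) with
    ⟨h1, h2⟩ | ⟨e, h1, h2, h3⟩
  · refine ⟨Sum.inl s, h2.trans (bottom_botVars w s), fun h => ?_, fun _ => rfl⟩
    obtain ⟨i, hi, his⟩ := List.mem_map.1 h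
    obtain ⟨t, ht⟩ := List.mem_iff_get.1 hi
    refine absurd ?_ (h1 ((w.get t).1, X (Sum.inr t)) ?_)
    · change (w.get t).1 + 1 = _
      rw [ht, his]
    · simp only [polyWord, crossVars, List.map_map, List.mem_map]
      exact ⟨t, List.mem_finRange t, rfl⟩
  · obtain ⟨t, rfl⟩ := hmem e h1
    refine ⟨Sum.inr t, h3, fun _ => ⟨t, rfl⟩, fun h => absurd ?_ h⟩
    exact List.mem_map.2 ⟨w.get t, List.get_mem _ _, Nat.succ_injective h2⟩

/-- The variable at the top of a strand. -/
def topVar : Fin b ⊕ Fin w.length → Fin b ⊕ Fin w.length :=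
  Sum.elim (fun s => (exists_top w s).choose) Sum.inr

theorem lab_top (s : Fin b) : lab w w.length (s + 1) = X (topVar w (Sum.inl s)) :=
  (exists_top w s).choose_spec.1

theorem topVar_of_mem {s : Fin b} (h : s.1 ∈ cols w) : ∃ t, topVar w (Sum.inl s) = Sum.inr t :=
  (exists_top w s).choose_spec.2.1 h

theorem topVar_of_notMem {s : Fin b} (h : s.1 ∉ cols w) : topVar w (Sum.inl s) = Sum.inl s :=
  (exists_top w s).choose_spec.2.2 h

/-- The variables at the bottom of the strands with a crossing to their right. -/
def elimVars : List (Fin b ⊕ Fin w.length) :=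
  ((List.finRange b).filter fun s => s.1 ∈ cols w).map Sum.inl

theorem inl_mem_elimVars {s : Fin b} : Sum.inl s ∈ elimVars w ↔ s.1 ∈ cols w := by
  simp [elimVars]

theorem inr_notMem_elimVars (t : Fin w.length) : Sum.inr t ∉ elimVars w := by
  simp [elimVars]

/-- The variables that remain after closing up. -/
abbrev FreeVar : Type := {y : Fin b ⊕ Fin w.length // y ∉ elimVars w}

theorem topVar_notMem (y : Fin b ⊕ Fin w.length) : topVar w y ∉ elimVars w := by
  rcases y with s | t
  · by_cases hs : s.1 ∈ cols w
    · obtain ⟨t, ht⟩ := topVar_of_mem w hs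
      rw [ht]
      exact inr_notMem_elimVars w t
    · rwa [topVar_of_notMem w hs, inl_mem_elimVars]
  · exact inr_notMem_elimVars w t

theorem topVar_of_notMem_elimVars {y : Fin b ⊕ Fin w.length} (h : y ∉ elimVars w) :
    topVar w y = y := by
  rcases y with s | t
  · exact topVar_of_notMem w fun hs => h ((inl_mem_elimVars w).2 hs)
  · rfl

/-- Close up. -/
def freeVar (y : Fin b ⊕ Fin w.length) : FreeVar w := ⟨topVar w y, topVar_notMem w y⟩

theorem freeVar_topVar (y : Fin b ⊕ Fin w.length) : freeVar w (topVar w y) = freeVar w y :=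
  Subtype.ext (topVar_of_notMem_elimVars w (topVar_notMem w y))

/-- The number of strands without a crossing to their right. -/
def freeCount : ℕ := ((List.finRange b).filter fun s => s.1 ∉ cols w).length

/-- The closing entries of strands with a crossing to their right express bottom variables by
crossing variables and are used for elimination. The other closing entries are `0`; they stay as
`freeCount w` trivial factors, the counterpart of the complexes for the connected components. -/
theorem hh_eq_hrank_cube (k h : ℤ) :
    hh b (cols w) k h = (((base (FreeVar w)).cube 0 (freeCount w) 0).cube 1 w.length
      fun t => rename (freeVar w) (labQuad w t)).hrank k h := by
  have hQ : Homog (quadEntries (bottom (botVars w)) (polyWord (crossVars w))) :=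
    homog_quadEntries (deg_bottom _) (deg_polyWord _)
  have hr := graded_rename (freeVar w)
  have hZ : ∀ {σ : Type} (n : ℕ), Homog (List.replicate n ((0 : ℤ), (0 : MvPolynomial σ ℚ))) := by
    intro σ n e he
    rw [List.eq_of_mem_replicate he]
    exact isWeightedHomogeneous_zero _ _ _
  have hperm : (presEntries (botVars w) (crossVars w)).Perm
      ((elimVars w).map (fun y => ((0 : ℤ), X (topVar w y) - X y)) ++
        (quadEntries (bottom (botVars w)) (polyWord (crossVars w)) ++
          List.replicate (freeCount w) (0, 0))) := by
    have h1 : closeEntries (List.range b) (bottom (botVars w)) (lab w w.length) =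
        (List.finRange b).map fun s => ((0 : ℤ), X (topVar w (Sum.inl s)) - X (Sum.inl s)) := by
      rw [closeEntries, ← List.map_coe_finRange_eq_range, List.map_map]
      refine List.map_congr_left fun s _ => ?_
      simp only [Function.comp_apply, lab_top, bottom_botVars]
    have h2 : (closeEntries (List.range b) (bottom (botVars w)) (lab w w.length)).Perm
        ((elimVars w).map (fun y => ((0 : ℤ), X (topVar w y) - X y)) ++
          List.replicate (freeCount w) (0, 0)) := by
      rw [h1]
      refine ((List.filter_append_perm (fun s : Fin b => decide (s.1 ∈ cols w)) _).symm.map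
        _).trans ?_
      rw [List.map_append]
      refine List.Perm.of_eq (congrArg₂ (· ++ ·) ?_ ?_)
      · rw [elimVars, List.map_map]
        rfl
      · refine List.eq_replicate_iff.2 ⟨?_, fun e he => ?_⟩
        · rw [List.length_map, freeCount]
          simp
        · obtain ⟨s, hs, rfl⟩ := List.mem_map.1 he
          rw [topVar_of_notMem w (by simpa using hs), sub_self]
    rw [presEntries, entries, ← lab_length, (pres_closure w).length]
    refine (h2.append_left _).trans ?_
    rw [← List.append_assoc, ← List.append_assoc]
    exact List.perm_append_comm.append_right _
  rw [← (pres_closure w).hrank, (koszul_perm _ hperm (homog_presEntries _ _)).hrank_eq,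
    hrank_koszul_elim_many (f := freeVar w) ?_ (fun y _ => topVar_notMem w y)
      (fun y _ => freeVar_topVar w y) ?_ ?_ (homog_append.2 ⟨hQ, hZ _⟩)]
  · rw [mapL_append, koszul_append]
    have e1 : mapL (rename (freeVar w)) (List.replicate (freeCount w) (0, 0)) =
        List.ofFn fun c : Fin (freeCount w) => ((0 : ℤ), (0 : Fin (freeCount w) → _) c) := by
      simp [mapL, List.ofFn_const]
    have e2 : mapL (rename (freeVar w)) (quadEntries (bottom (botVars w)) (polyWord (crossVars w))) =
        List.ofFn fun t => ((1 : ℤ), rename (freeVar w) (labQuad w t)) := by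
      rw [quadEntries_crossVars, mapL, List.map_ofFn]
      rfl
    have h0 := cube_equiv_koszul (base (FreeVar w)) (fun _ => rfl) (s := 0) (n := freeCount w)
      (Q := 0) fun _ => isWeightedHomogeneous_zero _ _ _
    rw [← e1] at h0
    have h1 := cube_equiv_koszul ((base (FreeVar w)).cube 0 (freeCount w) 0) ?_ (s := 1)
      (Q := fun t => rename (freeVar w) (labQuad w t)) fun t => hr _ _ (deg_labQuad w t)
    · rw [← e2] at h1
      exact (h1.trans (h0.koszul (hQ.mapL hr))).symm.hrank_eq k h
    · intro x
      funext S
      refine (cube_d_apply _ _ _ _ _).trans (Finset.sum_eq_zero fun c _ => ?_)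
      simp
  · exact ((List.nodup_finRange b).filter _).map Sum.inl_injective
  · rintro ⟨y, hy⟩
    exact ⟨y, hy, Subtype.ext (topVar_of_notMem_elimVars w hy)⟩
  · intro y hy z hz h
    have := congrArg Subtype.val h
    simpa [freeVar, topVar_of_notMem_elimVars w hy, topVar_of_notMem_elimVars w hz] using this

end Closure

end KR


/-! ### The edge ring of a closed braid graph as a polynomial ring -/

namespace KR

open MvPolynomial Cx

namespace ClosedGraph

variable (D : ClosedGraph)

theorem x_markOut (v : D.Mark) : D.x (D.markOut v) = D.x (D.markIn v) := by
  refine (Ideal.Quotient.mk_eq_mk_iff_sub_mem _ _).2 ?_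
  exact Ideal.subset_span (Or.inl ⟨v, rfl⟩)

theorem x_crossing (c : Fin D.numCrossings) :
    D.x (D.outL c) + D.x (D.outR c) = D.x (D.inL c) + D.x (D.inR c) := by
  simp only [x, ← map_add]
  refine (Ideal.Quotient.mk_eq_mk_iff_sub_mem _ _).2 ?_
  rw [← sub_sub]
  exact Ideal.subset_span (Or.inr ⟨c, rfl⟩)

theorem weight_two {σ : Type} (d : σ →₀ ℕ) :
    Finsupp.weight (fun _ => (2 : ℤ)) d = 2 * (Finsupp.weight 1 d : ℕ) := by
  rw [Finsupp.weight_apply, Finsupp.weight_apply, Finsupp.sum, Finsupp.sum, Nat.cast_sum,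
    Finset.mul_sum]
  refine Finset.sum_congr rfl fun i _ => ?_
  simp [mul_comm]

theorem isHomogeneous_iff_deg {σ : Type} {f : MvPolynomial σ ℚ} {m : ℕ} :
    f.IsHomogeneous m ↔ Deg f (2 * m) := by
  refine forall_congr' fun d => imp_congr_right fun _ => ?_
  rw [weight_two]
  constructor
  · intro h
    rw [h]
  · intro h
    exact_mod_cast mul_left_cancel₀ (two_ne_zero) h

theorem edgeRingPart_two_mul (m : ℕ) : D.edgeRingPart (2 * m) =
    (homogeneousSubmodule D.Edge ℚ m).map
      (Ideal.Quotient.mkₐ ℚ D.relatorIdeal).toLinearMap := by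
  refine le_antisymm (iSup₂_le fun m' hm' => ?_) (le_iSup₂_of_le m rfl le_rfl)
  have : m' = m := by omega
  rw [this]

theorem edgeRingPart_eq_bot {k : ℤ} (hk : ¬∃ m : ℕ, 2 * (m : ℤ) = k) : D.edgeRingPart k = ⊥ := by
  simp only [edgeRingPart, iSup_eq_bot]
  exact fun m hm => absurd ⟨m, hm⟩ hk

theorem mem_edgeRingPart {k : ℤ} {y : D.EdgeRing} :
    y ∈ D.edgeRingPart k ↔ ∃ f, Deg f k ∧ Ideal.Quotient.mk D.relatorIdeal f = y := by
  by_cases hk : ∃ m : ℕ, 2 * (m : ℤ) = k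
  · obtain ⟨m, rfl⟩ := hk
    rw [edgeRingPart_two_mul]
    simp only [Submodule.mem_map, mem_homogeneousSubmodule, isHomogeneous_iff_deg]
    rfl
  · rw [edgeRingPart_eq_bot D hk, Submodule.mem_bot]
    constructor
    · rintro rfl
      exact ⟨0, isWeightedHomogeneous_zero _ _ _, map_zero _⟩
    · rintro ⟨f, hf, rfl⟩
      have : f = 0 := by
        by_contra h
        obtain ⟨d, hd⟩ := MvPolynomial.ne_zero_iff.1 h
        exact hk ⟨_, (weight_two d).symm.trans (hf hd)⟩
      rw [this, map_zero]

theorem finite_edgeRingPart (k : ℤ) : Module.Finite ℚ (D.edgeRingPart k) := by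
  have := D.finiteEdge
  by_cases hk : ∃ m : ℕ, 2 * (m : ℤ) = k
  · obtain ⟨m, rfl⟩ := hk
    rw [edgeRingPart_two_mul, Module.Finite.iff_fg]
    exact (homogeneousSubmodule_fg _ _ m).map _
  · rw [edgeRingPart_eq_bot D hk]
    infer_instance

instance : Finite D.Component := by
  have := D.finiteEdge
  exact Quot.finite _

theorem finite_chainPart (i h : ℤ) : Module.Finite ℚ (D.chainPart i h) := by
  have := D.finite_edgeRingPart
  have : Finite D.BasisIndex := inferInstance
  have hmem : ∀ (x : D.chainPart i h) (s : D.BasisIndex),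
      x.1 s ∈ D.edgeRingPart (i - D.qShift s) := by
    intro x s
    have h1 := x.2 s (Set.mem_univ s)
    beta_reduce at h1
    split_ifs at h1 with hs
    · exact h1
    · rw [(Submodule.mem_bot ℚ).1 h1]
      exact zero_mem _
  let F : D.chainPart i h →ₗ[ℚ] ((s : D.BasisIndex) → D.edgeRingPart (i - D.qShift s)) :=
    { toFun := fun x s => ⟨x.1 s, hmem x s⟩
      map_add' := fun _ _ => rfl
      map_smul' := fun _ _ => rfl }
  refine Module.Finite.of_injective F fun x y hxy => Subtype.ext (funext fun s => ?_)
  exact congrArg Subtype.val (congrFun hxy s)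

theorem finite_homology (i h : ℤ) : Module.Finite ℚ (D.Homology i h) := by
  have := D.finite_chainPart i h
  have : Module.Finite ℚ (D.cycles i h) :=
    Submodule.finiteDimensional_of_le (inf_le_right : D.cycles i h ≤ D.chainPart i h)
  infer_instance

theorem exists_grH_eq {i h : ℤ} (H : Nontrivial (D.Homology i h)) : ∃ s, D.grH s = h := by
  by_contra hs
  push Not at hs
  have hc : ∀ x : D.cycles i h, x = 0 := by
    intro x
    refine Subtype.ext (funext fun s => ?_)
    have h1 := (Submodule.mem_inf.1 x.2).2 s (Set.mem_univ s)
    beta_reduce at h1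
    rw [if_neg (hs s)] at h1
    exact (Submodule.mem_bot ℚ).1 h1
  have : Subsingleton (D.cycles i h) := ⟨fun x y => (hc x).trans (hc y).symm⟩
  have : Subsingleton (D.Homology i h) := (Submodule.mkQ_surjective _).subsingleton
  exact not_subsingleton _ this

theorem finite_support_homology : {h : ℤ | ∃ i : ℤ, Nontrivial (D.Homology i h)}.Finite := by
  have : Finite D.BasisIndex := inferInstance
  refine (Set.finite_range D.grH).subset ?_
  rintro h ⟨i, hi⟩
  exact D.exists_grH_eq hi

end ClosedGraph

section Closure

variable {b : ℕ} (w : BraidGraph b)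

/-- The edge variables. -/
def xx (t s : ℕ) : (closure w).EdgeRing :=
  if h : t < w.length + 1 ∧ s < b then (closure w).x (⟨t, h.1⟩, ⟨s, h.2⟩) else 0

/-- The partial sums of edge variables. -/
def psum (t s : ℕ) : (closure w).EdgeRing := ∑ r ∈ Finset.range s, xx w t r

theorem xx_eq (t : Fin (w.length + 1)) (s : Fin b) : xx w t s = (closure w).x (t, s) := by
  rw [xx, dif_pos ⟨t.2, s.2⟩]

theorem xx_mark (t : Fin w.length) {s : ℕ} (h1 : s ≠ (w.get t).1) (h2 : s ≠ (w.get t).1 + 1) :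
    xx w (t + 1) s = xx w t s := by
  by_cases hs : s < b
  · have h := (closure w).x_markOut (Sum.inl ⟨(t, ⟨s, hs⟩), h1, h2⟩)
    exact (xx_eq w t.succ ⟨s, hs⟩).trans (h.trans (xx_eq w t.castSucc ⟨s, hs⟩).symm)
  · rw [xx, xx, dif_neg (by omega), dif_neg (by omega)]

theorem xx_close (s : ℕ) : xx w w.length s = xx w 0 s := by
  by_cases hs : s < b
  · have h := (closure w).x_markOut (Sum.inr ⟨s, hs⟩)
    exact (xx_eq w (Fin.last _) ⟨s, hs⟩).trans (h.symm.trans (xx_eq w 0 ⟨s, hs⟩).symm)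
  · rw [xx, xx, dif_neg (by omega), dif_neg (by omega)]

theorem xx_cross (t : Fin w.length) : xx w (t + 1) (w.get t).1 + xx w (t + 1) ((w.get t).1 + 1) =
    xx w t (w.get t).1 + xx w t ((w.get t).1 + 1) := by
  have h := (closure w).x_crossing t
  have h2 := (w.get t).2
  have e1 := xx_eq w t.succ ⟨(w.get t).1, by omega⟩
  have e2 := xx_eq w t.succ ⟨(w.get t).1 + 1, h2⟩
  have e3 := xx_eq w t.castSucc ⟨(w.get t).1, by omega⟩
  have e4 := xx_eq w t.castSucc ⟨(w.get t).1 + 1, h2⟩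
  refine (congrArg₂ (· + ·) e1 e2).trans (h.trans (congrArg₂ (· + ·) e3 e4).symm)

theorem psum_zero (t : ℕ) : psum w t 0 = 0 := rfl

theorem psum_succ (t s : ℕ) : psum w t (s + 1) = psum w t s + xx w t s :=
  Finset.sum_range_succ _ _

theorem psum_close (s : ℕ) : psum w w.length s = psum w 0 s :=
  Finset.sum_congr rfl fun r _ => xx_close w r

/-- The linear relation of a crossing preserves the sum of its two edge variables, and marks
preserve the others. So the only partial sum that can change is the one that ends between the two
strands. -/
theorem psum_cross (t : Fin w.length) {s : ℕ} (hs : s ≠ (w.get t).1 + 1) :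
    psum w (t + 1) s = psum w t s := by
  have h1 : ∀ s ≤ (w.get t).1, psum w (t + 1) s = psum w t s := fun s hs =>
    Finset.sum_congr rfl fun r hr => by
      have := Finset.mem_range.1 hr
      exact xx_mark w t (by omega) (by omega)
  by_cases h : s ≤ (w.get t).1
  · exact h1 s h
  · have h2 : (w.get t).1 + 2 ≤ s := by omega
    induction s, h2 using Nat.le_induction with
    | base =>
      rw [psum_succ, psum_succ, psum_succ, psum_succ, h1 _ le_rfl, add_assoc, xx_cross, add_assoc]
    | succ s hs' ih =>
      rw [psum_succ, psum_succ, ih (by omega) (by omega), xx_mark w t (by omega) (by omega)]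

/-- The map from the polynomial ring before closing up to the edge ring. -/
def toEdge₀ : MvPolynomial (Fin b ⊕ Fin w.length) ℚ →ₐ[ℚ] (closure w).EdgeRing :=
  aeval (Sum.elim (fun s => psum w 0 (s + 1)) fun t => psum w (t + 1) ((w.get t).1 + 1))

theorem toEdge₀_lab {t : ℕ} (ht : t ≤ w.length) {s : ℕ} (hs : s ≤ b) :
    toEdge₀ w (lab w t s) = psum w t s := by
  induction t generalizing s with
  | zero =>
    cases s with
    | zero => exact map_zero _
    | succ s =>
      rw [lab_zero, bottom_botVars w ⟨s, hs⟩, toEdge₀, aeval_X]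
      rfl
  | succ t ih =>
    have h := lab_succ w ⟨t, ht⟩
    rw [h, Function.update_apply]
    split_ifs with h1
    · rw [toEdge₀, aeval_X, h1]
      rfl
    · rw [ih (by omega) hs]
      exact (psum_cross w ⟨t, ht⟩ h1).symm

theorem toEdge₀_topVar (y : Fin b ⊕ Fin w.length) :
    toEdge₀ w (X (topVar w y)) = toEdge₀ w (X y) := by
  rcases y with s | t
  · rw [← lab_top, toEdge₀_lab w le_rfl s.2, psum_close, toEdge₀, aeval_X]
    rfl
  · rfl

/-- The map from a polynomial ring to the edge ring. -/
def toEdge : MvPolynomial (FreeVar w) ℚ →ₐ[ℚ] (closure w).EdgeRing :=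
  (toEdge₀ w).comp (rename Subtype.val)

theorem toEdge_rename (f : MvPolynomial (Fin b ⊕ Fin w.length) ℚ) :
    toEdge w (rename (freeVar w) f) = toEdge₀ w f := by
  have : (toEdge w).comp (rename (freeVar w)) = toEdge₀ w := by
    ext y
    simp only [AlgHom.comp_apply, rename_X, toEdge]
    exact toEdge₀_topVar w y
  rw [← this]
  rfl

/-- The labels after closing up. -/
def flab (t s : ℕ) : MvPolynomial (FreeVar w) ℚ := rename (freeVar w) (lab w t s)

theorem toEdge_flab {t : ℕ} (ht : t ≤ w.length) {s : ℕ} (hs : s ≤ b) :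
    toEdge w (flab w t s) = psum w t s := by
  rw [flab, toEdge_rename, toEdge₀_lab w ht hs]

theorem flab_cross (t : Fin w.length) {s : ℕ} (hs : s ≠ (w.get t).1 + 1) :
    flab w (t + 1) s = flab w t s := by
  rw [flab, lab_succ, Function.update_of_ne hs]
  rfl

theorem flab_close {s : ℕ} (hs : s ≤ b) : flab w w.length s = flab w 0 s := by
  cases s with
  | zero => rw [flab, flab, lab_apply_zero, lab_apply_zero]
  | succ s =>
    rw [flab, flab, lab_top w ⟨s, hs⟩, lab_zero, bottom_botVars w ⟨s, hs⟩, rename_X, rename_X,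
      freeVar_topVar]

/-- The map from the polynomial ring of all edges to the polynomial ring of the free variables. -/
def ofEdge₀ : MvPolynomial (closure w).Edge ℚ →ₐ[ℚ] MvPolynomial (FreeVar w) ℚ :=
  aeval fun e : Fin (w.length + 1) × Fin b => flab w e.1 (e.2 + 1) - flab w e.1 e.2

theorem ofEdge₀_X (t : Fin (w.length + 1)) (s : Fin b) :
    ofEdge₀ w (X (t, s)) = flab w t (s + 1) - flab w t s := aeval_X _ _

/-- An edge is sent to the difference of the labels on its two sides. The relators of marks and
crossings involve only labels that do not change there, or cancel the one that does; the closing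
marks use that top and bottom labels have been identified. -/
theorem ofEdge₀_relatorIdeal {f : MvPolynomial (closure w).Edge ℚ}
    (hf : f ∈ (closure w).relatorIdeal) : ofEdge₀ w f = 0 := by
  suffices h : (closure w).relatorIdeal ≤ RingHom.ker (ofEdge₀ w) from h hf
  refine Ideal.span_le.2 ?_
  rintro _ (⟨v, rfl⟩ | ⟨t, rfl⟩)
  · refine (map_sub (ofEdge₀ w) _ _).trans ?_
    rcases v with ⟨⟨t, s⟩, h1, h2⟩ | s
    · refine (congrArg₂ (· - ·) (ofEdge₀_X w t.succ s) (ofEdge₀_X w t.castSucc s)).trans ?_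
      rw [Fin.val_succ, flab_cross w t (by simpa using h1), flab_cross w t h2]
      exact sub_self _
    · refine (congrArg₂ (· - ·) (ofEdge₀_X w 0 s) (ofEdge₀_X w (Fin.last _) s)).trans ?_
      rw [Fin.val_last, flab_close w s.2.le, flab_close w s.2]
      exact sub_self _
  · have h2 := (w.get t).2
    have h1 : (w.get t).1 < b := by omega
    refine (map_sub (ofEdge₀ w) _ _).trans ((congrArg₂ (· - ·) ((map_sub (ofEdge₀ w) _ _).trans
      (congrArg₂ (· - ·) ((map_add (ofEdge₀ w) _ _).trans (congrArg₂ (· + ·)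
      (ofEdge₀_X w t.succ ⟨(w.get t).1, h1⟩) (ofEdge₀_X w t.succ ⟨(w.get t).1 + 1, h2⟩)))
      (ofEdge₀_X w t.castSucc ⟨(w.get t).1, h1⟩)))
      (ofEdge₀_X w t.castSucc ⟨(w.get t).1 + 1, h2⟩)).trans ?_)
    change flab w (t.1 + 1) ((w.get t).1 + 1) - flab w (t.1 + 1) (w.get t).1 +
      (flab w (t.1 + 1) ((w.get t).1 + 2) - flab w (t.1 + 1) ((w.get t).1 + 1)) -
      (flab w t.1 ((w.get t).1 + 1) - flab w t.1 (w.get t).1) -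
      (flab w t.1 ((w.get t).1 + 2) - flab w t.1 ((w.get t).1 + 1)) = 0
    rw [flab_cross w t (show (w.get t).1 ≠ _ by omega),
      flab_cross w t (show (w.get t).1 + 2 ≠ _ by omega)]
    ring

/-- The map from the edge ring to a polynomial ring. -/
def ofEdge : (closure w).EdgeRing →ₐ[ℚ] MvPolynomial (FreeVar w) ℚ :=
  Ideal.Quotient.liftₐ _ (ofEdge₀ w) fun _ => ofEdge₀_relatorIdeal w

theorem ofEdge_mk (f : MvPolynomial (closure w).Edge ℚ) :
    ofEdge w (Ideal.Quotient.mk _ f) = ofEdge₀ w f := rfl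

theorem ofEdge_xx {t : ℕ} (ht : t ≤ w.length) {s : ℕ} (hs : s < b) :
    ofEdge w (xx w t s) = flab w t (s + 1) - flab w t s := by
  rw [xx, dif_pos ⟨Nat.lt_succ_of_le ht, hs⟩]
  exact ofEdge₀_X w _ _

theorem ofEdge_psum {t : ℕ} (ht : t ≤ w.length) {s : ℕ} (hs : s ≤ b) :
    ofEdge w (psum w t s) = flab w t s := by
  induction s with
  | zero => rw [psum_zero, map_zero, flab, lab_apply_zero, map_zero]
  | succ s ih =>
    rw [psum_succ, map_add, ih (by omega), ofEdge_xx w ht hs]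
    ring

theorem toEdge_ofEdge (y : (closure w).EdgeRing) : toEdge w (ofEdge w y) = y := by
  obtain ⟨f, rfl⟩ := Ideal.Quotient.mk_surjective y
  have : (toEdge w).comp (ofEdge₀ w) = Ideal.Quotient.mkₐ ℚ (closure w).relatorIdeal := by
    refine MvPolynomial.algHom_ext fun e => ?_
    obtain ⟨t, s⟩ := e
    have ht := Nat.le_of_lt_succ t.2
    refine (congrArg (toEdge w) (ofEdge₀_X w t s)).trans ?_
    rw [map_sub, toEdge_flab w ht s.2, toEdge_flab w ht s.2.le, psum_succ, add_sub_cancel_left,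
      xx_eq]
    rfl
  rw [ofEdge_mk]
  exact congrArg (fun g : _ →ₐ[ℚ] _ => g f) this

theorem ofEdge_toEdge (f : MvPolynomial (FreeVar w) ℚ) : ofEdge w (toEdge w f) = f := by
  have : (ofEdge w).comp (toEdge w) = AlgHom.id ℚ _ := by
    ext1 ⟨y, hy⟩
    rw [AlgHom.comp_apply, toEdge, AlgHom.comp_apply, rename_X]
    have hy' : X (freeVar w y) = (X ⟨y, hy⟩ : MvPolynomial (FreeVar w) ℚ) :=
      congrArg X (Subtype.ext (topVar_of_notMem_elimVars w hy))
    refine Eq.trans ?_ hy'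
    rcases y with s | t
    · rw [toEdge₀, aeval_X, Sum.elim_inl, ofEdge_psum w (Nat.zero_le _) s.2, flab, lab_zero,
        bottom_botVars, rename_X]
    · have := (w.get t).2
      rw [toEdge₀, aeval_X, Sum.elim_inr, ofEdge_psum w t.2 (by omega), flab, lab_succ,
        Function.update_self, rename_X]
  exact congrArg (fun g : _ →ₐ[ℚ] _ => g f) this

/-- The edge ring of the closure of a braid graph is a polynomial ring. -/
def edgeEquiv : (closure w).EdgeRing ≃ₐ[ℚ] MvPolynomial (FreeVar w) ℚ :=
  AlgEquiv.ofAlgHom (ofEdge w) (toEdge w) (AlgHom.ext (ofEdge_toEdge w))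
    (AlgHom.ext (toEdge_ofEdge w))

theorem deg_flab (t s : ℕ) : Deg (flab w t s) 2 := graded_rename _ _ _ (deg_lab w t s)

/-- Both mutually inverse maps send variables to elements of degree `2`, so each preserves the
grading and homogeneity can be tested on either side. -/
theorem deg_edgeEquiv {y : (closure w).EdgeRing} {k : ℤ} :
    Deg (edgeEquiv w y) k ↔ y ∈ (closure w).edgeRingPart k := by
  constructor
  · intro h
    have hx : ∀ t s, xx w t s ∈ (closure w).edgeRingPart 2 := by
      intro t s
      rw [xx]
      split_ifs
      · exact ((closure w).mem_edgeRingPart).2 ⟨_, deg_X _, rfl⟩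
      · exact zero_mem _
    have h2 := aeval_mem (closure w).edgeRingPart
      (((closure w).mem_edgeRingPart).2 ⟨1, isWeightedHomogeneous_one _ _, map_one _⟩) ?_
      (x := fun y : FreeVar w => toEdge w (X y)) (fun y => ?_) h
    · have e : aeval (fun y : FreeVar w => toEdge w (X y)) = toEdge w := by
        ext y
        simp
      rw [e] at h2
      exact (toEdge_ofEdge w y) ▸ h2
    · intro i j a b ha hb
      obtain ⟨f, hf, rfl⟩ := ((closure w).mem_edgeRingPart).1 ha
      obtain ⟨g, hg, rfl⟩ := ((closure w).mem_edgeRingPart).1 hb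
      exact ((closure w).mem_edgeRingPart).2 ⟨f * g, hf.mul hg, map_mul _ _ _⟩
    · rw [toEdge, AlgHom.comp_apply, rename_X, toEdge₀, aeval_X]
      rcases y with ⟨s | t, hy⟩
      · change psum w _ _ ∈ _
        exact Submodule.sum_mem _ fun r _ => hx _ _
      · change psum w _ _ ∈ _
        exact Submodule.sum_mem _ fun r _ => hx _ _
  · intro h
    obtain ⟨f, hf, rfl⟩ := ((closure w).mem_edgeRingPart).1 h
    exact graded_aeval (fun e => (deg_flab w _ _).sub (deg_flab w _ _)) _ _ hf

/-- With labels `a`, `b`, `c` below and `a`, `r`, `c` above the crossing, `(r - a) * (c - r) - (b -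
a) * (c - b)` factors as `(r - b) * (a + c - r - b)`. -/
theorem edgeEquiv_quad (t : Fin w.length) :
    edgeEquiv w ((closure w).quad t) = rename (freeVar w) (labQuad w t) := by
  have h2 := (w.get t).2
  have h1 : (w.get t).1 < b := by omega
  have e : (closure w).quad t = xx w (t + 1) (w.get t).1 * xx w (t + 1) ((w.get t).1 + 1) -
      xx w t (w.get t).1 * xx w t ((w.get t).1 + 1) := by
    have e1 := xx_eq w t.succ ⟨(w.get t).1, h1⟩
    have e2 := xx_eq w t.succ ⟨(w.get t).1 + 1, h2⟩
    have e3 := xx_eq w t.castSucc ⟨(w.get t).1, h1⟩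
    have e4 := xx_eq w t.castSucc ⟨(w.get t).1 + 1, h2⟩
    exact (congrArg₂ (· - ·) (congrArg₂ (· * ·) e1 e2) (congrArg₂ (· * ·) e3 e4)).symm
  have hi := flab_cross w t (show (w.get t).1 ≠ _ by omega)
  have hi2 := flab_cross w t (show (w.get t).1 + 2 ≠ _ by omega)
  have hi1 : flab w (t + 1) ((w.get t).1 + 1) = rename (freeVar w) (X (Sum.inr t)) := by
    rw [flab, lab_succ, Function.update_self]
  refine Eq.trans (congrArg (ofEdge w) e) ?_
  rw [map_sub, map_mul, map_mul, ofEdge_xx w t.2 h1, ofEdge_xx w t.2 h2, ofEdge_xx w t.2.le h1,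
    ofEdge_xx w t.2.le h2, labQuad, map_crossing']
  change (flab w (t + 1) ((w.get t).1 + 1) - flab w (t + 1) (w.get t).1) *
    (flab w (t + 1) ((w.get t).1 + 2) - flab w (t + 1) ((w.get t).1 + 1)) -
    (flab w t ((w.get t).1 + 1) - flab w t (w.get t).1) *
    (flab w t ((w.get t).1 + 2) - flab w t ((w.get t).1 + 1)) =
    crossing (flab w t (w.get t).1) (flab w t ((w.get t).1 + 1)) (flab w t ((w.get t).1 + 2)) _
  rw [hi, hi2, hi1]
  simp only [crossing]
  ring

end Closure

end KR


/-! ### Boundaries of homogeneous chains -/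

namespace KR

open MvPolynomial Cx

namespace Cx

variable {σ : Type}

/-- Every element has homogeneous components. -/
def Splits (X : Cx σ) : Prop :=
  ∃ π : ℤ → ℤ → X.V →+ X.V, (∀ k h v, π k h v ∈ X.part k h) ∧
    (∀ k h v, v ∈ X.part k h → π k h v = v) ∧
    ∀ (f : MvPolynomial σ ℚ) e k h v, Deg f e → π (k + e) h (f • v) = f • π k h v

theorem splits_base : (base σ).Splits := by
  classical
  let 𝒜 : ℤ → Submodule ℚ (MvPolynomial σ ℚ) := weightedHomogeneousSubmodule ℚ fun _ => (2 : ℤ)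
  let _ : GradedAlgebra 𝒜 := weightedGradedAlgebra ℚ _
  let π : ℤ → ℤ → MvPolynomial σ ℚ →+ MvPolynomial σ ℚ :=
    fun k h => if h = 0 then GradedRing.proj 𝒜 k else 0
  have h0 : ∀ k, π k 0 = GradedRing.proj 𝒜 k := fun k => if_pos rfl
  have h0' : ∀ k h, h ≠ 0 → π k h = 0 := fun k h hh => if_neg hh
  have h1 : ∀ k h v, π k h v ∈ basePart σ k h := by
    intro k h v
    rw [mem_basePart]
    rcases eq_or_ne h 0 with rfl | hh
    · exact ⟨(h0 k).symm ▸ SetLike.coe_mem (DirectSum.decompose 𝒜 v k), Or.inl rfl⟩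
    · rw [h0' k h hh]
      exact ⟨isWeightedHomogeneous_zero _ _ _, Or.inr rfl⟩
  have h2 : ∀ k h v, v ∈ basePart σ k h → π k h v = v := by
    intro k h v hv
    rw [mem_basePart] at hv
    rcases eq_or_ne h 0 with rfl | hh
    · rw [h0]
      exact DirectSum.decompose_of_mem_same 𝒜 hv.1
    · rw [hv.2.resolve_left hh, map_zero]
  have h3 : ∀ f e k h v, Deg f e → π (k + e) h (f * v) = f * π k h v := by
    intro f e k h v hf
    rcases eq_or_ne h 0 with rfl | hh
    · rw [h0, h0, add_comm k e]
      exact DirectSum.coe_decompose_mul_add_of_left_mem (𝒜 := 𝒜) (i := e) (j := k) (b := v) hf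
    · rw [h0' _ h hh, h0' _ h hh]
      exact (mul_zero f).symm
  exact ⟨π, h1, h2, h3⟩

theorem Splits.cube {X : Cx σ} (hX : X.Splits) (s : ℤ) {n : ℕ} (Q : Fin n → MvPolynomial σ ℚ) :
    (X.cube s n Q).Splits := by
  obtain ⟨π, h1, h2, h3⟩ := hX
  refine ⟨fun k h => AddMonoidHom.mk' (fun (x : Finset (Fin n) → X.V) S =>
    π (k + s * (2 * S.card - n)) (h + n - S.card) (x S)) ?_, ?_, ?_, ?_⟩
  · intro x y
    funext S
    exact map_add _ _ _
  · intro k h x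
    exact (mem_cube_part X s Q).2 fun S => h1 _ _ _
  · intro k h x hx
    have hx' := (mem_cube_part X s Q).1 hx
    exact funext fun S => h2 _ _ _ (hx' S)
  · intro f e k h x hf
    funext S
    have := h3 f e (k + s * (2 * S.card - n)) (h + n - S.card)
      ((x : Finset (Fin n) → X.V) S) hf
    rw [show k + s * (2 * (S.card : ℤ) - n) + e = k + e + s * (2 * S.card - n) by ring] at this
    exact this

/-- A homogeneous boundary is the boundary of a homogeneous element. -/
theorem Splits.exists_of_boundary {X : Cx σ} (hX : X.Splits) {s : ℤ} {n : ℕ}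
    {Q : Fin n → MvPolynomial σ ℚ} (hQ : ∀ c, Deg (Q c) (2 * s + 2)) {k h : ℤ}
    {u : (X.cube s n Q).V} (hu : (X.cube s n Q).d u ∈ (X.cube s n Q).part k h) :
    (X.cube s n Q).d u ∈ (X.cube s n Q).bdry k h := by
  obtain ⟨π, h1, h2, h3⟩ := hX
  -- This is the component of `u` in bidegree `(k - 2, h - 1)`. The entries of the differential are
  -- homogeneous, so taking components commutes with it.
  let u' : Finset (Fin n) → X.V := fun S =>
    π (k - 2 + s * (2 * S.card - n)) (h - 1 + n - S.card) ((u : Finset (Fin n) → X.V) S)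
  refine mem_bdry.2 ⟨u', (mem_cube_part X s Q).2 fun S => h1 _ _ _, funext fun S => ?_⟩
  have hS := h2 _ _ _ ((mem_cube_part X s Q).1 hu S)
  refine Eq.trans ?_ hS
  refine (cube_d_apply X s Q u' S).trans ?_
  have e2 := cube_d_apply X s Q u S
  change _ = π _ _ (((X.cube s n Q).d u : Finset (Fin n) → X.V) S)
  rw [e2, map_sum]
  refine Finset.sum_congr rfl fun c hc => ?_
  have hcard : ((S.erase c).card : ℤ) = S.card - 1 := by
    rw [Finset.card_erase_of_mem hc, Nat.cast_sub (Finset.card_pos.2 ⟨c, hc⟩), Nat.cast_one]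
  have hsign : Deg ((-1 : MvPolynomial σ ℚ) ^ (S.filter (· < c)).card * Q c) (2 * s + 2) := by
    rcases neg_one_pow_eq_or (MvPolynomial σ ℚ) (S.filter (· < c)).card with h | h
    · rw [h, one_mul]
      exact hQ c
    · rw [h, neg_one_mul]
      exact (weightedHomogeneousSubmodule ℚ (fun _ : σ => (2 : ℤ)) _).neg_mem (hQ c)
  have := h3 _ _ (k - 2 + s * (2 * (S.erase c).card - n)) (h - 1 + n - (S.erase c).card)
    ((u : Finset (Fin n) → X.V) (S.erase c)) hsign
  change _ • π (k - 2 + s * (2 * (S.erase c).card - n)) (h - 1 + n - (S.erase c).card)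
    ((u : Finset (Fin n) → X.V) (S.erase c)) = _
  rw [← this, hcard]
  congr 2 <;> ring

end Cx

/-! ### The number of connected components -/

section Components

variable {b : ℕ} (w : BraidGraph b)

theorem cols_lt {s : ℕ} (h : s ∈ cols w) : s + 1 < b := by
  obtain ⟨i, -, rfl⟩ := List.mem_map.1 h
  exact i.2

theorem exists_cut (s : ℕ) : ∃ r, s ≤ r ∧ r ∉ cols w :=
  ⟨max s b, le_max_left _ _, fun h => by have := cols_lt w h; omega⟩

/-- The last strand in the connected component of a strand. -/
def lastStrand (s : ℕ) : ℕ := Nat.find (exists_cut w s)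

theorem lastStrand_spec (s : ℕ) : s ≤ lastStrand w s ∧ lastStrand w s ∉ cols w :=
  Nat.find_spec (exists_cut w s)

theorem lastStrand_of_notMem {s : ℕ} (h : s ∉ cols w) : lastStrand w s = s :=
  (Nat.find_eq_iff _).2 ⟨⟨le_rfl, h⟩, fun r hr h' => by omega⟩

theorem lastStrand_of_mem {s : ℕ} (h : s ∈ cols w) : lastStrand w s = lastStrand w (s + 1) := by
  refine (Nat.find_eq_iff _).2 ⟨⟨(Nat.le_succ s).trans (lastStrand_spec w (s + 1)).1,
    (lastStrand_spec w (s + 1)).2⟩, fun r hr h' => ?_⟩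
  rcases h'.1.eq_or_lt with rfl | h1
  · exact h'.2 h
  · exact Nat.find_min _ hr ⟨h1, h'.2⟩

theorem lastStrand_lt {s : ℕ} (h : s < b) : lastStrand w s < b :=
  (Nat.find_min' (exists_cut w s) ⟨Nat.le_sub_one_of_lt h, fun h' => by
    have := cols_lt w h'; omega⟩).trans_lt (by omega)

theorem get_mem_cols (t : Fin w.length) : (w.get t).1 ∈ cols w :=
  List.mem_map.2 ⟨_, List.get_mem w t, rfl⟩

/-- Adjacent strands are joined exactly at crossings, so a connected component is an interval of
strands that ends at the first column without a crossing. The last strand is therefore an invariant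
of the component. -/
theorem lastStrand_of_meet {e e' : (closure w).Edge} (h : (closure w).Meet e e') :
    lastStrand w e.2 = lastStrand w e'.2 := by
  rcases h with ⟨v, h1, h2⟩ | ⟨t, h1, h2⟩
  · rcases v with ⟨⟨t, s⟩, hs⟩ | s <;> rcases h1 with rfl | rfl <;> rcases h2 with rfl | rfl <;> rfl
  · have ht := lastStrand_of_mem w (get_mem_cols w t)
    rcases h1 with rfl | rfl | rfl | rfl <;> rcases h2 with rfl | rfl | rfl | rfl <;>
      first | rfl | exact ht | exact ht.symm

theorem lastStrand_of_reachable {e e' : (closure w).Edge}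
    (h : (SimpleGraph.fromRel (closure w).Meet).Reachable e e') :
    lastStrand w e.2 = lastStrand w e'.2 := by
  obtain ⟨p⟩ := h
  induction p with
  | nil => rfl
  | cons hadj _ ih =>
    refine Eq.trans ?_ ih
    rcases hadj.2 with h | h
    · exact lastStrand_of_meet w h
    · exact (lastStrand_of_meet w h).symm

theorem reachable_of_meet {D : ClosedGraph} {e e' : D.Edge} (h : D.Meet e e') :
    (SimpleGraph.fromRel D.Meet).Reachable e e' := by
  by_cases he : e = e'
  · rw [he]
  · exact SimpleGraph.Adj.reachable ⟨he, Or.inl h⟩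

theorem reachable_bottom (t : Fin (w.length + 1)) (s : Fin b) :
    (SimpleGraph.fromRel (closure w).Meet).Reachable (t, s) (0, s) := by
  induction t using Fin.induction with
  | zero => rfl
  | succ t ih =>
    refine SimpleGraph.Reachable.trans (reachable_of_meet ?_) ih
    by_cases h1 : s.1 = (w.get t).1
    · have hs : s = ⟨(w.get t).1, Nat.lt_of_succ_lt (w.get t).2⟩ := Fin.ext h1
      rw [hs]
      exact Or.inr ⟨t, Or.inr (Or.inr (Or.inl rfl)), Or.inl rfl⟩
    · by_cases h2 : s.1 = (w.get t).1 + 1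
      · have hs : s = ⟨(w.get t).1 + 1, (w.get t).2⟩ := Fin.ext h2
        rw [hs]
        exact Or.inr ⟨t, Or.inr (Or.inr (Or.inr rfl)), Or.inr (Or.inl rfl)⟩
      · exact Or.inl ⟨Sum.inl ⟨(t, s), h1, h2⟩, Or.inr rfl, Or.inl rfl⟩

theorem reachable_succ {s : ℕ} (h : s ∈ cols w) :
    (SimpleGraph.fromRel (closure w).Meet).Reachable
      ((0, ⟨s, Nat.lt_of_succ_lt (cols_lt w h)⟩) : Fin (w.length + 1) × Fin b)
      ((0, ⟨s + 1, cols_lt w h⟩) : Fin (w.length + 1) × Fin b) := by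
  obtain ⟨i, hi, rfl⟩ := List.mem_map.1 h
  obtain ⟨t, rfl⟩ := List.mem_iff_get.1 hi
  refine (reachable_bottom w t.castSucc _).symm.trans
    (SimpleGraph.Reachable.trans (reachable_of_meet ?_) (reachable_bottom w t.castSucc _))
  exact Or.inr ⟨t, Or.inl rfl, Or.inr (Or.inl rfl)⟩

theorem reachable_lastStrand {s : ℕ} (h : s < b) :
    (SimpleGraph.fromRel (closure w).Meet).Reachable
      ((0, ⟨s, h⟩) : Fin (w.length + 1) × Fin b)
      ((0, ⟨lastStrand w s, lastStrand_lt w h⟩) : Fin (w.length + 1) × Fin b) := by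
  obtain ⟨n, hn⟩ : ∃ n, b - s = n := ⟨_, rfl⟩
  induction n generalizing s with
  | zero => omega
  | succ n ih =>
    by_cases hs : s ∈ cols w
    · have := ih (cols_lt w hs) (by omega)
      have e : (⟨lastStrand w (s + 1), lastStrand_lt w (cols_lt w hs)⟩ : Fin b) =
          ⟨lastStrand w s, lastStrand_lt w h⟩ := Fin.ext (lastStrand_of_mem w hs).symm
      rw [e] at this
      exact (reachable_succ w hs).trans this
    · have e : (⟨lastStrand w s, lastStrand_lt w h⟩ : Fin b) = ⟨s, h⟩ :=
        Fin.ext (lastStrand_of_notMem w hs)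
      rw [e]
      exact SimpleGraph.Reachable.refl _

/-- Each component contains exactly one strand without a crossing to its right, namely its last
strand. -/
theorem card_component : Nat.card (closure w).Component = freeCount w := by
  let F : {s : Fin b // s.1 ∉ cols w} → (closure w).Component := fun s =>
    (SimpleGraph.fromRel (closure w).Meet).connectedComponentMk ((0, s.1) : Fin (w.length + 1) × Fin b)
  have hF : Function.Bijective F := by
    constructor
    · intro s r h
      have := lastStrand_of_reachable w (SimpleGraph.ConnectedComponent.exact h)
      change lastStrand w s.1 = lastStrand w r.1 at this
      rw [lastStrand_of_notMem w s.2, lastStrand_of_notMem w r.2] at this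
      exact Subtype.ext (Fin.ext this)
    · intro C
      induction C using SimpleGraph.ConnectedComponent.ind with
      | h e =>
        obtain ⟨t, s⟩ := e
        refine ⟨⟨⟨_, lastStrand_lt w s.2⟩, (lastStrand_spec w s).2⟩,
          SimpleGraph.ConnectedComponent.sound ?_⟩
        exact (reachable_lastStrand w s.2).symm.trans (reachable_bottom w t s).symm
  rw [← Nat.card_congr (Equiv.ofBijective F hF), Nat.card_eq_fintype_card, Fintype.card_subtype]
  rfl

end Components

end KR


/-! ### Identification of the unreduced complex with a cube -/

namespace KR

open MvPolynomial Cx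

namespace ClosedGraph

theorem dPlus_apply (D : ClosedGraph) (x : D.Chain) (s : D.BasisIndex) :
    D.dPlus x s = ∑ c ∈ s.1, ((-1 : D.EdgeRing) ^ (s.1.filter (· < c)).card * D.quad c) *
      x (s.1.erase c, s.2) := by
  change (∑ c ∈ s.1, ((-1 : D.EdgeRing) ^ (s.1.filter (· < c)).card * D.quad c) •
      LinearMap.proj (R := D.EdgeRing) (φ := fun _ : D.BasisIndex => D.EdgeRing)
        (s.1.erase c, s.2)) x = _
  rw [LinearMap.sum_apply]
  rfl

theorem mem_chainPart (D : ClosedGraph) {x : D.Chain} {i h : ℤ} : x ∈ D.chainPart i h ↔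
    ∀ s, x s ∈ D.edgeRingPart (i - D.qShift s) ∧ (D.grH s = h ∨ x s = 0) := by
  refine Iff.trans ⟨fun hx s => hx s (Set.mem_univ s), fun hx s _ => hx s⟩
    (forall_congr' fun s => ?_)
  change x s ∈ (if D.grH s = h then D.edgeRingPart (i - D.qShift s) else ⊥) ↔ _
  split_ifs with hs
  · simp [hs]
  · rw [Submodule.mem_bot]
    refine ⟨fun h => ⟨h ▸ zero_mem _, Or.inr h⟩, fun h => h.2.resolve_left hs⟩

end ClosedGraph

variable {b : ℕ} (w : BraidGraph b)

/-- The complex over a polynomial ring that is isomorphic to the unreduced complex. -/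
abbrev closureCube : Cx (FreeVar w) :=
  ((base (FreeVar w)).cube 0 (freeCount w) 0).cube 1 w.length
    fun t => rename (freeVar w) (labQuad w t)

/-- A numbering of the connected components. -/
def componentEquiv : (closure w).Component ≃ Fin (freeCount w) :=
  Finite.equivFinOfCardEq (card_component w)

/-- The isomorphism of the unreduced complex with a complex over a polynomial ring. -/
def chainEquiv : (closure w).Chain ≃ₗ[ℚ]
    (Finset (Fin w.length) → Finset (Fin (freeCount w)) → MvPolynomial (FreeVar w) ℚ) where
  toFun x S T := edgeEquiv w (x (S, (componentEquiv w).finsetCongr.symm T))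
  invFun y s := (edgeEquiv w).symm (y s.1 ((componentEquiv w).finsetCongr s.2))
  map_add' x y := funext fun S => funext fun T => map_add (edgeEquiv w) _ _
  map_smul' r x := funext fun S => funext fun T => map_smul (edgeEquiv w) r _
  left_inv x := by
    funext s
    simp only [Equiv.symm_apply_apply, AlgEquiv.symm_apply_apply]
  right_inv y := by
    funext S T
    simp only [Equiv.apply_symm_apply, AlgEquiv.apply_symm_apply]

theorem chainEquiv_apply (x : (closure w).Chain) (S : Finset (Fin w.length))
    (T : Finset (Fin (freeCount w))) : chainEquiv w x S T =
      edgeEquiv w (x (S, (componentEquiv w).finsetCongr.symm T)) := rfl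

theorem chainEquiv_dPlus (x : (closure w).Chain) :
    chainEquiv w ((closure w).dPlus x) = (closureCube w).d (chainEquiv w x) := by
  funext S
  refine Eq.trans ?_ (cube_d_apply ((base (FreeVar w)).cube 0 (freeCount w) 0) 1
    (fun t => rename (freeVar w) (labQuad w t)) (chainEquiv w x) S).symm
  funext T
  have hs := Finset.sum_apply T S fun c => (((-1 : MvPolynomial (FreeVar w) ℚ) ^
    (S.filter (· < c)).card * rename (freeVar w) (labQuad w c)) • chainEquiv w x (S.erase c) :
      Finset (Fin (freeCount w)) → MvPolynomial (FreeVar w) ℚ)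
  refine Eq.trans ?_ hs.symm
  rw [chainEquiv_apply, ClosedGraph.dPlus_apply, map_sum]
  refine Finset.sum_congr rfl fun c _ => ?_
  rw [map_mul, map_mul, map_pow, map_neg, map_one]
  exact congrArg₂ (· * ·) (congrArg₂ (· * ·) rfl (edgeEquiv_quad w c)) rfl

theorem card_finsetCongr_symm (T : Finset (Fin (freeCount w))) :
    ((componentEquiv w).finsetCongr.symm T).card = T.card := by
  simp

theorem chainEquiv_mem_part (x : (closure w).Chain) (i h : ℤ) :
    chainEquiv w x ∈ (closureCube w).part i h ↔ x ∈ (closure w).chainPart i h := by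
  refine (mem_cube_part _ _ _).trans (Iff.trans ?_ ((closure w).mem_chainPart).symm)
  have key : ∀ (S : Finset (Fin w.length)) (T : Finset (Fin (freeCount w))),
      chainEquiv w x S T ∈ (base (FreeVar w)).part (i + 1 * (2 * S.card - w.length) +
        0 * (2 * T.card - freeCount w)) (h + w.length - S.card + freeCount w - T.card) ↔
      x (S, (componentEquiv w).finsetCongr.symm T) ∈ (closure w).edgeRingPart
        (i - (closure w).qShift (S, (componentEquiv w).finsetCongr.symm T)) ∧
      ((closure w).grH (S, (componentEquiv w).finsetCongr.symm T) = h ∨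
        x (S, (componentEquiv w).finsetCongr.symm T) = 0) := by
    intro S T
    refine mem_basePart.trans ?_
    rw [chainEquiv_apply, deg_edgeEquiv, ClosedGraph.qShift, ClosedGraph.grH, card_component,
      card_finsetCongr_symm, EmbeddingLike.map_eq_zero_iff]
    refine and_congr (Iff.of_eq (congrArg (fun z => x (S, (componentEquiv w).finsetCongr.symm T) ∈
      (closure w).edgeRingPart z) ?_)) (or_congr ?_ Iff.rfl)
    · change i + 1 * (2 * (S.card : ℤ) - w.length) + 0 * (2 * T.card - freeCount w) =
        i - ((w.length : ℤ) - 2 * S.card)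
      ring
    · change h + w.length - S.card + freeCount w - T.card = 0 ↔
        (S.card : ℤ) - w.length + (T.card - freeCount w) = h
      omega
  constructor
  · rintro hx ⟨S, T⟩
    obtain ⟨T, rfl⟩ := (componentEquiv w).finsetCongr.symm.surjective T
    exact (key S T).1 ((mem_cube_part _ _ _).1 (hx S) T)
  · exact fun hx S => (mem_cube_part _ _ _).2 fun T => (key S T).2 (hx _)

/-- This links the homology of the theorem with the Koszul homology for which the MOY relations are
proved. -/
theorem rank_homology (i h : ℤ) :
    Module.rank ℚ ((closure w).Homology i h) = hh b (cols w) i h := by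
  rw [hh_eq_hrank_cube]
  have hQ : ∀ t, Deg (rename (freeVar w) (labQuad w t)) (2 * 1 + 2) :=
    fun t => graded_rename _ _ _ (deg_labQuad w t)
  have hc : ∀ v, chainEquiv w v ∈ (closureCube w).cyc i h ↔ v ∈ (closure w).cycles i h := by
    intro v
    refine mem_cyc.trans (Iff.trans (and_congr ?_ (chainEquiv_mem_part w v i h))
      Submodule.mem_inf.symm)
    rw [← chainEquiv_dPlus]
    exact (chainEquiv w).map_eq_zero_iff
  refine rank_subquotient_eq (chainEquiv w) hc fun v hv => ?_
  constructor
  · intro hb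
    obtain ⟨u, -, hu⟩ := mem_bdry.1 hb
    refine ⟨(chainEquiv w).symm u, (chainEquiv w).injective ?_⟩
    rw [chainEquiv_dPlus]
    exact (congrArg _ ((chainEquiv w).apply_symm_apply u)).trans hu
  · rintro ⟨u, rfl⟩
    have h1 := (mem_cyc.1 ((hc _).2 hv)).2
    rw [chainEquiv_dPlus] at h1 ⊢
    -- `Homology` divides by arbitrary boundaries, the Koszul homology only by boundaries of
    -- homogeneous chains. Projection to homogeneous components shows that a homogeneous boundary is
    -- of the latter kind.
    exact (splits_base.cube 0 0).exists_of_boundary hQ h1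

end KR


namespace KR

/-! ### The MOY relations determine an invariant -/

/-- The MOY relations for a function with values in a vector space over `ℚ(a, q)`. -/
structure MOYRelations {M : Type} [AddCommGroup M] [Module QAQ M]
    (P : (b : ℕ) → BraidGraph b → M) : Prop where
  slide : ∀ (b : ℕ) (u v : BraidGraph b) (i j : Column b), i.1 + 1 < j.1 →
    P b (u ++ [i, j] ++ v) = P b (u ++ [j, i] ++ v)
  relO : ∀ (b : ℕ) (w : BraidGraph b),
    P (b + 1) (w.map widen) = ((a - a⁻¹) / (q - q⁻¹)) • P b w
  relI : ∀ (b : ℕ) (u v : BraidGraph (b + 1)),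
    P (b + 2) (u.map widen ++ [lastColumn b] ++ v.map widen) =
      ((a * q⁻¹ - a⁻¹ * q) / (q - q⁻¹)) • P (b + 1) (u ++ v)
  relII : ∀ (b : ℕ) (u v : BraidGraph b) (i : Column b),
    P b (u ++ [i, i] ++ v) = (q + q⁻¹) • P b (u ++ [i] ++ v)
  relIII : ∀ (b : ℕ) (u v : BraidGraph b) (i j : Column b), j.1 = i.1 + 1 →
    P b (u ++ [j, i, j] ++ v) + P b (u ++ [i] ++ v) =
      P b (u ++ [i, j, i] ++ v) + P b (u ++ [j] ++ v)

namespace MOYRelations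

variable {M : Type} [AddCommGroup M] [Module QAQ M] {P : (b : ℕ) → BraidGraph b → M}

/-- The words in the columns below `m - 1`, and those in the columns below `m` that contain the
column `m - 1` once. -/
def reducedWords (b m : ℕ) : Set (BraidGraph b) :=
  {s | ∀ c ∈ s, c.1 + 1 < m} ∪
    {s | ∃ p c r, s = p ++ [c] ++ r ∧ c.1 + 1 = m ∧ (∀ c ∈ p, c.1 + 1 < m) ∧ ∀ c ∈ r, c.1 + 1 < m}

/-- In every context the values on `w` are determined by those on `S`. -/
def Reduces (P : (b : ℕ) → BraidGraph b → M) (N : Submodule QAQ M) {b : ℕ} (w : BraidGraph b)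
    (S : Set (BraidGraph b)) : Prop :=
  ∀ u v, (∀ s ∈ S, P b (u ++ s ++ v) ∈ N) → P b (u ++ w ++ v) ∈ N

variable {N : Submodule QAQ M} {b : ℕ}

theorem reduces_of_mem {w : BraidGraph b} {S : Set (BraidGraph b)} (h : w ∈ S) : Reduces P N w S :=
  fun _ _ hS => hS w h

theorem Reduces.trans {w : BraidGraph b} {S T : Set (BraidGraph b)} {p r : BraidGraph b}
    (h : Reduces P N w S) (hS : ∀ s ∈ S, Reduces P N (p ++ s ++ r) T) :
    Reduces P N (p ++ w ++ r) T := by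
  intro u v hT
  have := h (u ++ p) (r ++ v) fun s hs => by
    have := hS s hs u v hT
    simpa only [List.append_assoc] using this
  simpa only [List.append_assoc] using this

theorem slide_word (h : MOYRelations P) {j : Column b} {s : BraidGraph b}
    (hs : ∀ c ∈ s, c.1 + 1 < j.1) (u v : BraidGraph b) :
    P b (u ++ ([j] ++ s) ++ v) = P b (u ++ (s ++ [j]) ++ v) := by
  induction s generalizing u with
  | nil => rfl
  | cons c s ih =>
    have h1 := h.slide b u (s ++ v) c j (hs c (by simp))
    have h2 := ih (fun c' hc' => hs c' (by simp [hc'])) (u ++ [c])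
    simp only [List.append_assoc, List.cons_append, List.nil_append] at h1 h2 ⊢
    rw [← h1, h2]

/-- If `s` avoids the column next to `j`, the first `j` slides through `s` and relation II merges
the two. Otherwise `s = p i r` with `i` next to `j`; the outer letters slide past `p` and `r`, and
relation III turns `j i j` into `i j i + j - i`. In every term `j` occurs at most once. -/
theorem reduces_double (h : MOYRelations P) {m : ℕ} {x s : BraidGraph b} {j : Column b}
    (hj : j.1 = m) (hx : ∀ c ∈ x, c.1 < m) (hs : s ∈ reducedWords b m) :
    Reduces P N (x ++ [j] ++ s ++ [j]) (reducedWords b (m + 1)) := by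
  intro u v hS
  rcases hs with hs | ⟨p, i, r, rfl, hi, hp, hr⟩
  · have h1 := slide_word h (j := j) (s := s) (fun c hc => hj ▸ hs c hc) (u ++ x) ([j] ++ v)
    have h2 := h.relII b (u ++ x ++ s) v j
    have h3 := hS (x ++ s ++ [j]) (Or.inr ⟨x ++ s, j, [], by simp, by omega, fun c hc => ?_, by simp⟩)
    · simp only [List.append_assoc, List.cons_append, List.nil_append] at h1 h2 h3 ⊢
      rw [h1, h2]
      exact N.smul_mem _ h3
    · rcases List.mem_append.1 hc with hc | hc
      · exact Nat.succ_lt_succ (hx c hc)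
      · exact (hs c hc).trans (Nat.lt_succ_self m)
  · have h1 := slide_word h (j := j) (s := p) (fun c hc => hj ▸ hp c hc) (u ++ x)
      ([i] ++ r ++ [j] ++ v)
    have h2 := slide_word h (j := j) (s := r) (fun c hc => hj ▸ hr c hc) (u ++ x ++ p ++ [j] ++ [i]) v
    have h3 := h.relIII b (u ++ x ++ p) (r ++ v) i j (by omega)
    have hxp : ∀ c ∈ x ++ p, c.1 + 1 < m + 1 := fun c hc => by
      rcases List.mem_append.1 hc with hc | hc
      · exact Nat.succ_lt_succ (hx c hc)
      · exact (hp c hc).trans (Nat.lt_succ_self m)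
    have hr' : ∀ c ∈ r, c.1 + 1 < m + 1 := fun c hc => (hr c hc).trans (Nat.lt_succ_self m)
    have hi' : i.1 + 1 < m + 1 := by omega
    have h4 := hS (x ++ p ++ [i] ++ r) (Or.inl fun c hc => ?_)
    have h5 := hS (x ++ p ++ [j] ++ r) (Or.inr ⟨x ++ p, j, r, rfl, by omega, hxp, hr'⟩)
    have h6 := hS (x ++ p ++ [i] ++ [j] ++ ([i] ++ r)) (Or.inr ⟨x ++ p ++ [i], j, [i] ++ r, rfl,
      by omega, fun c hc => ?_, fun c hc => ?_⟩)
    · simp only [List.append_assoc, List.cons_append, List.nil_append] at h1 h2 h3 h4 h5 h6 ⊢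
      rw [h1, ← h2, eq_sub_of_add_eq h3]
      exact N.sub_mem (N.add_mem h6 h5) h4
    · rcases List.mem_append.1 hc with hc | hc
      · exact hxp c hc
      · rw [List.mem_singleton.1 hc]
        exact hi'
    · rcases List.mem_append.1 hc with hc | hc
      · rw [List.mem_singleton.1 hc]
        exact hi'
      · exact hr' c hc
    · rcases List.mem_append.1 hc with hc | hc
      · rcases List.mem_append.1 hc with hc | hc
        · exact hxp c hc
        · rw [List.mem_singleton.1 hc]
          exact hi'
      · exact hr' c hc

/-- Induction on the number of columns and on the word, one letter being appended at a time. The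
only problem is a second letter in the highest column: the word between the two occurrences lies in
lower columns, is reduced by the induction on `m`, and then `reduces_double` applies. -/
theorem reduces_reducedWords (h : MOYRelations P) (m : ℕ) {w : BraidGraph b}
    (hw : ∀ c ∈ w, c.1 < m) : Reduces P N w (reducedWords b m) := by
  induction m generalizing w with
  | zero =>
    refine reduces_of_mem (Or.inl fun c hc => ?_)
    exact absurd (hw c hc) (Nat.not_lt_zero _)
  | succ m ihm =>
    induction w using List.reverseRecOn with
    | nil => exact reduces_of_mem (Or.inl (by simp))
    | append_singleton w c ih =>
      have hc := hw c (by simp)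
      have key : ∀ s ∈ reducedWords b (m + 1),
          Reduces P N ([] ++ s ++ [c]) (reducedWords b (m + 1)) := by
        intro s hs
        rcases Nat.lt_succ_iff_lt_or_eq.1 hc with hc | hc
        · refine reduces_of_mem ?_
          rcases hs with hs | ⟨p, i, r, rfl, hi, hp, hr⟩
          · refine Or.inl fun c' hc' => ?_
            rcases List.mem_append.1 hc' with hc' | hc'
            · exact hs c' hc'
            · rw [List.mem_singleton.1 hc']
              exact Nat.succ_lt_succ hc
          · refine Or.inr ⟨p, i, r ++ [c], by simp, hi, hp, fun c' hc' => ?_⟩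
            rcases List.mem_append.1 hc' with hc' | hc'
            · exact hr c' hc'
            · rw [List.mem_singleton.1 hc']
              exact Nat.succ_lt_succ hc
        · rcases hs with hs | ⟨p, i, r, rfl, hi, hp, hr⟩
          · exact reduces_of_mem (Or.inr ⟨s, c, [], by simp, by omega, hs, by simp⟩)
          · have hic : i = c := Subtype.ext (by omega)
            subst hic
            refine (ihm (w := r) fun c hc => Nat.lt_of_succ_lt_succ (hr c hc)).trans
              (p := p ++ [i]) (r := [i]) fun s hs => ?_
            exact reduces_double h hc (fun c hc => Nat.lt_of_succ_lt_succ (hp c hc)) hs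
      exact (ih fun c hc => hw c (by simp [hc])).trans key

theorem exists_map_widen {w : BraidGraph (b + 1)} (hw : ∀ c ∈ w, c.1 + 1 < b) :
    ∃ w' : BraidGraph b, w'.map widen = w := by
  induction w with
  | nil => exact ⟨[], rfl⟩
  | cons c w ih =>
    obtain ⟨w', rfl⟩ := ih fun c hc => hw c (by simp [hc])
    exact ⟨⟨c.1, hw c (by simp)⟩ :: w', rfl⟩

/-- All values of an invariant that satisfies the MOY relations are multiples of its value on the
empty graph. -/
theorem mem (h : MOYRelations P) (h0 : P 0 [] ∈ N) : ∀ (b : ℕ) (w : BraidGraph b), P b w ∈ N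
  | 0, w => by
    cases w with
    | nil => exact h0
    | cons c w => exact absurd c.2 (Nat.not_lt_zero _)
  | b + 1, w => by
    -- On `b + 1` strands the last column is `b - 1`. A reduced word without it leaves the last
    -- strand free, so relation O applies; a reduced word that contains it once is of the form
    -- required by relation I.
    have hr := reduces_reducedWords (N := N) h b (w := w) (fun c _ => Nat.lt_of_succ_lt_succ c.2)
      [] [] fun s hs => ?_
    · simpa using hr
    rw [List.nil_append, List.append_nil]
    rcases hs with hs | ⟨p, i, r, rfl, hi, hp, hr⟩
    · obtain ⟨s, rfl⟩ := exists_map_widen hs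
      rw [h.relO]
      exact N.smul_mem _ (mem h h0 b s)
    · obtain ⟨p, rfl⟩ := exists_map_widen hp
      obtain ⟨r, rfl⟩ := exists_map_widen hr
      obtain ⟨b, rfl⟩ : ∃ b', b = b' + 1 := ⟨i.1, hi.symm⟩
      have e : i = lastColumn b := Subtype.ext (Nat.succ_injective hi)
      rw [e, h.relI]
      exact N.smul_mem _ (mem h h0 (b + 1) (p ++ r))

end MOYRelations

/-- The relations are linear, so the difference of two solutions satisfies them too. It vanishes on
the empty graph, hence everywhere by `MOYRelations.mem` with the zero subspace. -/
theorem IsMOYHomfly.unique {P P' : (b : ℕ) → BraidGraph b → QAQ} (h : IsMOYHomfly P)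
    (h' : IsMOYHomfly P') : P = P' := by
  have hd : MOYRelations fun b w => P b w - P' b w := by
    refine ⟨fun b u v i j hij => ?_, fun b w => ?_, fun b u v => ?_, fun b u v i => ?_,
      fun b u v i j hij => ?_⟩
    · rw [h.slide b u v i j hij, h'.slide b u v i j hij]
    · rw [h.relO, h'.relO, smul_eq_mul, mul_sub]
    · rw [h.relI, h'.relI, smul_eq_mul, mul_sub]
    · rw [h.relII, h'.relII, smul_eq_mul, mul_sub]
    · rw [sub_add_sub_comm, sub_add_sub_comm, h.relIII b u v i j hij, h'.relIII b u v i j hij]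
  funext b w
  have := hd.mem (N := ⊥) (by rw [h.empty, h'.empty, sub_self]; exact zero_mem _) b w
  exact sub_eq_zero.1 ((Submodule.mem_bot QAQ).1 this)

end KR


namespace KR

open Cx

/-! ### The Poincaré series of closed braid graphs -/

section Expand

open scoped RatFunc

/-- The expansion of rational functions as a ring homomorphism. -/
def expandHom : QAQ →+* (RatFunc ℚ)⸨X⸩ := algebraMap QAQ (RatFunc ℚ)⸨X⸩

theorem expandHom_apply (f : QAQ) : expandHom f = expand f := rfl

theorem expandHom_q : expandHom q = HahnSeries.single 1 1 := RatFunc.coe_X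

theorem expandHom_C (c : RatFunc ℚ) : expandHom (RatFunc.C c) = HahnSeries.C c := by
  rw [← RatFunc.algebraMap_C]
  refine (IsScalarTower.algebraMap_apply (Polynomial (RatFunc ℚ)) QAQ (RatFunc ℚ)⸨X⸩ _).symm.trans ?_
  rw [Polynomial.algebraMap_hahnSeries_apply, Polynomial.coe_C, HahnSeries.ofPowerSeries_C]

end Expand

/-- The weight of the homological degree `1` in the signed Poincaré series. -/
def alpha : RatFunc ℚ := -(a₀ ^ 2)

theorem a₀_ne_zero : a₀ ≠ 0 := RatFunc.X_ne_zero

theorem alpha_ne_zero : alpha ≠ 0 := neg_ne_zero.2 (pow_ne_zero 2 a₀_ne_zero)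

theorem alpha_zpow (h : ℤ) : alpha ^ h = (-1) ^ h * a₀ ^ (2 * h) := by
  rw [alpha, neg_eq_neg_one_mul, mul_zpow, zpow_mul]
  rfl

variable {b : ℕ}

/-- The dimension of the homology as an element of the field of coefficients. -/
def dimK (w : BraidGraph b) (i h : ℤ) : RatFunc ℚ := (Cardinal.toNat (hh b (cols w) i h) : RatFunc ℚ)

theorem hh_lt_aleph0 (w : BraidGraph b) (i h : ℤ) : hh b (cols w) i h < Cardinal.aleph0 := by
  have := (closure w).finite_homology i h
  rw [← rank_homology]
  exact Module.rank_lt_aleph0 _ _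

theorem toNat_hh (w : BraidGraph b) (i h : ℤ) :
    Cardinal.toNat (hh b (cols w) i h) = Module.finrank ℚ ((closure w).Homology i h) := by
  rw [← rank_homology]
  rfl

/-- The coefficients of the signed Poincaré series. -/
def coefK (w : BraidGraph b) (i : ℤ) : RatFunc ℚ := ∑ᶠ h : ℤ, alpha ^ h * dimK w i h

theorem coeff_poincare (w : BraidGraph b) (i : ℤ) :
    (poincare (closure w)).coeff i = coefK w i := by
  refine finsum_congr fun h => ?_
  rw [alpha_zpow, dimK, toNat_hh]

theorem finite_support_dimK (w : BraidGraph b) (i : ℤ) :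
    Function.HasFiniteSupport fun h : ℤ => alpha ^ h * dimK w i h := by
  refine (closure w).finite_support_homology.subset fun h hh => ⟨i, ?_⟩
  by_contra hn
  rw [not_nontrivial_iff_subsingleton] at hn
  refine hh ?_
  have : dimK w i h = 0 := by
    rw [dimK, toNat_hh, Module.finrank_zero_of_subsingleton, Nat.cast_zero]
  change alpha ^ h * dimK w i h = 0
  rw [this, mul_zero]

theorem alpha_zpow_mul_dimK_succ (w : BraidGraph b) (i h : ℤ) :
    alpha ^ h * dimK w i (h + 1) = alpha⁻¹ * (alpha ^ (h + 1) * dimK w i (h + 1)) := by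
  rw [zpow_add_one₀ alpha_ne_zero]
  field_simp [alpha_ne_zero]

theorem finite_support_dimK_succ (w : BraidGraph b) (i : ℤ) :
    Function.HasFiniteSupport fun h : ℤ => alpha ^ h * dimK w i (h + 1) := by
  refine ((finite_support_dimK w i).preimage (f := fun h : ℤ => h + 1)
    (add_left_injective 1).injOn).subset fun h hh => ?_
  intro h0
  refine hh ?_
  change alpha ^ (h + 1) * dimK w i (h + 1) = 0 at h0
  change alpha ^ h * dimK w i (h + 1) = 0
  rw [alpha_zpow_mul_dimK_succ, h0, mul_zero]

/-- Lowering the homological degree by one divides the weight by `alpha`; this is how the source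
generators in the cones enter the series. -/
theorem finsum_dimK_succ (w : BraidGraph b) (i : ℤ) :
    ∑ᶠ h : ℤ, alpha ^ h * dimK w i (h + 1) = alpha⁻¹ * coefK w i := by
  refine (finsum_congr fun h => alpha_zpow_mul_dimK_succ w i h).trans ?_
  rw [← mul_finsum]
  exact congrArg _ (finsum_comp_equiv (Equiv.addRight (1 : ℤ)) (f := fun h => alpha ^ h * dimK w i h))

theorem cols_append (u v : BraidGraph b) : cols (u ++ v) = cols u ++ cols v := List.map_append

theorem cols_map_widen (w : BraidGraph b) : cols (w.map widen) = cols w := by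
  rw [cols, cols, List.map_map]
  rfl

theorem hh_cols_rotate (u v : BraidGraph b) (k m : ℤ) :
    hh b (cols (u ++ v)) k m = hh b (cols (v ++ u)) k m := by
  rw [cols_append, cols_append]
  exact hh_rotate _ _ (fun j hj => cols_lt u hj) k m

theorem poincare_congr {w w' : BraidGraph b} (h : ∀ k m, hh b (cols w) k m = hh b (cols w') k m) :
    poincare (closure w) = poincare (closure w') := by
  ext i
  rw [coeff_poincare, coeff_poincare]
  exact finsum_congr fun m => by rw [dimK, dimK, h]

theorem poincare_rotate (u v : BraidGraph b) :
    poincare (closure (u ++ v)) = poincare (closure (v ++ u)) :=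
  poincare_congr (hh_cols_rotate u v)

/-- Rotation brings any part of the word to the end, so it suffices to know the relations for the
last crossings of a word. -/
theorem poincare_context (u x v : BraidGraph b) :
    poincare (closure (u ++ x ++ v)) = poincare (closure (v ++ u ++ x)) := by
  rw [poincare_rotate, List.append_assoc]

theorem poincare_slide (u v : BraidGraph b) {i j : Column b} (hij : i.1 + 1 < j.1) :
    poincare (closure (u ++ [i, j] ++ v)) = poincare (closure (u ++ [j, i] ++ v)) := by
  rw [poincare_context u [i, j] v, poincare_context u [j, i] v]
  refine poincare_congr fun k m => ?_
  rw [cols_append _ [i, j], cols_append _ [j, i]]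
  exact hh_slide_last _ hij k m

theorem poincare_relII (u v : BraidGraph b) (i : Column b) :
    poincare (closure (u ++ [i, i] ++ v)) =
      (HahnSeries.single 1 1 + HahnSeries.single (-1) 1) * poincare (closure (u ++ [i] ++ v)) := by
  rw [poincare_context u [i, i] v, poincare_context u [i] v]
  have hd : ∀ k m, dimK (v ++ u ++ [i, i]) k m =
      dimK (v ++ u ++ [i]) (k + 1) m + dimK (v ++ u ++ [i]) (k - 1) m := by
    intro k m
    have h := hh_double (b := b) (cols (v ++ u)) (i := i.1) (Nat.lt_of_succ_lt i.2) k m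
    have e1 : cols (v ++ u) ++ [i.1] ++ [i.1] = cols (v ++ u ++ [i, i]) := by simp [cols]
    have e2 : cols (v ++ u) ++ [i.1] = cols (v ++ u ++ [i]) := by simp [cols]
    rw [e1, e2] at h
    rw [dimK, h, Cardinal.toNat_add (hh_lt_aleph0 _ _ _) (hh_lt_aleph0 _ _ _), Nat.cast_add]
    rfl
  ext k
  rw [add_mul, HahnSeries.coeff_add, HahnSeries.coeff_single_mul, HahnSeries.coeff_single_mul,
    one_mul, one_mul, coeff_poincare, coeff_poincare, coeff_poincare, coefK, add_comm, coefK, coefK,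
    ← finsum_add_distrib (finite_support_dimK _ _) (finite_support_dimK _ _)]
  refine finsum_congr fun m => ?_
  rw [hd, mul_add, sub_neg_eq_add]

theorem poincare_relIII (u v : BraidGraph b) {i j : Column b} (hij : j.1 = i.1 + 1) :
    poincare (closure (u ++ [j, i, j] ++ v)) + poincare (closure (u ++ [i] ++ v)) =
      poincare (closure (u ++ [i, j, i] ++ v)) + poincare (closure (u ++ [j] ++ v)) := by
  rw [poincare_context u [j, i, j] v, poincare_context u [i] v, poincare_context u [i, j, i] v,
    poincare_context u [j] v]
  have hd : ∀ k m, dimK (v ++ u ++ [j, i, j]) k m + dimK (v ++ u ++ [i]) k m =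
      dimK (v ++ u ++ [i, j, i]) k m + dimK (v ++ u ++ [j]) k m := by
    intro k m
    obtain ⟨z, h1, h2⟩ := hh_triple (b := b) (cols (v ++ u)) (i := i.1) (hij ▸ Nat.lt_of_succ_lt j.2)
      k m
    rw [← hij] at h1 h2
    have e1 : cols (v ++ u) ++ [i.1] ++ [j.1] ++ [i.1] = cols (v ++ u ++ [i, j, i]) := by simp [cols]
    have e2 : cols (v ++ u) ++ [j.1] ++ [i.1] ++ [j.1] = cols (v ++ u ++ [j, i, j]) := by simp [cols]
    have e3 : cols (v ++ u) ++ [i.1] = cols (v ++ u ++ [i]) := by simp [cols]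
    have e4 : cols (v ++ u) ++ [j.1] = cols (v ++ u ++ [j]) := by simp [cols]
    rw [e1, e3] at h1
    rw [e2, e4] at h2
    -- The common remainder is a summand of a finite dimension, hence finite, and cardinal addition
    -- turns into addition of natural numbers.
    have hz : z < Cardinal.aleph0 :=
      lt_of_le_of_lt (self_le_add_left z _) (h1 ▸ hh_lt_aleph0 (v ++ u ++ [i, j, i]) k m)
    simp only [dimK]
    rw [h1, h2, Cardinal.toNat_add (hh_lt_aleph0 _ _ _) hz,
      Cardinal.toNat_add (hh_lt_aleph0 _ _ _) hz]
    push_cast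
    ring
  ext k
  rw [HahnSeries.coeff_add, HahnSeries.coeff_add, coeff_poincare, coeff_poincare, coeff_poincare,
    coeff_poincare, coefK, coefK, coefK, coefK,
    ← finsum_add_distrib (finite_support_dimK _ _) (finite_support_dimK _ _),
    ← finsum_add_distrib (finite_support_dimK _ _) (finite_support_dimK _ _)]
  refine finsum_congr fun m => ?_
  rw [← mul_add, hd, mul_add]

/-- Multiplication by `1 - q ^ 2` turns the recursion of `hh_add_strand` in the `q`-degree into a
closed identity of series. -/
theorem poincare_relO (w : BraidGraph b) :
    (1 - HahnSeries.single 2 1) * poincare (closure (w.map widen)) =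
      HahnSeries.C (1 + alpha⁻¹) * poincare (closure w) := by
  have hd : ∀ k m, dimK (w.map widen) k m =
      dimK w k m + dimK w k (m + 1) + dimK (w.map widen) (k - 2) m := by
    intro k m
    have h := hh_add_strand (cols w) (fun i hi => cols_lt w hi) k m
    have h' := hh_lt_aleph0 (w.map widen) (k - 2) m
    rw [cols_map_widen] at h'
    simp only [dimK]
    rw [cols_map_widen, h, Cardinal.toNat_add (Cardinal.add_lt_aleph0 (hh_lt_aleph0 _ _ _)
      (hh_lt_aleph0 _ _ _)) h', Cardinal.toNat_add (hh_lt_aleph0 _ _ _) (hh_lt_aleph0 _ _ _)]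
    push_cast
    rfl
  ext k
  rw [sub_mul, one_mul, HahnSeries.coeff_sub, HahnSeries.coeff_single_mul, one_mul,
    HahnSeries.C_mul_eq_smul, HahnSeries.coeff_smul, coeff_poincare, coeff_poincare, coeff_poincare,
    sub_eq_iff_eq_add, smul_eq_mul, add_mul, one_mul, ← finsum_dimK_succ, coefK, coefK, coefK,
    ← finsum_add_distrib (finite_support_dimK _ _) (finite_support_dimK_succ _ _),
    ← finsum_add_distrib _ (finite_support_dimK _ _)]
  · refine finsum_congr fun m => ?_
    rw [hd]
    ring
  · exact ((finite_support_dimK _ _).union (finite_support_dimK_succ _ _)).subset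
      (Function.support_add _ _)

theorem poincare_relI (u v : BraidGraph (b + 1)) :
    (1 - HahnSeries.single 2 1) *
        poincare (closure (u.map widen ++ [lastColumn b] ++ v.map widen)) =
      (HahnSeries.single 1 alpha⁻¹ + HahnSeries.single (-1) 1) * poincare (closure (u ++ v)) := by
  rw [poincare_context, poincare_rotate u v, ← List.map_append]
  generalize v ++ u = w
  have e : cols (w.map widen ++ [lastColumn b]) = cols w ++ [b] := by
    rw [cols_append, cols_map_widen]
    rfl
  have hd : ∀ k m, dimK (w.map widen ++ [lastColumn b]) k m =
      dimK w (k - 1) (m + 1) + dimK w (k + 1) m +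
        dimK (w.map widen ++ [lastColumn b]) (k - 2) m := by
    intro k m
    have h := hh_add_crossing (cols w) (fun i hi => cols_lt w hi) k m
    have h' := hh_lt_aleph0 (w.map widen ++ [lastColumn b]) (k - 2) m
    rw [e] at h'
    simp only [dimK]
    rw [e, h, Cardinal.toNat_add (Cardinal.add_lt_aleph0 (hh_lt_aleph0 _ _ _)
      (hh_lt_aleph0 _ _ _)) h', Cardinal.toNat_add (hh_lt_aleph0 _ _ _) (hh_lt_aleph0 _ _ _)]
    push_cast
    rfl
  ext k
  rw [sub_mul, one_mul, HahnSeries.coeff_sub, HahnSeries.coeff_single_mul, one_mul, add_mul,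
    HahnSeries.coeff_add, HahnSeries.coeff_single_mul, HahnSeries.coeff_single_mul, one_mul,
    coeff_poincare, coeff_poincare, coeff_poincare, coeff_poincare,
    sub_eq_iff_eq_add, ← finsum_dimK_succ, coefK, coefK, coefK,
    ← finsum_add_distrib (finite_support_dimK_succ _ _) (finite_support_dimK _ _),
    ← finsum_add_distrib _ (finite_support_dimK _ _)]
  · refine finsum_congr fun m => ?_
    rw [hd, sub_neg_eq_add]
    ring
  · exact ((finite_support_dimK_succ _ _).union (finite_support_dimK _ _)).subset
      (Function.support_add _ _)

theorem hrank_base_of_isEmpty (σ : Type) [IsEmpty σ] (k m : ℤ) :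
    (base σ).hrank k m = if k = 0 ∧ m = 0 then 1 else 0 := by
  have hC : ∀ v : MvPolynomial σ ℚ, Deg v 0 := fun v => by
    obtain ⟨c, rfl⟩ := MvPolynomial.C_surjective _ v
    exact MvPolynomial.isWeightedHomogeneous_C _ _
  have hcyc : (base σ).cyc k m = basePart σ k m := by
    ext v
    refine mem_cyc.trans ⟨fun h => h.2, fun h => ⟨rfl, h⟩⟩
  split_ifs with h
  · obtain ⟨rfl, rfl⟩ := h
    have htop : (base σ).cyc 0 0 = ⊤ := by
      rw [hcyc]
      exact eq_top_iff.2 fun v _ => mem_basePart.2 ⟨hC v, Or.inl rfl⟩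
    have hbot : ((base σ).bdry 0 0).comap ((base σ).cyc 0 0).subtype = ⊥ := by
      refine (Submodule.eq_bot_iff _).2 fun v hv => ?_
      obtain ⟨w, -, hw⟩ := mem_bdry.1 hv
      exact Subtype.ext hw.symm
    refine ((Submodule.quotEquivOfEqBot _ hbot).trans (LinearEquiv.ofTop _ htop)).rank_eq.trans ?_
    exact (MvPolynomial.isEmptyAlgEquiv ℚ σ).toLinearEquiv.rank_eq.trans (Module.rank_self ℚ)
  · have hbot : (base σ).cyc k m = ⊥ := by
      rw [hcyc]
      refine (Submodule.eq_bot_iff _).2 fun v hv => ?_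
      rw [mem_basePart] at hv
      rcases hv.2 with hm | hv0
      · by_contra hv0
        exact h ⟨hv.1.inj_right hv0 (hC v), hm⟩
      · exact hv0
    have : Subsingleton ((base σ).cyc k m) := by
      rw [hbot]
      infer_instance
    have : Subsingleton ((base σ).cyc k m ⧸ ((base σ).bdry k m).comap ((base σ).cyc k m).subtype) :=
      (Submodule.mkQ_surjective _).subsingleton
    exact rank_subsingleton' _ _

theorem hh_empty (k m : ℤ) : hh 0 [] k m = if k = 0 ∧ m = 0 then 1 else 0 :=
  have : IsEmpty (Fin 0 ⊕ Fin ([] : List ℕ).length) := inferInstanceAs (IsEmpty (Fin 0 ⊕ Fin 0))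
  hrank_base_of_isEmpty _ k m

theorem poincare_empty : poincare (closure ([] : BraidGraph 0)) = 1 := by
  have hd : ∀ k m, dimK ([] : BraidGraph 0) k m = if k = 0 ∧ m = 0 then 1 else 0 := by
    intro k m
    have := hh_empty k m
    rw [dimK]
    change ((Cardinal.toNat (hh 0 [] k m) : ℕ) : RatFunc ℚ) = _
    rw [this]
    split_ifs <;> simp
  ext k
  rw [coeff_poincare, HahnSeries.coeff_one, coefK, finsum_eq_single _ 0]
  · rw [hd]
    simp
  · intro m hm
    rw [hd, if_neg (fun h => hm h.2), mul_zero]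

end KR


namespace KR

/-! ### The HOMFLY polynomial as a Poincaré series -/

theorem expandHom_injective : Function.Injective expandHom := expandHom.injective

theorem q_ne_zero : q ≠ 0 := RatFunc.X_ne_zero

theorem a_ne_zero : a ≠ 0 := (map_ne_zero RatFunc.C).2 a₀_ne_zero

theorem expandHom_q_inv : expandHom q⁻¹ = HahnSeries.single (-1) 1 := by
  rw [map_inv₀, expandHom_q, HahnSeries.inv_single, inv_one]

theorem expandHom_q_sq : expandHom (q ^ 2) = HahnSeries.single 2 1 := by
  rw [map_pow, expandHom_q, HahnSeries.single_pow, one_pow]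
  rfl

theorem q_sq_ne_one : 1 - q ^ 2 ≠ 0 := by
  intro h
  have h1 := congrArg (fun f => (expandHom f).coeff 0) h
  simp only [map_sub, map_one, expandHom_q_sq, map_zero] at h1
  simp at h1

theorem alpha_inv : alpha⁻¹ = -(a₀ ^ 2)⁻¹ := by rw [alpha, inv_neg]

theorem expandHom_circle : expandHom (1 - (a ^ 2)⁻¹) = HahnSeries.C (1 + alpha⁻¹) := by
  rw [← expandHom_C, alpha_inv, a]
  simp [sub_eq_add_neg]

theorem expandHom_loop :
    expandHom (q⁻¹ - (a ^ 2)⁻¹ * q) = HahnSeries.single 1 alpha⁻¹ + HahnSeries.single (-1) 1 := by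
  rw [map_sub, expandHom_q_inv, map_mul, expandHom_q, a, ← map_pow, ← map_inv₀, expandHom_C,
    HahnSeries.C_mul_eq_smul, alpha_inv, sub_eq_neg_add]
  ext k
  simp [HahnSeries.coeff_single]

/-- The normalized Poincaré series. -/
def normalized (b : ℕ) (w : BraidGraph b) : (RatFunc ℚ)⸨X⸩ :=
  expandHom ((-(a * q)) ^ b) * poincare (closure w)

/-- Laurent series as a vector space over the rational functions. -/
@[reducible]
def laurentModule : Module QAQ (RatFunc ℚ)⸨X⸩ := Module.compHom _ expandHom

theorem eq_expandHom_div_mul {x y : QAQ} {f g : (RatFunc ℚ)⸨X⸩} (hx : x ≠ 0)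
    (h : expandHom x * f = expandHom y * g) : f = expandHom (y / x) * g := by
  have hx' : expandHom x ≠ 0 := (map_ne_zero expandHom).2 hx
  rw [map_div₀, div_mul_eq_mul_div, eq_div_iff hx', mul_comm, h]

theorem q_sub_inv_ne_zero : q - q⁻¹ ≠ 0 := by
  intro h
  refine q_sq_ne_one ?_
  have h1 : q * (q - q⁻¹) = q ^ 2 - 1 := by
    rw [mul_sub, mul_inv_cancel₀ q_ne_zero, pow_two]
  rw [h, mul_zero] at h1
  rw [← neg_sub, ← h1, neg_zero]

theorem poincare_widen {b : ℕ} (w : BraidGraph b) : poincare (closure (w.map widen)) =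
    expandHom ((1 - (a ^ 2)⁻¹) / (1 - q ^ 2)) * poincare (closure w) := by
  refine eq_expandHom_div_mul q_sq_ne_one ?_
  rw [expandHom_circle, map_sub, map_one, expandHom_q_sq]
  exact poincare_relO w

theorem poincare_loop {b : ℕ} (u v : BraidGraph (b + 1)) :
    poincare (closure (u.map widen ++ [lastColumn b] ++ v.map widen)) =
      expandHom ((q⁻¹ - (a ^ 2)⁻¹ * q) / (1 - q ^ 2)) * poincare (closure (u ++ v)) := by
  refine eq_expandHom_div_mul q_sq_ne_one ?_
  rw [expandHom_loop, map_sub, map_one, expandHom_q_sq]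
  exact poincare_relI u v

/-- The normalization `(-(a * q)) ^ b` contributes one factor `-(a * q)` for each strand removed.
This factor turns the coefficient obtained from the homology into the symmetric coefficient of the
MOY relation. -/
theorem circle_value : -(a * q) * ((1 - (a ^ 2)⁻¹) / (1 - q ^ 2)) = (a - a⁻¹) / (q - q⁻¹) := by
  have h1 := q_sub_inv_ne_zero
  have h2 := q_sq_ne_one
  have h3 := q_ne_zero
  have h4 := a_ne_zero
  rw [eq_div_iff h1, mul_div_assoc', div_mul_eq_mul_div, div_eq_iff h2]
  field_simp
  ring

theorem loop_value :
    -(a * q) * ((q⁻¹ - (a ^ 2)⁻¹ * q) / (1 - q ^ 2)) = (a * q⁻¹ - a⁻¹ * q) / (q - q⁻¹) := by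
  have h1 := q_sub_inv_ne_zero
  have h2 := q_sq_ne_one
  have h3 := q_ne_zero
  have h4 := a_ne_zero
  rw [eq_div_iff h1, mul_div_assoc', div_mul_eq_mul_div, div_eq_iff h2]
  field_simp
  ring

attribute [local instance] laurentModule in
theorem relations_normalized : MOYRelations normalized := by
  have hsmul : ∀ (r : QAQ) (f : (RatFunc ℚ)⸨X⸩), r • f = expandHom r * f := fun _ _ => rfl
  refine ⟨fun b u v i j hij => ?_, fun b w => ?_, fun b u v => ?_, fun b u v i => ?_,
    fun b u v i j hij => ?_⟩
  · rw [normalized, normalized, poincare_slide u v hij]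
  · rw [hsmul, normalized, normalized, poincare_widen, ← mul_assoc, ← mul_assoc, ← map_mul,
      ← map_mul, ← circle_value]
    ring_nf
  · rw [hsmul, normalized, normalized, poincare_loop, ← mul_assoc, ← mul_assoc, ← map_mul,
      ← map_mul, ← loop_value]
    ring_nf
  · rw [hsmul, normalized, normalized, poincare_relII, map_add, expandHom_q, expandHom_q_inv]
    ring
  · simp only [normalized]
    rw [← mul_add, poincare_relIII u v hij, mul_add]

theorem normalized_empty : normalized 0 [] = 1 := by
  rw [normalized, pow_zero, map_one, one_mul]
  exact poincare_empty

attribute [local instance] laurentModule in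
-- The expansions of rational functions form a `ℚ(a, q)`-subspace of the Laurent series that
-- contains the value `1` on the empty graph, so `MOYRelations.mem` puts all values into it.
theorem exists_expandHom_eq_normalized (b : ℕ) (w : BraidGraph b) :
    ∃ f, expandHom f = normalized b w := by
  let N : Submodule QAQ (RatFunc ℚ)⸨X⸩ :=
    { carrier := Set.range expandHom
      add_mem' := by
        rintro _ _ ⟨x, rfl⟩ ⟨y, rfl⟩
        exact ⟨x + y, map_add _ _ _⟩
      zero_mem' := ⟨0, map_zero _⟩
      smul_mem' := by
        rintro r _ ⟨x, rfl⟩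
        exact ⟨r * x, map_mul _ _ _⟩ }
  exact relations_normalized.mem (N := N) ⟨1, (map_one _).trans normalized_empty.symm⟩ b w

/-- The normalized Poincaré series as a rational function. -/
def rationalSeries (b : ℕ) (w : BraidGraph b) : QAQ :=
  (exists_expandHom_eq_normalized b w).choose

theorem expandHom_rationalSeries (b : ℕ) (w : BraidGraph b) :
    expandHom (rationalSeries b w) = normalized b w :=
  (exists_expandHom_eq_normalized b w).choose_spec

attribute [local instance] laurentModule in
-- Expansion is injective, so identities between expansions are identities between rational
-- functions. This solution coming from homology is the existence proof for the polynomial.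
theorem isMOYHomfly_rationalSeries : IsMOYHomfly rationalSeries := by
  have hN := relations_normalized
  have hsmul : ∀ (r : QAQ) (f : (RatFunc ℚ)⸨X⸩), r • f = expandHom r * f := fun _ _ => rfl
  refine ⟨fun b u v i j hij => expandHom_injective ?_, fun b u v => expandHom_injective ?_,
    expandHom_injective ?_, fun b w => expandHom_injective ?_, fun b u v => expandHom_injective ?_,
    fun b u v i => expandHom_injective ?_, fun b u v i j hij => expandHom_injective ?_⟩
  · simpa only [expandHom_rationalSeries] using hN.slide b u v i j hij
  · rw [expandHom_rationalSeries, expandHom_rationalSeries, normalized, normalized,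
      poincare_rotate]
  · rw [expandHom_rationalSeries, normalized_empty, map_one]
  · rw [map_mul, expandHom_rationalSeries, expandHom_rationalSeries, ← hsmul]
    exact hN.relO b w
  · rw [map_mul, expandHom_rationalSeries, expandHom_rationalSeries, ← hsmul]
    exact hN.relI b u v
  · rw [map_mul, expandHom_rationalSeries, expandHom_rationalSeries, ← hsmul]
    exact hN.relII b u v i
  · simpa only [map_add, expandHom_rationalSeries] using hN.relIII b u v i j hij

theorem isMOYHomfly_moyHomfly : IsMOYHomfly moyHomfly :=
  Classical.epsilon_spec ⟨rationalSeries, isMOYHomfly_rationalSeries⟩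

theorem poincare_eq_expand (b : ℕ) (w : BraidGraph b) :
    poincare (closure w) = expand ((-(a * q)) ^ (-(b : ℤ)) * moyHomfly b w) := by
  have h0 : -(a * q) ≠ 0 := neg_ne_zero.2 (mul_ne_zero a_ne_zero q_ne_zero)
  rw [isMOYHomfly_moyHomfly.unique isMOYHomfly_rationalSeries, ← expandHom_apply, map_mul,
    expandHom_rationalSeries, normalized, ← mul_assoc, ← map_mul, zpow_neg, zpow_natCast,
    inv_mul_cancel₀ (pow_ne_zero b h0), map_one, one_mul]

end KR

end

theorem mainTheorem10 :
    -- the MOY HOMFLY polynomial is well defined: it satisfies the MOY relations,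
    -- and it is determined by them
    (KR.IsMOYHomfly KR.moyHomfly ∧ ∀ P, KR.IsMOYHomfly P → P = KR.moyHomfly) ∧
    ∀ (b : ℕ) (D : KR.BraidGraph b),
      -- the signed Poincaré series is well defined
      (∀ i h : ℤ, Module.Finite ℚ ((KR.closure D).Homology i h)) ∧
      {h : ℤ | ∃ i : ℤ, Nontrivial ((KR.closure D).Homology i h)}.Finite ∧
      KR.poincare (KR.closure D) =
        KR.expand ((-(KR.a * KR.q)) ^ (-(b : ℤ)) * KR.moyHomfly b D) := by
  exact ⟨⟨KR.isMOYHomfly_moyHomfly, fun P hP => hP.unique KR.isMOYHomfly_moyHomfly⟩, fun b D =>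
    ⟨(KR.closure D).finite_homology, (KR.closure D).finite_support_homology,
      KR.poincare_eq_expand b D⟩⟩
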